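/- Let $G$ be a connected real reductive Lie group with compact centre, with Cartan involution $\theta$ and maximal compact subgroup $K=G^\theta$. Let $\mathfrak g_0=\mathfrak k_0\oplus\mathfrak p_0$ be the corresponding Cartan decomposition of its Lie algebra, and $\mathfrak g=\mathfrak k\oplus\mathfrak p$ the complexification. Let $B$ be a symmetric bilinear form on $\mathfrak g_0$, invariant under $G$ and under $\theta$, positive definite on $\mathfrak p_0$ and negative definite on $\mathfrak k_0$; extend it to $\mathfrak g$. Assume that $\dim\mathfrak p_0$ is even. Let $\mathrm{Cl}(\mathfrak p)$ be the Clifford algebra of $\mathfrak p$ with relations $vw+wv=-2B(v,w)$, and let $\widetilde K=\{(k,s)\in K\times \mathrm{Spin}(\mathfrak p_0): s\,v\,s^{-1}=\mathrm{Ad}(k)v \text{ for all } v\in\mathfrak p_0\}$ be the spin double cover of $K$. Choose a decomposition $\mathfrak p=W\oplus W'$ into isotropic subspaces, and let $S=\bigwedge W$ be the spin module of $\mathrm{Cl}(\mathfrak p)$ (elements of $W$ act by exterior multiplication, and $w'\in W'$ acts by contraction with $-2B(w',\cdot)$), with its decomposition $S=S^+\oplus S^-$ into even and odd parts; $\widetilde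 K$ acts on $S^\pm$ through $\mathrm{Spin}(\mathfrak p_0)\subset \mathrm{Cl}(\mathfrak p)$. Let $$D=\sum_i Y_i\otimes Z_i\in U(\mathfrak g)\otimes \mathrm{Cl}(\mathfrak p)$$ be the Dirac operator, where $(Y_i)$ is a basis of $\mathfrak p$ and $(Z_i)$ is the dual basis with respect to $B$. Let $X$ be a Harish-Chandra module, that is, a $(\mathfrak g,K)$-module: a complex vector space with a representation of $\mathfrak g$ and a locally finite continuous representation of $K$ whose differential is the action of $\mathfrak k_0$, such that $k\,(Y x)=(\mathrm{Ad}(k)Y)(k x)$ for $k\in K$, $Y\in\mathfrak g$, $x\in X$. Suppose that $X$ is admissible (each irreducible representation of $K$ has finite multiplicity in $X$) and has an infinitesimal character (the centre of $U(\mathfrak g)$ acts on $X$ by scalars, through a character). The operator $D$ acts on $X\otimes S$ and exchanges $X\otimes S^+$ and $X\otimes S^-$, and $\widetilde K$ acts on $X\otimes S$, commuting with $D$. Put $$H_{\mathrm{Dir}}(X)=\ker D/(\ker D\cap \mathrm{Im}\, D),$$ and let $H_{\mathrm{Dir}}(X)^\pm$ be the image of $\ker D\cap (X\otimes S^\pm)$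 in it. Then $H_{\mathrm{Dir}}(X)^{+}$ and $H_{\mathrm{Dir}}(X)^-$ are finite-dimensional continuous representations of $\widetilde K$, every irreducible (continuous, finite-dimensional, complex) representation $\gamma$ of $\widetilde K$ has finite multiplicity in $X\otimes S^{+}$ and in $X\otimes S^-$, and the Dirac index $I_{\mathrm{Dir}}(X)=H_{\mathrm{Dir}}(X)^+-H_{\mathrm{Dir}}(X)^-$ satisfies $$I_{\mathrm{Dir}}(X)=X\otimes S^+-X\otimes S^-$$ as virtual $\widetilde K$-representations, in $\prod_{\gamma}\mathbb Z$ where $\gamma$ runs over the irreducible representations of $\widetilde K$: for every $\gamma$, $$m_\gamma\big(H_{\mathrm{Dir}}(X)^+\big)-m_\gamma\big(H_{\mathrm{Dir}}(X)^-\big)=m_\gamma(X\otimes S^+)-m_\gamma(X\otimes S^-),$$ where $m_\gamma(V)=\dim \mathrm{Hom}_{\widetilde K}(\gamma,V)$. -/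

import Mathlib

open scoped Manifold ContDiff TensorProduct

noncomputable section

namespace DiracIndex

/-! ### Representations -/

section Representations

universe v w

/-- A (possibly infinite-dimensional) complex representation all of whose matrix coefficients are
continuous. In finite dimension this is the usual continuity. -/
def IsContinuousRep {H : Type v} [Group H] [TopologicalSpace H] {V : Type w} [AddCommGroup V]
    [Module ℂ V] (ρ : Representation ℂ H V) : Prop :=
  ∀ (x : V) (φ : Module.Dual ℂ V), Continuous fun h : H => φ (ρ h x)

/-- A continuous irreducible finite-dimensional complex representation of a topological group,
realized on some `ℂⁿ`. Every class in the (finite-dimensional) unitary dual of a compact group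
is represented by such an object. -/
structure FDIrrep (H : Type v) [Group H] [TopologicalSpace H] where
  dim : ℕ
  ρ : Representation ℂ H (Fin dim → ℂ)
  irreducible : ρ.IsIrreducible
  continuous : IsContinuousRep ρ

/-- The multiplicity `dim Hom_H(γ, V)` of the irreducible representation `γ` in `V`. It is only
meaningful when `Hom_H(γ, V)` is finite-dimensional. -/
def multiplicity {H : Type v} [Group H] [TopologicalSpace H] {V : Type w} [AddCommGroup V]
    [Module ℂ V] (γ : FDIrrep H) (σ : Representation ℂ H V) : ℕ :=
  Module.finrank ℂ (Representation.IntertwiningMap γ.ρ σ)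

/-- Every irreducible representation of `H` occurs with finite multiplicity in `V`. -/
def HasFiniteMultiplicities {H : Type v} [Group H] [TopologicalSpace H] {V : Type w}
    [AddCommGroup V] [Module ℂ V] (σ : Representation ℂ H V) : Prop :=
  ∀ γ : FDIrrep H, Module.Finite ℂ (Representation.IntertwiningMap γ.ρ σ)

end Representations

/-! ### Lie groups, adjoint action, Cartan involutions -/

section LieGroups

universe u v

instance : ENat.LEInfty (minSmoothness ℝ 3) := by
  rw [minSmoothness_of_isRCLikeNormedField]; infer_instance

/-- The Lie algebra `𝔤₀` of the real Lie group `G`. -/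
abbrev LieAlg (E : Type u) [NormedAddCommGroup E] [NormedSpace ℝ E] (G : Type v)
    [TopologicalSpace G] [ChartedSpace E G] [Group G] : Type u :=
  GroupLieAlgebra 𝓘(ℝ, E) G

variable {E : Type u} [NormedAddCommGroup E] [NormedSpace ℝ E] {G : Type v}
  [TopologicalSpace G] [ChartedSpace E G] [Group G]

/-- The curve `c` in `G` satisfies `c 0 = 1` and `c' 0 = Z`. -/
def HasVelocityAtOne (c : ℝ → G) (Z : LieAlg E G) : Prop :=
  c 0 = 1 ∧ HasMFDerivAt 𝓘(ℝ, ℝ) 𝓘(ℝ, E) c 0 (ContinuousLinearMap.toSpanSingleton ℝ (Z : E))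

/-- The differential at `1` of a map `f : G → G` with `f 1 = 1`. -/
def diffAtOne (f : G → G) : LieAlg E G →ₗ[ℝ] LieAlg E G :=
  { toFun := fun X => mfderiv 𝓘(ℝ, E) 𝓘(ℝ, E) f 1 X
    map_add' := fun X Y => (mfderiv 𝓘(ℝ, E) 𝓘(ℝ, E) f 1).map_add X Y
    map_smul' := fun a X => (mfderiv 𝓘(ℝ, E) 𝓘(ℝ, E) f 1).map_smul a X }

/-- The adjoint action of `g ∈ G` on the Lie algebra: the differential at `1` of `x ↦ g x g⁻¹`. -/
def Ad (g : G) : LieAlg E G →ₗ[ℝ] LieAlg E G :=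
  diffAtOne fun x => g * x * g⁻¹

theorem diffAtOne_comp {f h : G → G} (hf : MDifferentiableAt 𝓘(ℝ, E) 𝓘(ℝ, E) f 1)
    (hh : MDifferentiableAt 𝓘(ℝ, E) 𝓘(ℝ, E) h 1) (h1 : h 1 = 1) (X : LieAlg E G) :
    diffAtOne (fun x => f (h x)) X = diffAtOne f (diffAtOne (E := E) h X) := by
  have key := mfderiv_comp (I := 𝓘(ℝ, E)) (I' := 𝓘(ℝ, E)) (I'' := 𝓘(ℝ, E)) (1 : G)
    (f := h) (g := f) (by rw [h1]; exact hf) hh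
  have aux : ∀ y : G, y = 1 → ∀ v : E, (mfderiv 𝓘(ℝ, E) 𝓘(ℝ, E) f y v : E)
      = (mfderiv 𝓘(ℝ, E) 𝓘(ℝ, E) f 1 v : E) := by
    rintro _ rfl _; rfl
  exact (congrArg (fun L => (L X : E)) key).trans (aux (h 1) h1 _)

theorem mdifferentiableAt_conj [LieGroup 𝓘(ℝ, E) ∞ G] (g x : G) :
    MDifferentiableAt 𝓘(ℝ, E) 𝓘(ℝ, E) (fun x : G => g * x * g⁻¹) x := by
  have h : ContMDiff 𝓘(ℝ, E) 𝓘(ℝ, E) ∞ (fun x : G => g * x * g⁻¹) :=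
    (contMDiff_mul_right (I := 𝓘(ℝ, E)) (n := ∞) (a := g⁻¹)).comp
      (contMDiff_mul_left (I := 𝓘(ℝ, E)) (n := ∞) (a := g))
  exact h.mdifferentiableAt (by simp)

theorem Ad_one (X : LieAlg E G) : Ad (1 : G) X = X := by
  have e : (fun x : G => 1 * x * 1⁻¹) = id := by funext x; simp
  unfold Ad
  rw [e]
  exact congrArg (fun L => (L X : E)) (mfderiv_id (I := 𝓘(ℝ, E)) (x := (1 : G)))

theorem Ad_mul [LieGroup 𝓘(ℝ, E) ∞ G] (g h : G) (X : LieAlg E G) :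
    Ad (g * h) X = Ad g (Ad h X) := by
  have e : (fun x : G => g * h * x * (g * h)⁻¹)
      = fun x => (fun y => g * y * g⁻¹) ((fun z => h * z * h⁻¹) x) := by
    funext x; simp [mul_assoc]
  unfold Ad
  rw [e]
  exact diffAtOne_comp (mdifferentiableAt_conj g 1) (mdifferentiableAt_conj h 1) (by simp) X

end LieGroups

/-! ### Connected real reductive groups and the spin cover of `K` -/

section Complexification

universe u

/-- The complexification `ℂ ⊗ L` of a real Lie algebra `L`. -/
def Complexification (L : Type u) [LieRing L] [LieAlgebra ℝ L] : Type u := ℂ ⊗[ℝ] L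

variable {L : Type u} [LieRing L] [LieAlgebra ℝ L]

instance : LieRing (Complexification L) := inferInstanceAs (LieRing (ℂ ⊗[ℝ] L))

instance : LieAlgebra ℂ (Complexification L) := inferInstanceAs (LieAlgebra ℂ (ℂ ⊗[ℝ] L))

/-- The inclusion of `L` in its complexification. -/
def toComplexification (x : L) : Complexification L := (1 : ℂ) ⊗ₜ[ℝ] x

theorem toComplexification_add (x y : L) :
    toComplexification (x + y) = toComplexification x + toComplexification y :=
  TensorProduct.tmul_add _ _ _

theorem toComplexification_smul (c : ℝ) (x : L) :
    toComplexification (c • x) = (c : ℂ) • toComplexification x := by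
  have e : (1 : ℂ) ⊗ₜ[ℝ] (c • x) = (c : ℂ) • ((1 : ℂ) ⊗ₜ[ℝ] x) := by
    rw [← TensorProduct.smul_tmul, TensorProduct.smul_tmul']
    simp
  exact e

end Complexification

section Reductive

universe u v

/-- A reductive structure, with compact centre, on the (connected) real Lie group `G`: a Cartan
involution `θ` of `G` whose group of fixed points `K` is a maximal compact subgroup, together with
an invariant nondegenerate symmetric bilinear form `B` on `𝔤₀`, compatible with `θ`, positive
definite on `𝔭₀` and negative definite on `𝔨₀` (the `∓1` eigenspaces of `θ`).
Since `-B(·, θ ·)` is an inner product for which `ad(𝔤₀)` is stable under transposition, `𝔤₀` is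
automatically a reductive Lie algebra. -/
structure ReductiveStructure (E : Type u) [NormedAddCommGroup E] [NormedSpace ℝ E] (G : Type v)
    [TopologicalSpace G] [ChartedSpace E G] [Group G] [LieGroup 𝓘(ℝ, E) ∞ G] where
  θ : G →* G
  contMDiff_θ : ContMDiff 𝓘(ℝ, E) 𝓘(ℝ, E) ∞ θ
  θ_θ : ∀ g, θ (θ g) = g
  isCompact_fixed : IsCompact {g : G | θ g = g}
  maximal_compact : ∀ L : Subgroup G, IsCompact (L : Set G) → (∀ g, θ g = g → g ∈ L) →
    ∀ g ∈ L, θ g = g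
  isCompact_center : IsCompact (Subgroup.center G : Set G)
  B : LinearMap.BilinForm ℝ (LieAlg E G)
  B_symm : ∀ X Y, B X Y = B Y X
  B_Ad : ∀ (g : G) (X Y), B (Ad g X) (Ad g Y) = B X Y
  B_lie : ∀ X Y Z : LieAlg E G, B ⁅X, Y⁆ Z = B X ⁅Y, Z⁆
  B_θ : ∀ X Y, B (diffAtOne θ X) (diffAtOne θ Y) = B X Y
  B_pos : ∀ X, diffAtOne θ X = -X → X ≠ 0 → 0 < B X X
  B_neg : ∀ X, diffAtOne θ X = X → X ≠ 0 → B X X < 0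

instance {E : Type u} [NormedAddCommGroup E] [NormedSpace ℝ E] [FiniteDimensional ℝ E]
    {G : Type v} [TopologicalSpace G] [ChartedSpace E G] [Group G] :
    FiniteDimensional ℝ (LieAlg E G) :=
  inferInstanceAs (FiniteDimensional ℝ E)

namespace ReductiveStructure

variable {E : Type u} [NormedAddCommGroup E] [NormedSpace ℝ E] {G : Type v}
  [TopologicalSpace G] [ChartedSpace E G] [Group G] [LieGroup 𝓘(ℝ, E) ∞ G]
  (R : ReductiveStructure E G)

/-- The maximal compact subgroup `K = G^θ`. -/
def K : Subgroup G where
  carrier := {g | R.θ g = g}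
  mul_mem' := fun {a b} ha hb => by
    simp only [Set.mem_ofPred_eq] at *
    rw [map_mul, ha, hb]
  one_mem' := map_one _
  inv_mem' := fun {a} ha => by
    simp only [Set.mem_ofPred_eq] at *
    rw [map_inv, ha]

/-- The subspace `𝔭₀` of `𝔤₀`: the `-1` eigenspace of the differential of `θ`. (The Lie algebra
`𝔨₀` of `K` is the `+1` eigenspace.) -/
def p₀ : Submodule ℝ (LieAlg E G) where
  carrier := {X | diffAtOne R.θ X = -X}
  add_mem' := fun {a b} ha hb => by
    simp only [Set.mem_ofPred_eq] at *
    rw [map_add, ha, hb, neg_add]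
  zero_mem' := by simp
  smul_mem' := fun c X hX => by
    simp only [Set.mem_ofPred_eq] at *
    rw [map_smul, hX, smul_neg]

theorem Ad_mem_p₀ (k : R.K) {X : LieAlg E G} (hX : X ∈ R.p₀) : Ad (k : G) X ∈ R.p₀ := by
  have hk : R.θ k = k := k.2
  have hθ : MDifferentiableAt 𝓘(ℝ, E) 𝓘(ℝ, E) R.θ 1 := R.contMDiff_θ.mdifferentiableAt (by simp)
  have h1 := diffAtOne_comp (E := E) (f := R.θ) (h := fun x : G => (k : G) * x * (k : G)⁻¹) hθ
    (mdifferentiableAt_conj _ _) (by simp) X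
  have h2 := diffAtOne_comp (E := E) (h := R.θ) (f := fun x : G => (k : G) * x * (k : G)⁻¹)
    (mdifferentiableAt_conj _ _) hθ (map_one _) X
  have e : (fun x : G => R.θ ((k : G) * x * (k : G)⁻¹))
      = fun x : G => (k : G) * R.θ x * (k : G)⁻¹ := by
    funext x; rw [map_mul, map_mul, map_inv, hk]
  change diffAtOne R.θ (Ad (k : G) X) = -Ad (k : G) X
  have hX' : diffAtOne R.θ X = -X := hX
  unfold Ad
  rw [← h1, e, h2, hX', map_neg]

/-- The action of `K` on `𝔭₀` by the adjoint action. -/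
def AdP (k : R.K) : R.p₀ →ₗ[ℝ] R.p₀ :=
  (Ad (k : G)).restrict fun _ hX => R.Ad_mem_p₀ k hX

@[simp] theorem coe_AdP (k : R.K) (X : R.p₀) : (R.AdP k X : LieAlg E G) = Ad (E := E) (k : G) X := rfl

theorem AdP_one (X : R.p₀) : R.AdP 1 X = X := Subtype.ext (Ad_one (E := E) (X : LieAlg E G))

theorem AdP_mul (k l : R.K) (X : R.p₀) : R.AdP (k * l) X = R.AdP k (R.AdP l X) :=
  Subtype.ext (Ad_mul (E := E) (k : G) (l : G) (X : LieAlg E G))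

/-- The restriction of `B` to `𝔭₀`. -/
def Bp₀ : LinearMap.BilinForm ℝ R.p₀ := R.B.restrict R.p₀

theorem Bp₀_symm : R.Bp₀.IsSymm := ⟨fun _ _ => R.B_symm _ _⟩

theorem Bp₀_nondegenerate : R.Bp₀.Nondegenerate := by
  refine (LinearMap.IsRefl.nondegenerate_iff_separatingLeft R.Bp₀_symm.isRefl).2 fun X hX => ?_
  by_contra h
  exact (R.B_pos X X.2 fun h' => h (Subtype.ext h')).ne' (hX X)

theorem Bp₀_AdP (k : R.K) (X Y : R.p₀) : R.Bp₀ (R.AdP k X) (R.AdP k Y) = R.Bp₀ X Y :=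
  R.B_Ad _ _ _

/-- The quadratic form `v ↦ -B(v, v)` on `𝔭₀`: the Clifford relations are
`v w + w v = -2 B(v, w)`. -/
def Q₀ : QuadraticForm ℝ R.p₀ := -R.Bp₀.toQuadraticMap

/-- The real Clifford algebra of `𝔭₀`. -/
abbrev Cl₀ : Type u := CliffordAlgebra R.Q₀

/-- The usual topology of the finite-dimensional real vector space `Cl(𝔭₀)`. -/
instance : TopologicalSpace R.Cl₀ := moduleTopology ℝ _

/-- The spin double cover `K̃` of `K`: the fibre product of `K` and `Spin(𝔭₀)` over `SO(𝔭₀)`, that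
is, all pairs `(k, s)` such that `s v s⁻¹ = Ad(k) v` in `Cl(𝔭₀)` for `v ∈ 𝔭₀`. Its topology is that
of a subspace of `G × Cl(𝔭₀)`. -/
def Ktilde : Subgroup (R.K × spinGroup R.Q₀) where
  carrier := {x | ∀ v : R.p₀, (x.2 : R.Cl₀) * CliffordAlgebra.ι R.Q₀ v
    = CliffordAlgebra.ι R.Q₀ (R.AdP x.1 v) * (x.2 : R.Cl₀)}
  mul_mem' := fun {a b} ha hb v => by
    change (a.2 : R.Cl₀) * (b.2 : R.Cl₀) * _ = CliffordAlgebra.ι R.Q₀ (R.AdP (a.1 * b.1) v)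
      * ((a.2 : R.Cl₀) * (b.2 : R.Cl₀))
    rw [mul_assoc, hb v, ← mul_assoc, ha, AdP_mul, mul_assoc]
  one_mem' := fun v => by
    change (1 : R.Cl₀) * _ = CliffordAlgebra.ι R.Q₀ (R.AdP 1 v) * (1 : R.Cl₀)
    rw [one_mul, AdP_one, mul_one]
  inv_mem' := fun {a} ha v => by
    have h := ha (R.AdP a.1⁻¹ v)
    rw [← AdP_mul, mul_inv_cancel, AdP_one] at h
    have h1 : ((a⁻¹).2 : R.Cl₀) * (a.2 : R.Cl₀) = 1 := spinGroup.coe_star_mul_self a.2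
    have h2 : (a.2 : R.Cl₀) * ((a⁻¹).2 : R.Cl₀) = 1 := spinGroup.coe_mul_star_self a.2
    change ((a⁻¹).2 : R.Cl₀) * CliffordAlgebra.ι R.Q₀ v
      = CliffordAlgebra.ι R.Q₀ (R.AdP a.1⁻¹ v) * ((a⁻¹).2 : R.Cl₀)
    calc ((a⁻¹).2 : R.Cl₀) * CliffordAlgebra.ι R.Q₀ v
        = ((a⁻¹).2 : R.Cl₀) * (CliffordAlgebra.ι R.Q₀ v * (a.2 : R.Cl₀)) * ((a⁻¹).2 : R.Cl₀) := by
          rw [mul_assoc, mul_assoc, h2, mul_one]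
      _ = ((a⁻¹).2 : R.Cl₀) * ((a.2 : R.Cl₀) * CliffordAlgebra.ι R.Q₀ (R.AdP a.1⁻¹ v))
          * ((a⁻¹).2 : R.Cl₀) := by rw [h]
      _ = _ := by rw [← mul_assoc, h1, one_mul]

/-- The projection `K̃ → K`. -/
def KtildeToK : R.Ktilde →* R.K :=
  (MonoidHom.fst R.K (spinGroup R.Q₀)).comp R.Ktilde.subtype

/-! ### Complexifications, the Clifford algebra and the spin module -/

/-- The complexified Lie algebra `𝔤`. -/
abbrev 𝔤 [CompleteSpace E] (_R : ReductiveStructure E G) : Type u := Complexification (LieAlg E G)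

/-- The inclusion `𝔤₀ → 𝔤`. -/
def toG [CompleteSpace E] (Y : LieAlg E G) : R.𝔤 := toComplexification Y

/-- The complexification `𝔭` of `𝔭₀`. -/
abbrev 𝔭 : Type u := ℂ ⊗[ℝ] R.p₀

/-- The complex bilinear extension of `B` to `𝔭`. -/
def Bp : LinearMap.BilinForm ℂ R.𝔭 := R.Bp₀.baseChange ℂ

theorem Bp_symm (v w : R.𝔭) : R.Bp v w = R.Bp w v :=
  (LinearMap.BilinForm.IsSymm.baseChange ℂ (B₂ := R.Bp₀) ⟨fun X Y => R.Bp₀_symm.eq X Y⟩).eq v w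

/-- The quadratic form `v ↦ -B(v, v)` on `𝔭`. -/
def Q : QuadraticForm ℂ R.𝔭 := -R.Bp.toQuadraticMap

/-- The Clifford algebra `Cl(𝔭)`, with relations `v w + w v = -2 B(v, w)`. -/
abbrev Cl : Type u := CliffordAlgebra R.Q

/-- The inclusion `Cl(𝔭₀) → Cl(𝔭)`. -/
def clToCl : R.Cl₀ →ₐ[ℝ] R.Cl :=
  CliffordAlgebra.lift R.Q₀
    ⟨((CliffordAlgebra.ι R.Q).restrictScalars ℝ).comp (TensorProduct.mk ℝ ℂ R.p₀ 1), fun v => by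
      change CliffordAlgebra.ι R.Q ((1 : ℂ) ⊗ₜ[ℝ] v) * CliffordAlgebra.ι R.Q ((1 : ℂ) ⊗ₜ[ℝ] v) = _
      rw [CliffordAlgebra.ι_sq_scalar, IsScalarTower.algebraMap_apply ℝ ℂ R.Cl]
      congr 1
      simp [Q, Q₀, Bp, LinearMap.BilinForm.baseChange_tmul]⟩

theorem clToCl_ι (v : R.p₀) :
    R.clToCl (CliffordAlgebra.ι R.Q₀ v) = CliffordAlgebra.ι R.Q ((1 : ℂ) ⊗ₜ[ℝ] v) :=
  CliffordAlgebra.lift_ι_apply _ _ _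

theorem clToCl_mul (a b : R.Cl₀) : R.clToCl (a * b) = R.clToCl a * R.clToCl b :=
  map_mul R.clToCl a b

/-- The universal enveloping algebra `U(𝔤)`. -/
abbrev U [CompleteSpace E] : Type u := UniversalEnvelopingAlgebra ℂ R.𝔤

/-- The algebra `𝒜 = U(𝔤) ⊗ Cl(𝔭)`. -/
abbrev A [CompleteSpace E] : Type u := R.U ⊗[ℂ] R.Cl

/-- The Dirac operator `D = ∑ Yᵢ ⊗ Zᵢ ∈ U(𝔤) ⊗ Cl(𝔭)`, where `(Yᵢ)` is a basis of `𝔭` and `(Zᵢ)` is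
the dual basis with respect to `B`. As `D` does not depend on the basis, one that comes from a basis
of `𝔭₀` is used. -/
def D [CompleteSpace E] [FiniteDimensional ℝ E] : R.A :=
  ∑ i, UniversalEnvelopingAlgebra.ι ℂ (R.toG (Module.finBasis ℝ R.p₀ i : LieAlg E G)) ⊗ₜ[ℂ]
    CliffordAlgebra.ι R.Q
      ((1 : ℂ) ⊗ₜ[ℝ] R.Bp₀.dualBasis R.Bp₀_nondegenerate (Module.finBasis ℝ R.p₀) i)

theorem wedge_add_contract_sq {V : Type*} [AddCommGroup V] [Module ℂ V] (w : V)
    (d : Module.Dual ℂ V) (x : ExteriorAlgebra ℂ V) :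
    CliffordAlgebra.ι (0 : QuadraticForm ℂ V) w *
        (CliffordAlgebra.ι (0 : QuadraticForm ℂ V) w * x + CliffordAlgebra.contractLeft d x)
      + CliffordAlgebra.contractLeft d
        (CliffordAlgebra.ι (0 : QuadraticForm ℂ V) w * x + CliffordAlgebra.contractLeft d x)
      = d w • x := by
  rw [map_add, CliffordAlgebra.contractLeft_ι_mul, CliffordAlgebra.contractLeft_contractLeft,
    mul_add, ← mul_assoc, CliffordAlgebra.ι_sq_scalar]
  simp

/-- A decomposition `𝔭 = W ⊕ W'` into isotropic subspaces (necessarily put in duality by `B`). It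
exists if and only if the dimension of `𝔭` is even. -/
structure Polarization where
  W : Submodule ℂ R.𝔭
  W' : Submodule ℂ R.𝔭
  isCompl : IsCompl W W'
  isotropic : ∀ v ∈ W, ∀ w ∈ W, R.Bp v w = 0
  isotropic' : ∀ v ∈ W', ∀ w ∈ W', R.Bp v w = 0

namespace Polarization

variable {R} (P : R.Polarization)

/-- The space `S = ⋀ W` of spinors. -/
abbrev S : Type u := ExteriorAlgebra ℂ P.W

/-- The Clifford action of `v = w + w' ∈ 𝔭 = W ⊕ W'` on `S`: exterior multiplication by `w` plus
contraction with the linear form `-2 B(w', ·)` on `W`. -/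
def cliffordMap : R.𝔭 →ₗ[ℂ] Module.End ℂ P.S :=
  (LinearMap.mul ℂ P.S).comp
      ((ExteriorAlgebra.ι ℂ).comp (P.W.projectionOnto P.W' P.isCompl))
    + (CliffordAlgebra.contractLeft (Q := (0 : QuadraticForm ℂ P.W))).comp
      ((-2 : ℂ) • (Submodule.dualRestrict P.W).comp
        (LinearMap.comp R.Bp (P.W'.subtype.comp (P.W'.projectionOnto P.W P.isCompl.symm))))

theorem cliffordMap_apply (v : R.𝔭) (x : P.S) : P.cliffordMap v x =
    CliffordAlgebra.ι (0 : QuadraticForm ℂ P.W) (P.W.projectionOnto P.W' P.isCompl v) * x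
      + CliffordAlgebra.contractLeft (Q := (0 : QuadraticForm ℂ P.W))
          ((-2 : ℂ) • Submodule.dualRestrict P.W
            (R.Bp (P.W'.projectionOnto P.W P.isCompl.symm v))) x := rfl

/-- The Clifford action of `v ∈ 𝔭₀` on the spinor `s`. -/
def cliffordReal (s : P.S) (v : R.p₀) : P.S := P.cliffordMap ((1 : ℂ) ⊗ₜ[ℝ] v) s

theorem cliffordReal_add (s : P.S) (u u' : R.p₀) :
    P.cliffordReal s (u + u') = P.cliffordReal s u + P.cliffordReal s u' := by
  unfold cliffordReal
  rw [TensorProduct.tmul_add, map_add, LinearMap.add_apply]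

theorem cliffordReal_smul (s : P.S) (c : ℝ) (u : R.p₀) :
    P.cliffordReal s (c • u) = (c : ℂ) • P.cliffordReal s u := by
  have e : (1 : ℂ) ⊗ₜ[ℝ] (c • u) = (c : ℂ) • ((1 : ℂ) ⊗ₜ[ℝ] u) := by
    rw [← TensorProduct.smul_tmul, TensorProduct.smul_tmul']
    simp
  unfold cliffordReal
  rw [e, map_smul, LinearMap.smul_apply]

theorem cliffordMap_sq (v : R.𝔭) :
    P.cliffordMap v * P.cliffordMap v = algebraMap ℂ (Module.End ℂ P.S) (R.Q v) := by
  set w := P.W.projectionOnto P.W' P.isCompl v with hw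
  set w' := P.W'.projectionOnto P.W P.isCompl.symm v with hw'
  have hv : (w : R.𝔭) + (w' : R.𝔭) = v :=
    Submodule.projection_add_projection_eq_self P.isCompl v
  have hQ : R.Q v = -2 * R.Bp w' w := by
    have h1 := P.isotropic w w.2 w w.2
    have h2 := P.isotropic' w' w'.2 w' w'.2
    have h3 := R.Bp_symm w w'
    rw [← hv]
    simp only [Q, neg_apply, LinearMap.BilinMap.toQuadraticMap_apply, map_add,
      LinearMap.add_apply, h1, h2, h3]
    ring
  have hd : ((-2 : ℂ) • Submodule.dualRestrict P.W (R.Bp (w' : R.𝔭))) w = R.Q v := hQ.symm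
  refine LinearMap.ext fun x => ?_
  rw [← hd]
  exact wedge_add_contract_sq w _ x

/-- The simple `Cl(𝔭)`-module structure of `S`. -/
def spinAction : R.Cl →ₐ[ℂ] Module.End ℂ P.S :=
  CliffordAlgebra.lift R.Q ⟨P.cliffordMap, P.cliffordMap_sq⟩

/-- The half-spin modules: `S⁺ = ⋀ᵉᵛᵉⁿ W` for `ε = 0` and `S⁻ = ⋀ᵒᵈᵈ W` for `ε = 1`. -/
def halfSpin (ε : ZMod 2) : Submodule ℂ P.S :=
  CliffordAlgebra.evenOdd (0 : QuadraticForm ℂ P.W) ε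

theorem ι_mul_mem_halfSpin (w : P.W) (ε : ZMod 2) {x : P.S} (hx : x ∈ P.halfSpin ε) :
    CliffordAlgebra.ι (0 : QuadraticForm ℂ P.W) w * x ∈ P.halfSpin (ε + 1) := by
  rw [add_comm]
  exact SetLike.mul_mem_graded (A := CliffordAlgebra.evenOdd (0 : QuadraticForm ℂ P.W))
    (CliffordAlgebra.ι_mem_evenOdd_one _ w) hx

theorem contractLeft_mem_halfSpin (d : Module.Dual ℂ P.W) (ε : ZMod 2) {x : P.S}
    (hx : x ∈ P.halfSpin ε) :
    CliffordAlgebra.contractLeft (Q := (0 : QuadraticForm ℂ P.W)) d x ∈ P.halfSpin (ε + 1) := by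
  have step : ∀ (ε : ZMod 2) (m₁ m₂ : P.W) (x : P.S), x ∈ P.halfSpin ε →
      CliffordAlgebra.contractLeft (Q := (0 : QuadraticForm ℂ P.W)) d x ∈ P.halfSpin (ε + 1) →
      CliffordAlgebra.contractLeft (Q := (0 : QuadraticForm ℂ P.W)) d
        (CliffordAlgebra.ι _ m₁ * CliffordAlgebra.ι _ m₂ * x) ∈ P.halfSpin (ε + 1) := by
    intro ε m₁ m₂ x hx h
    rw [mul_assoc, CliffordAlgebra.contractLeft_ι_mul, CliffordAlgebra.contractLeft_ι_mul]
    have e : ε + 1 + 1 + 1 = ε + 1 := by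
      rw [add_assoc ε 1 1, show (1 + 1 : ZMod 2) = 0 from rfl, add_zero]
    refine Submodule.sub_mem _ (Submodule.smul_mem _ _ (P.ι_mul_mem_halfSpin m₂ ε hx)) ?_
    rw [mul_sub, mul_smul_comm]
    refine Submodule.sub_mem _ (Submodule.smul_mem _ _ (P.ι_mul_mem_halfSpin m₁ ε hx)) ?_
    rw [← e]
    exact P.ι_mul_mem_halfSpin m₁ _ (P.ι_mul_mem_halfSpin m₂ _ h)
  have hε : ∀ ε : ZMod 2, ε = 0 ∨ ε = 1 := by decide
  rcases hε ε with rfl | rfl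
  · refine CliffordAlgebra.even_induction (0 : QuadraticForm ℂ P.W)
      (motive := fun x _ => CliffordAlgebra.contractLeft d x ∈ P.halfSpin (0 + 1))
      (fun r => ?_) (fun x y _ _ h₁ h₂ => ?_) (fun m₁ m₂ x hx h => step 0 m₁ m₂ x hx h) x hx
    · rw [CliffordAlgebra.contractLeft_algebraMap]; exact Submodule.zero_mem _
    · rw [map_add]; exact Submodule.add_mem _ h₁ h₂
  · refine CliffordAlgebra.odd_induction (0 : QuadraticForm ℂ P.W)
      (P := fun x _ => CliffordAlgebra.contractLeft d x ∈ P.halfSpin (1 + 1))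
      (fun v => ?_) (fun x y _ _ h₁ h₂ => ?_) (fun m₁ m₂ x hx h => step 1 m₁ m₂ x hx h) x hx
    · rw [CliffordAlgebra.contractLeft_ι]; exact SetLike.algebraMap_mem_graded (CliffordAlgebra.evenOdd (0 : QuadraticForm ℂ P.W)) _
    · rw [map_add]; exact Submodule.add_mem _ h₁ h₂

theorem cliffordMap_mem_halfSpin (v : R.𝔭) (ε : ZMod 2) {x : P.S} (hx : x ∈ P.halfSpin ε) :
    P.cliffordMap v x ∈ P.halfSpin (ε + 1) := by
  rw [cliffordMap_apply]
  exact Submodule.add_mem _ (P.ι_mul_mem_halfSpin _ ε hx) (P.contractLeft_mem_halfSpin _ ε hx)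

theorem spinAction_ι (v : R.𝔭) : P.spinAction (CliffordAlgebra.ι R.Q v) = P.cliffordMap v :=
  CliffordAlgebra.lift_ι_apply _ _ _

theorem spinAction_mul_apply (a b : R.Cl) (x : P.S) :
    P.spinAction (a * b) x = P.spinAction a (P.spinAction b x) :=
  LinearMap.congr_fun (map_mul P.spinAction a b) x

theorem spinAction_clToCl_mul_apply (a b : R.Cl₀) (x : P.S) :
    P.spinAction (R.clToCl (a * b)) x = P.spinAction (R.clToCl a) (P.spinAction (R.clToCl b) x) :=
  (LinearMap.congr_fun (congrArg P.spinAction (R.clToCl_mul a b)) x).trans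
    (P.spinAction_mul_apply _ _ x)

theorem spinAction_clToCl_ι (v : R.p₀) :
    P.spinAction (R.clToCl (CliffordAlgebra.ι R.Q₀ v)) = P.cliffordMap ((1 : ℂ) ⊗ₜ[ℝ] v) :=
  (congrArg P.spinAction (R.clToCl_ι v)).trans (P.spinAction_ι _)

theorem spinAction_ι_mul_ι_mem (m₁ m₂ : R.p₀) (a : R.Cl₀) (ε : ZMod 2) (x : P.S)
    (h : P.spinAction (R.clToCl a) x ∈ P.halfSpin ε) :
    P.spinAction (R.clToCl (CliffordAlgebra.ι R.Q₀ m₁ * CliffordAlgebra.ι R.Q₀ m₂ * a)) x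
      ∈ P.halfSpin ε := by
  have e : ε + 1 + 1 = ε := by
    rw [add_assoc ε 1 1, show (1 + 1 : ZMod 2) = 0 from rfl, add_zero]
  have := P.cliffordMap_mem_halfSpin ((1 : ℂ) ⊗ₜ[ℝ] m₁) _
    (P.cliffordMap_mem_halfSpin ((1 : ℂ) ⊗ₜ[ℝ] m₂) _ h)
  rw [e] at this
  rw [mul_assoc, spinAction_clToCl_mul_apply, spinAction_clToCl_mul_apply, spinAction_clToCl_ι,
    spinAction_clToCl_ι]
  exact this

theorem spinAction_even_mem_halfSpin {a : R.Cl₀} (ha : a ∈ CliffordAlgebra.evenOdd R.Q₀ 0)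
    (ε : ZMod 2) {x : P.S} (hx : x ∈ P.halfSpin ε) :
    P.spinAction (R.clToCl a) x ∈ P.halfSpin ε := by
  refine CliffordAlgebra.even_induction R.Q₀
      (motive := fun a _ => P.spinAction (R.clToCl a) x ∈ P.halfSpin ε)
      (fun r => ?_) (fun a b _ _ h₁ h₂ => ?_)
      (fun m₁ m₂ a _ h => P.spinAction_ι_mul_ι_mem m₁ m₂ a ε x h) a ha
  · rw [AlgHom.commutes R.clToCl r, IsScalarTower.algebraMap_apply ℝ ℂ R.Cl,
      AlgHom.commutes P.spinAction]
    exact Submodule.smul_mem (P.halfSpin ε) _ hx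
  · rw [map_add, map_add, LinearMap.add_apply]
    exact Submodule.add_mem _ h₁ h₂

/-- The spin representation of `K̃` on `S`, through `K̃ → Spin(𝔭₀) → Cl(𝔭)`. -/
def spinRep : Representation ℂ R.Ktilde P.S :=
  (((P.spinAction.toMonoidHom.comp R.clToCl.toMonoidHom).comp
    (spinGroup R.Q₀).subtype).comp (MonoidHom.snd R.K (spinGroup R.Q₀))).comp R.Ktilde.subtype

theorem spinRep_apply (x : R.Ktilde) :
    P.spinRep x = P.spinAction (R.clToCl (x.1.2 : R.Cl₀)) := rfl

theorem spinRep_mem_halfSpin (x : R.Ktilde) (ε : ZMod 2) {y : P.S} (hy : y ∈ P.halfSpin ε) :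
    P.spinRep x y ∈ P.halfSpin ε :=
  P.spinAction_even_mem_halfSpin (spinGroup.mem_even x.1.2.2) ε hy

theorem spinRep_cliffordMap (x : R.Ktilde) (v : R.p₀) (y : P.S) :
    P.spinRep x (P.cliffordMap ((1 : ℂ) ⊗ₜ[ℝ] v) y) =
      P.cliffordMap ((1 : ℂ) ⊗ₜ[ℝ] R.AdP (R.KtildeToK x) v) (P.spinRep x y) := by
  have h := congrArg (fun a => P.spinAction (R.clToCl a)) (x.2 v)
  simp only [map_mul, clToCl_ι, spinAction_ι] at h
  exact LinearMap.congr_fun h y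

end Polarization

end ReductiveStructure

end Reductive

/-! ### Cohomology of an equivariant operator -/

section EquivariantOperator

universe v w

variable {H : Type v} [Group H] {V : Type w} [AddCommGroup V] [Module ℂ V]

/-- The restriction of a representation to an invariant subspace. -/
def restrictRep (ρ : Representation ℂ H V) (W : Submodule ℂ V)
    (hW : ∀ h, ∀ y ∈ W, ρ h y ∈ W) : Representation ℂ H W :=
  ρ.subrepresentation W fun h y hy => hW h y hy

/-- The subspace `ker T ∩ Im T` of `ker T`. -/
def kerInterRange (T : Module.End ℂ V) : Submodule ℂ (LinearMap.ker T) :=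
  (LinearMap.range T).comap (LinearMap.ker T).subtype

/-- The quotient `ker T / (ker T ∩ Im T)`. -/
abbrev Cohomology (T : Module.End ℂ V) : Type w := LinearMap.ker T ⧸ kerInterRange T

/-- The image of `ker T ∩ W` in `ker T / (ker T ∩ Im T)`. -/
def cohomologyPart (T : Module.End ℂ V) (W : Submodule ℂ V) : Submodule ℂ (Cohomology T) :=
  (W.comap (LinearMap.ker T).subtype).map (kerInterRange T).mkQ

variable (ρ : Representation ℂ H V) (T : Module.End ℂ V)
  (hT : ∀ h y, ρ h (T y) = T (ρ h y))

/-- The representation on the kernel of an equivariant operator. -/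
def kerRep : Representation ℂ H (LinearMap.ker T) :=
  restrictRep ρ (LinearMap.ker T) fun h y hy => by
    rw [LinearMap.mem_ker] at *
    rw [← hT, hy, map_zero]

/-- The representation on `ker T / (ker T ∩ Im T)` for an equivariant operator `T`. -/
def cohomologyRep : Representation ℂ H (Cohomology T) :=
  (kerRep ρ T hT).quotient (kerInterRange T) fun h y hy => by
    obtain ⟨z, hz⟩ := hy
    refine ⟨ρ h z, ?_⟩
    rw [← hT, hz]
    rfl

theorem cohomologyRep_mem_part (W : Submodule ℂ V) (hW : ∀ h, ∀ y ∈ W, ρ h y ∈ W) (h : H)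
    (y : Cohomology T) (hy : y ∈ cohomologyPart T W) :
    cohomologyRep ρ T hT h y ∈ cohomologyPart T W := by
  obtain ⟨z, hz, rfl⟩ := hy
  exact ⟨kerRep ρ T hT h z, hW h _ hz, rfl⟩

/-- If `B` is invariant under `a`, with dual bases `b` and `b*`, then `∑ b ⊗ b*` is invariant under
`a`; this is stated for the values of a real bilinear map `f`. -/
theorem sum_dualBasis_invariant {P Y : Type*} [AddCommGroup P] [Module ℝ P] [AddCommGroup Y]
    [Module ℂ Y] {ι : Type*} [Fintype ι] [DecidableEq ι] (B : LinearMap.BilinForm ℝ P)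
    (hB : B.Nondegenerate) (hs : ∀ v w, B v w = B w v) (b : Module.Basis ι ℝ P) (a a' : P →ₗ[ℝ] P)
    (haa' : ∀ v, a (a' v) = v) (ha : ∀ v w, B (a v) (a w) = B v w) (f : P → P → Y)
    (f1 : ∀ u u' v, f (u + u') v = f u v + f u' v)
    (f2 : ∀ (c : ℝ) u v, f (c • u) v = (c : ℂ) • f u v)
    (f3 : ∀ u v v', f u (v + v') = f u v + f u v')
    (f4 : ∀ (c : ℝ) u v, f u (c • v) = (c : ℂ) • f u v) :
    ∑ i, f (a (b i)) (a (B.dualBasis hB b i)) = ∑ i, f (b i) (B.dualBasis hB b i) := by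
  let F : P →ₗ[ℝ] P →ₗ[ℝ] Y := LinearMap.mk₂ ℝ f f1 f2 f3 f4
  change ∑ i, F (a (b i)) (a (B.dualBasis hB b i)) = ∑ i, F (b i) (B.dualBasis hB b i)
  have e1 : ∀ u, u = ∑ j, B u (B.dualBasis hB b j) • b j := fun u => by
    have hc : ∀ j, B u (B.dualBasis hB b j) = b.repr u j := fun j => by
      conv_lhs => rw [hs, ← b.sum_repr u, map_sum]
      simp [LinearMap.BilinForm.apply_dualBasis_left]
    simp only [hc, b.sum_repr]
  have e2 : ∀ u, u = ∑ j, B (b j) u • B.dualBasis hB b j := fun u => by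
    have hc : ∀ j, B (b j) u = (B.dualBasis hB b).repr u j := fun j => by
      rw [LinearMap.BilinForm.dualBasis_repr_apply, hs]
    simp only [hc, Module.Basis.sum_repr]
  calc ∑ i, F (a (b i)) (a (B.dualBasis hB b i))
      = ∑ i, ∑ j, B (a (b i)) (B.dualBasis hB b j) • F (b j) (a (B.dualBasis hB b i)) := by
        refine Finset.sum_congr rfl fun i _ => ?_
        conv_lhs => rw [e1 (a (b i))]
        rw [map_sum, LinearMap.sum_apply]
        simp only [map_smul, LinearMap.smul_apply]
    _ = ∑ j, ∑ i, B (a (b i)) (B.dualBasis hB b j) • F (b j) (a (B.dualBasis hB b i)) :=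
        Finset.sum_comm
    _ = ∑ j, F (b j) (B.dualBasis hB b j) := by
        refine Finset.sum_congr rfl fun j _ => ?_
        have h : B.dualBasis hB b j
            = ∑ i, B (a (b i)) (B.dualBasis hB b j) • a (B.dualBasis hB b i) := by
          conv_lhs => rw [← haa' (B.dualBasis hB b j), e2 (a' (B.dualBasis hB b j))]
          rw [map_sum]
          refine Finset.sum_congr rfl fun i _ => ?_
          rw [map_smul, ← ha (b i), haa']
        conv_rhs => rw [h]
        rw [map_sum]
        simp only [map_smul]

end EquivariantOperator

/-! ### `(𝔤, K)`-modules, Dirac cohomology and Dirac index -/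

section Modules

universe u v w

attribute [local instance 100] LieRing.ofAssociativeRing

/-- A `(𝔤, K)`-module (Harish-Chandra module) structure on the complex vector space `X`: a
representation of `𝔤` and a locally finite continuous representation of `K` which are compatible.
In `deriv_π`, the differential of the action of `K` at `1` in the direction `Z ∈ 𝔨₀` is computed
along an arbitrary curve in `K` that is differentiable at `0` with velocity `Z`. -/
structure GKModule {E : Type u} [NormedAddCommGroup E] [NormedSpace ℝ E] [CompleteSpace E]
    {G : Type v} [TopologicalSpace G] [ChartedSpace E G] [Group G] [LieGroup 𝓘(ℝ, E) ∞ G]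
    (R : ReductiveStructure E G) (X : Type w) [AddCommGroup X] [Module ℂ X] where
  act : R.𝔤 →ₗ⁅ℂ⁆ Module.End ℂ X
  π : Representation ℂ R.K X
  locallyFinite : ∀ x : X, ∃ V : Submodule ℂ X, FiniteDimensional ℂ V ∧ x ∈ V ∧
    ∀ k, ∀ y ∈ V, π k y ∈ V
  continuous_π : IsContinuousRep π
  π_act : ∀ (k : R.K) (Y : LieAlg E G) (x : X),
    π k (act (R.toG Y) x) = act (R.toG (Ad (k : G) Y)) (π k x)
  deriv_π : ∀ (c : ℝ → R.K) (Z : LieAlg E G), HasVelocityAtOne (fun t => (c t : G)) Z →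
    ∀ (x : X) (φ : Module.Dual ℂ X),
      HasDerivAt (fun t => φ (π (c t) x)) (φ (act (R.toG Z) x)) 0

namespace GKModule

variable {E : Type u} [NormedAddCommGroup E] [NormedSpace ℝ E] [CompleteSpace E]
    {G : Type v} [TopologicalSpace G] [ChartedSpace E G] [Group G] [LieGroup 𝓘(ℝ, E) ∞ G]
    {R : ReductiveStructure E G} {X : Type w} [AddCommGroup X] [Module ℂ X] (M : GKModule R X)

/-- `X` is admissible: each irreducible representation of `K` has finite multiplicity in `X`. -/
def IsAdmissible : Prop := HasFiniteMultiplicities M.π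

/-- The vector `u x` for `u ∈ 𝔭₀`. -/
def actReal (x : X) (u : R.p₀) : X := M.act (R.toG (u : LieAlg E G)) x

theorem actReal_add (x : X) (u u' : R.p₀) :
    M.actReal x (u + u') = M.actReal x u + M.actReal x u' :=
  (congrArg (fun y => M.act y x) (toComplexification_add (u : LieAlg E G) u')).trans
    (LinearMap.congr_fun (map_add M.act _ _) x)

theorem actReal_smul (x : X) (c : ℝ) (u : R.p₀) :
    M.actReal x (c • u) = (c : ℂ) • M.actReal x u :=
  (congrArg (fun y => M.act y x) (toComplexification_smul c (u : LieAlg E G))).trans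
    (LinearMap.congr_fun (map_smul M.act (c : ℂ) _) x)

/-- The action of `U(𝔤)` on `X`. -/
def actU : R.U →ₐ[ℂ] Module.End ℂ X := UniversalEnvelopingAlgebra.lift ℂ M.act

/-- `X` has an infinitesimal character: the centre `𝔷(𝔤)` of `U(𝔤)` acts on `X` by scalars, through a
character `χ`. (By the Harish-Chandra isomorphism, the characters of `𝔷(𝔤)` are the `χ_Λ` for
`Λ ∈ 𝔥*`.) -/
def HasInfinitesimalCharacter : Prop :=
  ∃ χ : Subalgebra.center ℂ R.U →ₐ[ℂ] ℂ, ∀ (z : Subalgebra.center ℂ R.U) (x : X),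
    M.actU (z : R.U) x = χ z • x

variable (P : R.Polarization)

/-- The action of `𝒜 = U(𝔤) ⊗ Cl(𝔭)` on `X ⊗ S`. -/
def actA : R.A →ₐ[ℂ] Module.End ℂ (X ⊗[ℂ] P.S) :=
  (Module.endTensorEndAlgHom (R := ℂ) (S := ℂ) (A := ℂ) (M := X) (N := P.S)).comp
    (Algebra.TensorProduct.map M.actU P.spinAction)

/-- The representation of `K̃` on `X ⊗ S`. -/
def repXS : Representation ℂ R.Ktilde (X ⊗[ℂ] P.S) :=
  Representation.tprod (MonoidHom.comp M.π R.KtildeToK : Representation ℂ R.Ktilde X) P.spinRep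

/-- The subspace `X ⊗ S^±` of `X ⊗ S` (`+` for `ε = 0` and `-` for `ε = 1`). -/
def XS (_M : GKModule R X) (ε : ZMod 2) : Submodule ℂ (X ⊗[ℂ] P.S) :=
  LinearMap.range ((P.halfSpin ε).subtype.lTensor X)

theorem repXS_mem_XS (k : R.Ktilde) (ε : ZMod 2) {y : X ⊗[ℂ] P.S} (hy : y ∈ M.XS P ε) :
    M.repXS P k y ∈ M.XS P ε := by
  obtain ⟨z, rfl⟩ := hy
  induction z with
  | zero => simp
  | add a b ha hb => rw [map_add, map_add]; exact Submodule.add_mem _ ha hb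
  | tmul x s =>
    exact ⟨M.π (R.KtildeToK k) x ⊗ₜ ⟨P.spinRep k s, P.spinRep_mem_halfSpin k ε s.2⟩, rfl⟩

/-- The representation of `K̃` on `X ⊗ S^±`. -/
def repXSpart (ε : ZMod 2) : Representation ℂ R.Ktilde (M.XS P ε) :=
  restrictRep (M.repXS P) (M.XS P ε) fun k _ hy => M.repXS_mem_XS P k ε hy

theorem repXS_tmul (k : R.Ktilde) (x : X) (s : P.S) :
    M.repXS P k (x ⊗ₜ s) = M.π (R.KtildeToK k) x ⊗ₜ P.spinRep k s := rfl

variable [FiniteDimensional ℝ E]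

/-- The Dirac operator acting on `X ⊗ S`. -/
def diracOp : Module.End ℂ (X ⊗[ℂ] P.S) := M.actA P R.D

theorem diracOp_tmul (x : X) (s : P.S) : M.diracOp P (x ⊗ₜ s) =
    ∑ i, M.actReal x (Module.finBasis ℝ R.p₀ i) ⊗ₜ[ℂ]
      P.cliffordReal s (R.Bp₀.dualBasis R.Bp₀_nondegenerate (Module.finBasis ℝ R.p₀) i) := by
  have h2 : M.actA P R.D = ∑ i, M.actA P (UniversalEnvelopingAlgebra.ι ℂ
      (R.toG (Module.finBasis ℝ R.p₀ i : LieAlg E G)) ⊗ₜ[ℂ] CliffordAlgebra.ι R.Q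
      ((1 : ℂ) ⊗ₜ[ℝ] R.Bp₀.dualBasis R.Bp₀_nondegenerate (Module.finBasis ℝ R.p₀) i)) :=
    map_sum (M.actA P) _ _
  refine (LinearMap.congr_fun h2 _).trans ((LinearMap.sum_apply _ _ _).trans ?_)
  refine Finset.sum_congr rfl fun i _ => ?_
  have h1 : M.actU (UniversalEnvelopingAlgebra.ι ℂ
      (R.toG (Module.finBasis ℝ R.p₀ i : LieAlg E G)))
      = M.act (R.toG (Module.finBasis ℝ R.p₀ i : LieAlg E G)) :=
    UniversalEnvelopingAlgebra.lift_ι_apply ℂ M.act _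
  exact congrArg₂ (fun a b => a x ⊗ₜ[ℂ] b s) h1 (P.spinAction_ι _)

/-- The Dirac operator commutes with the action of `K̃` on `X ⊗ S`. -/
theorem repXS_diracOp_tmul (k : R.Ktilde) (x : X) (s : P.S) :
    M.repXS P k (M.diracOp P (x ⊗ₜ s)) = M.diracOp P (M.repXS P k (x ⊗ₜ s)) := by
  refine ((congrArg (M.repXS P k) (M.diracOp_tmul P x s)).trans (map_sum (M.repXS P k) _ _)).trans
    (Eq.trans ?_ (M.diracOp_tmul P (M.π (R.KtildeToK k) x) (P.spinRep k s)).symm)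
  refine Eq.trans (Finset.sum_congr rfl fun i _ => ?_) (sum_dualBasis_invariant R.Bp₀
    R.Bp₀_nondegenerate (fun v w => R.Bp₀_symm.eq v w) (Module.finBasis ℝ R.p₀)
    (R.AdP (R.KtildeToK k)) (R.AdP (R.KtildeToK k)⁻¹)
    (fun v => by rw [← R.AdP_mul, mul_inv_cancel, R.AdP_one])
    (R.Bp₀_AdP _) (fun u v => M.actReal (M.π (R.KtildeToK k) x) u ⊗ₜ[ℂ]
      P.cliffordReal (P.spinRep k s) v) ?_ ?_ ?_ ?_)
  · exact congrArg₂ (fun a b => a ⊗ₜ[ℂ] b) (M.π_act _ _ _) (P.spinRep_cliffordMap _ _ _)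
  · exact fun u u' v => (congrArg (fun a => a ⊗ₜ[ℂ] _) (M.actReal_add _ u u')).trans
      (TensorProduct.add_tmul _ _ _)
  · exact fun c u v => (congrArg (fun a => a ⊗ₜ[ℂ] _) (M.actReal_smul _ c u)).trans
      (TensorProduct.smul_tmul' _ _ _).symm
  · exact fun u v v' => (congrArg (fun a => _ ⊗ₜ[ℂ] a) (P.cliffordReal_add _ v v')).trans
      (TensorProduct.tmul_add _ _ _)
  · exact fun c u v => (congrArg (fun a => _ ⊗ₜ[ℂ] a) (P.cliffordReal_smul _ c v)).trans
      (TensorProduct.tmul_smul _ _ _)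

theorem repXS_diracOp (k : R.Ktilde) (y : X ⊗[ℂ] P.S) :
    M.repXS P k (M.diracOp P y) = M.diracOp P (M.repXS P k y) := by
  have h : (M.repXS P k).comp (M.diracOp P) = (M.diracOp P).comp (M.repXS P k) :=
    TensorProduct.ext' fun x s => M.repXS_diracOp_tmul P k x s
  exact LinearMap.congr_fun h y

/-- The Dirac cohomology `H_Dir(X) = ker D / (ker D ∩ Im D)`. -/
abbrev HDir : Type max u w := Cohomology (M.diracOp P)

/-- The representation of `K̃` on the Dirac cohomology. -/
def repHDir : Representation ℂ R.Ktilde (M.HDir P) :=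
  cohomologyRep (M.repXS P) (M.diracOp P) (M.repXS_diracOp P)

/-- The subspaces `H_Dir(X)^±` of `H_Dir(X)` (`+` for `ε = 0` and `-` for `ε = 1`): the classes of
elements of `ker D ∩ (X ⊗ S^±)`. -/
def HDirPart (ε : ZMod 2) : Submodule ℂ (M.HDir P) :=
  cohomologyPart (M.diracOp P) (M.XS P ε)

/-- The representation of `K̃` on `H_Dir(X)^±`. -/
def repHDirPart (ε : ZMod 2) : Representation ℂ R.Ktilde (M.HDirPart P ε) :=
  restrictRep (M.repHDir P) (M.HDirPart P ε) (cohomologyRep_mem_part (M.repXS P) (M.diracOp P)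
    (M.repXS_diracOp P) (M.XS P ε) fun k _ hy => M.repXS_mem_XS P k ε hy)

/-- The Dirac index `I_Dir(X) = H_Dir(X)⁺ - H_Dir(X)⁻`, seen in the product of copies of `ℤ` indexed
by the irreducible representations `γ` of `K̃`. -/
def diracIndex (γ : FDIrrep R.Ktilde) : ℤ :=
  (multiplicity γ (M.repHDirPart P 0) : ℤ) - multiplicity γ (M.repHDirPart P 1)

/-- The virtual representation `X ⊗ S⁺ - X ⊗ S⁻`, seen in the product of copies of `ℤ` indexed by
the irreducible representations `γ` of `K̃`. -/
def spinDifference (γ : FDIrrep R.Ktilde) : ℤ :=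
  (multiplicity γ (M.repXSpart P 0) : ℤ) - multiplicity γ (M.repXSpart P 1)

end GKModule

end Modules

end DiracIndex

end

noncomputable section

set_option linter.unusedSectionVars false

namespace DiracIndex

section

/-! ### Contractions in exterior and Clifford algebras; the twisted centre -/

section ExteriorContraction

variable {k V : Type*} [Field k] [AddCommGroup V] [Module k V]

/-! Write `T` for the action of `D` on `X ⊗ S`. Parthasarathy's formula (`exists_dirac_sq`) says
that `T²` is a constant, minus the Casimir element of `𝔤` acting on `X`, minus `∑ Z_b²` for the
diagonal action of `𝔨₀`, where `(Z_b)` is a basis of `𝔨₀` orthonormal for `-B`. The infinitesimal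
character makes the Casimir element of `𝔤` a scalar, so on the image of an irreducible `γ` of `K̃`
the operator `T²` is a scalar `s` by Schur's lemma (`IsCasimirSqrt.exists_scalar`).

The index identity follows (`multiplicity_sub_cohomologyPart`). The odd equivariant operator `T`
induces maps in both directions between `Hom(γ, X ⊗ S⁺)` and `Hom(γ, X ⊗ S⁻)`, whose composites are
`s`. If `s ≠ 0`, these maps are isomorphisms and `γ` does not occur in the cohomology. If `s = 0`,
exactness of `Hom(γ, ·)` over the compact group `K̃` shows that the multiplicity of `γ` in the even
(odd) part of the cohomology is the dimension of the kernel of `T` on that part minus the rank of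
`T` coming from the other part. By rank-nullity the ranks cancel in the difference.

Finite multiplicities come from admissibility (`finite_intertwiningMap_repXS`). The space `Hom(γ, X
⊗ S)` embeds in `Hom(γ ⊗ S*, X)`. Since `K̃` acts on `X` through `K`, only a quotient of `γ ⊗ S*` on
which the kernel of `K̃ → K` acts trivially matters. That quotient is induced up to `K`, which is
harmless because the image of `K̃` is open, hence of finite index.

Finite-dimensionality of the cohomology follows from that of `ker T`. An irreducible `γ` occurring
in `ker T` has a prescribed Casimir eigenvalue, and finitely many `γ` have it. No highest weights
are needed for this: for an invariant inner product, the eigenvalue bounds the differential of `γ`,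
so a diagonal matrix coefficient of a unit vector has real part at least `1/2` on a neighbourhood of
`1` independent of `γ`. For `n` inequivalent such `γ`, the sum of these coefficients has squared
`L²` norm at most `n` by orthogonality and at least a constant times `n²`; this bounds `n`
(`exists_card_le`, `finiteDimensional_of_card_le`).

The remaining work is differential calculus on `K̃` without an exponential map. A chart at `1` that
linearizes `θ` supplies curves in `K`. The element `∑ g(e_I) e_I⁻¹` of the Clifford algebra,
normalized, supplies a differentiable local section of `K̃ → K`. The derivatives of `Ad` and of the
spin action are then found from the algebraic identities they must satisfy. -/

theorem finite_exteriorAlgebra [FiniteDimensional k V] :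
    FiniteDimensional k (ExteriorAlgebra k V) := by
  have hbot : ∀ i, Module.finrank k V < i → (⋀[k]^i V) = ⊥ := fun i hi => by
    rw [← Submodule.finrank_eq_zero (R := k), exteriorPower.finrank_eq, Nat.choose_eq_zero_of_lt hi]
  have htop : (⨆ i : Fin (Module.finrank k V + 1), (⋀[k]^(i : ℕ) V)) = ⊤ := by
    rw [eq_top_iff, ← (DirectSum.Decomposition.isInternal
      (fun i : ℕ => ⋀[k]^i V)).submodule_iSup_eq_top]
    refine iSup_le fun i => ?_
    by_cases hi : Module.finrank k V < i
    · rw [hbot i hi]; exact bot_le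
    · exact le_iSup (fun i : Fin (Module.finrank k V + 1) => ⋀[k]^(i : ℕ) V) ⟨i, by omega⟩
  have : FiniteDimensional k (⊤ : Submodule k (ExteriorAlgebra k V)) := by
    rw [← htop]; infer_instance
  exact Module.finite_def.2 ((Submodule.fg_iff_finiteDimensional _).2 this)

theorem finite_cliffordAlgebra [FiniteDimensional k V] [Invertible (2 : k)]
    (Q : QuadraticForm k V) : FiniteDimensional k (CliffordAlgebra Q) :=
  have := finite_exteriorAlgebra (k := k) (V := V)
  (CliffordAlgebra.equivExterior Q).symm.finiteDimensional

open CliffordAlgebra in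
/-- An element of the exterior algebra killed by all contractions is a scalar. -/
theorem exteriorAlgebra_eq_scalar_of_contractLeft_eq_zero [FiniteDimensional k V]
    (x : ExteriorAlgebra k V)
    (hx : ∀ d : Module.Dual k V, contractLeft (Q := (0 : QuadraticForm k V)) d x = 0) :
    ∃ r : k, x = algebraMap k _ r := by
  classical
  let b := Module.finBasis k V
  let Q : QuadraticForm k V := 0
  let e : Fin (Module.finrank k V) → CliffordAlgebra Q := fun i => ι Q (b i)
  have ee : ∀ i, e i * e i = 0 := fun i => by simp [e, Q, ι_sq_scalar]
  have anti : ∀ i j, e i * e j = - (e j * e i) := fun i j => by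
    have := ι_mul_ι_add_swap (Q := Q) (b i) (b j)
    rw [eq_neg_iff_add_eq_zero]
    exact this.trans (by simp [Q, QuadraticMap.polar])
  -- Wedging with `e i` and then contracting with its dual projects onto the elements free of `e i`.
  -- The composite over all `i` projects onto the scalars, whereas the hypothesis on `x` makes each
  -- factor fix `x`.
  let Φ : List (Fin (Module.finrank k V)) → CliffordAlgebra Q → CliffordAlgebra Q :=
    fun l x => l.foldr (fun i y => contractLeft (Q := Q) (b.coord i) (e i * y)) x
  have hΦcons : ∀ i l y, Φ (i :: l) y = contractLeft (Q := Q) (b.coord i) (e i * Φ l y) :=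
    fun i l y => rfl
  have hadd : ∀ l y z, Φ l (y + z) = Φ l y + Φ l z := fun l y z => by
    induction l with
    | nil => rfl
    | cons i l ih => rw [hΦcons, ih, mul_add, map_add]; rfl
  have hfix : ∀ l, Φ l x = x := fun l => by
    induction l with
    | nil => rfl
    | cons i l ih =>
      rw [hΦcons, ih, contractLeft_ι_mul, hx]
      simp
  have hscal : ∀ l r, Φ l (algebraMap k _ r) = algebraMap k _ r := fun l r => by
    induction l with
    | nil => rfl
    | cons i l ih =>
      rw [hΦcons, ih, contractLeft_ι_mul, contractLeft_algebraMap]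
      simp
  have hmul : ∀ (l : List (Fin (Module.finrank k V))), l.Nodup → ∀ j y,
      Φ l (e j * y) = if j ∈ l then 0 else e j * Φ l y := by
    intro l hl j y
    induction l with
    | nil => simp [Φ]
    | cons i l ih =>
      rw [List.nodup_cons] at hl
      rw [hΦcons, ih hl.2]
      by_cases hj : j ∈ l
      · simp [hj]
      · by_cases hij : j = i
        · subst hij
          simp [hj, ← mul_assoc, ee]
        · simp only [hj, if_false, List.mem_cons, hij, false_or]
          rw [← mul_assoc, anti, neg_mul, mul_assoc, map_neg, contractLeft_ι_mul, hΦcons]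
          simp [Ne.symm hij, b.coord_apply, e]
  have hsp : ∀ z : CliffordAlgebra Q, ∃ r : k, Φ (List.finRange _) z = algebraMap k _ r := by
    intro z
    induction z using CliffordAlgebra.left_induction with
    | algebraMap r => exact ⟨r, hscal _ _⟩
    | add y z hy hz =>
      obtain ⟨r, hr⟩ := hy
      obtain ⟨s, hs⟩ := hz
      exact ⟨r + s, by rw [hadd, hr, hs, map_add]⟩
    | ι_mul z v hz =>
      refine ⟨0, ?_⟩
      have h0 : ∀ s : Finset (Fin (Module.finrank k V)), Φ (List.finRange _)
          (∑ i ∈ s, b.repr v i • (e i * z)) = algebraMap k _ 0 := by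
        intro s
        induction s using Finset.induction_on with
        | empty => rw [Finset.sum_empty]; simpa using hscal _ (0 : k)
        | insert i s hi ih =>
          rw [Finset.sum_insert hi, hadd, ih, ← mul_smul_comm, hmul _ (List.nodup_finRange _)]
          simp
      rw [← h0 Finset.univ]
      congr 1
      have hv : ι Q v = ∑ i, b.repr v i • e i := by
        conv_lhs => rw [← b.sum_repr v, map_sum]
        simp only [map_smul, e]
      simp only [hv, Finset.sum_mul, smul_mul_assoc]
  obtain ⟨r, hr⟩ := hsp x
  exact ⟨r, by rw [← hr, hfix]⟩

end ExteriorContraction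

section DefiniteClifford

open CliffordAlgebra

variable {V : Type*} [AddCommGroup V] [Module ℝ V] {Q : QuadraticForm ℝ V}
  {B : LinearMap.BilinForm ℝ V}

theorem clifford_relation (hQ : ∀ v, Q v = -B v v) (hs : ∀ v w, B v w = B w v) (v w : V) :
    ι Q v * ι Q w + ι Q w * ι Q v = algebraMap ℝ _ (-2 * B v w) := by
  rw [ι_mul_ι_add_swap]
  congr 1
  simp only [QuadraticMap.polar, hQ, map_add, LinearMap.add_apply, hs w v]
  ring

/-- Both sides are skew-derivations in `x` that kill scalars, and on vectors they agree by the
Clifford relation. -/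
theorem twisted_commutator (hQ : ∀ v, Q v = -B v v) (hs : ∀ v w, B v w = B w v) (v : V)
    (x : CliffordAlgebra Q) :
    ι Q v * x - involute x * ι Q v = contractLeft ((-2 : ℝ) • B v) x := by
  induction x using CliffordAlgebra.left_induction with
  | algebraMap r => rw [AlgHom.commutes, contractLeft_algebraMap, Algebra.commutes, sub_self]
  | add x y hx hy => rw [map_add, map_add, ← hx, ← hy]; noncomm_ring
  | ι_mul x w hx =>
    rw [contractLeft_ι_mul, ← hx, map_mul, involute_ι]
    have h := clifford_relation hQ hs v w
    have : ι Q v * (ι Q w * x) = algebraMap ℝ _ (-2 * B v w) * x - ι Q w * (ι Q v * x) := by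
      rw [← h]; noncomm_ring
    rw [this, ← Algebra.smul_def]
    simp only [LinearMap.smul_apply, smul_eq_mul]
    noncomm_ring

/-- The twisted centre of a nondegenerate Clifford algebra consists of the scalars. -/
theorem eq_scalar_of_twisted_central [FiniteDimensional ℝ V] (hQ : ∀ v, Q v = -B v v)
    (hs : ∀ v w, B v w = B w v) (hpos : ∀ v, v ≠ 0 → 0 < B v v) (x : CliffordAlgebra Q)
    (hx : ∀ v, involute x * ι Q v = ι Q v * x) : ∃ r : ℝ, x = algebraMap ℝ _ r := by
  have hB : Function.Surjective B := by
    refine (LinearMap.injective_iff_surjective_of_finrank_eq_finrank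
      (Subspace.dual_finrank_eq (K := ℝ) (V := V)).symm).1 ?_
    refine (injective_iff_map_eq_zero B).2 fun v hv => ?_
    by_contra h
    exact (hpos v h).ne' (by rw [hv]; rfl)
  -- Twisted centrality says that the contractions by the forms `-2 B v` vanish on `x`, and by
  -- nondegeneracy these are all the linear forms.
  have hd : ∀ d : Module.Dual ℝ V, contractLeft (Q := Q) d x = 0 := fun d => by
    obtain ⟨v, rfl⟩ := hB d
    have h := twisted_commutator hQ hs v x
    rw [hx, sub_self, map_smul, LinearMap.smul_apply] at h
    simpa using h.symm
  -- The linear isomorphism with the exterior algebra commutes with contractions and preserves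
  -- scalars.
  obtain ⟨r, hr⟩ := exteriorAlgebra_eq_scalar_of_contractLeft_eq_zero
    (equivExterior Q x) fun d => by
      change contractLeft d (changeForm changeForm.associated_neg_proof x) = 0
      rw [← changeForm_contractLeft, hd, map_zero]
  refine ⟨r, (equivExterior Q).injective ?_⟩
  rw [hr]
  exact (changeForm_algebraMap changeForm.associated_neg_proof r).symm

end DefiniteClifford

end

section

/-! ### Lifting isometries to the Pin and Spin groups -/

section SpinLift

open CliffordAlgebra

variable {V : Type*} [AddCommGroup V] [Module ℝ V] {Q : QuadraticForm ℝ V}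
  {B : LinearMap.BilinForm ℝ V}

theorem star_ι_clifford (v : V) : star (ι Q v) = -ι Q v := by
  simp [star_def]

theorem ι_sq_of_unit (hQ : ∀ v, Q v = -B v v) {u : V} (hu : B u u = 1) :
    ι Q u * ι Q u = -1 := by
  rw [ι_sq_scalar, hQ, hu, map_neg, map_one]

theorem ι_mem_pinGroup (hQ : ∀ v, Q v = -B v v) {u : V} (hu : B u u = 1) :
    ι Q u ∈ pinGroup Q := by
  have h := ι_sq_of_unit hQ hu
  refine pinGroup.mem_iff.2 ⟨?_, ?_⟩
  · refine ⟨⟨ι Q u, -ι Q u, by rw [mul_neg, h, neg_neg], by rw [neg_mul, h, neg_neg]⟩, ?_, rfl⟩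
    exact Subgroup.subset_closure ⟨u, rfl⟩
  · rw [Unitary.mem_iff, star_ι_clifford, neg_mul, mul_neg, h, neg_neg]
    exact ⟨rfl, rfl⟩

/-- The inner product space structure given by a positive definite form. -/
abbrev innerCore (hs : ∀ v w, B v w = B w v) (hpos : ∀ v, v ≠ 0 → 0 < B v v) :
    InnerProductSpace.Core ℝ V where
  inner v w := B v w
  conj_inner_symm v w := hs w v
  re_inner_nonneg v := by
    by_cases h : v = 0
    · simp [h]
    · exact (hpos v h).le
  add_left u v w := by simp
  smul_left u v r := by simp
  definite v hv := by
    by_contra h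
    exact (hpos v h).ne' hv

theorem exists_orthonormal_basis [FiniteDimensional ℝ V] (hs : ∀ v w, B v w = B w v)
    (hpos : ∀ v, v ≠ 0 → 0 < B v v) :
    ∃ b : Module.Basis (Fin (Module.finrank ℝ V)) ℝ V, ∀ i j, B (b i) (b j) = if i = j then 1 else 0 := by
  let := (innerCore hs hpos).toNormedAddCommGroup
  let : InnerProductSpace ℝ V := InnerProductSpace.ofCore (innerCore hs hpos).toCore
  let b := stdOrthonormalBasis ℝ V
  refine ⟨b.toBasis, fun i j => ?_⟩
  have := orthonormal_iff_ite.1 b.orthonormal i j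
  rw [OrthonormalBasis.coe_toBasis]
  exact this

/-- Every isometry is the twisted conjugation by an element of the Pin group. -/
theorem exists_pin_of_isometry [FiniteDimensional ℝ V] (hQ : ∀ v, Q v = -B v v)
    (hs : ∀ v w, B v w = B w v) (hpos : ∀ v, v ≠ 0 → 0 < B v v) (g : V →ₗ[ℝ] V)
    (hg : ∀ v w, B (g v) (g w) = B v w) :
    ∃ t ∈ pinGroup Q, ∀ v, involute t * ι Q v = ι Q (g v) * t := by
  let := (innerCore hs hpos).toNormedAddCommGroup
  let : InnerProductSpace ℝ V := InnerProductSpace.ofCore (innerCore hs hpos).toCore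
  have hin : ∀ v w : V, inner ℝ v w = B v w := fun v w => rfl
  let g₁ : V →ₗᵢ[ℝ] V := g.isometryOfInner fun v w => hg v w
  let φ : V ≃ₗᵢ[ℝ] V := g₁.toLinearIsometryEquiv rfl
  -- Cartan–Dieudonné: an isometry is a product of hyperplane reflections, and the reflection
  -- orthogonal to a unit vector `u` is twisted conjugation by `u`.
  obtain ⟨l, -, hl⟩ := φ.reflections_generate_dim
  have key : ∀ l : List V, ∃ t ∈ pinGroup Q, ∀ v,
      involute t * ι Q v = ι Q ((l.map fun v => ((ℝ ∙ v)ᗮ).reflection).prod v) * t := by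
    intro l
    induction l with
    | nil => exact ⟨1, one_mem _, fun v => by simp⟩
    | cons a l ih =>
      obtain ⟨t, ht, h⟩ := ih
      -- The list may contain zero vectors; their "reflection" is the identity and contributes no
      -- factor.
      by_cases ha : a = 0
      · refine ⟨t, ht, fun v => ?_⟩
        rw [h v, List.map_cons, List.prod_cons, LinearIsometryEquiv.coe_mul, Function.comp_apply,
          Submodule.reflection_mem_subspace_eq_self]
        simp [ha]
      · obtain ⟨u, hun, hspan⟩ : ∃ u : V, ‖u‖ = 1 ∧ (ℝ ∙ a) = (ℝ ∙ u) :=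
          ⟨(‖a‖⁻¹ : ℝ) • a, norm_smul_inv_norm ha, (Submodule.span_singleton_smul_eq
            (IsUnit.mk0 _ (inv_ne_zero (norm_ne_zero_iff.2 ha))) a).symm⟩
        have hu : B u u = 1 := by rw [← hin, real_inner_self_eq_norm_sq, hun, one_pow]
        refine ⟨ι Q u * t, mul_mem (ι_mem_pinGroup hQ hu) ht, fun v => ?_⟩
        rw [map_mul, involute_ι, mul_assoc, h v, List.map_cons, List.prod_cons,
          LinearIsometryEquiv.coe_mul, Function.comp_apply]
        set w := (l.map fun v => ((ℝ ∙ v)ᗮ).reflection).prod v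
        have hr : ((ℝ ∙ a)ᗮ).reflection w = w - (2 * B u w) • u := by
          simp only [hspan]
          rw [Submodule.reflection_orthogonal_apply, Submodule.reflection_singleton_apply, hun]
          simp only [hin, RCLike.ofReal_one, one_pow, div_one, neg_sub]
          module
        rw [hr, map_sub, map_smul]
        have h1 := clifford_relation hQ hs u w
        have h2 := ι_sq_of_unit hQ hu
        have h3 : ι Q u * ι Q w = algebraMap ℝ _ (-2 * B u w) - ι Q w * ι Q u := by
          rw [← h1]; noncomm_ring
        rw [← mul_assoc, ← mul_assoc, neg_mul (ι Q u), h3, sub_mul (ι Q w), smul_mul_assoc, h2,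
          Algebra.algebraMap_eq_smul_one]
        congr 1
        simp only [neg_mul, neg_smul, smul_neg]
        abel
  obtain ⟨t, ht, h⟩ := key l
  refine ⟨t, ht, fun v => ?_⟩
  rw [h v, ← hl]
  rfl

/-- Two unitary elements of the Clifford algebra, one of which is even, inducing the same isometry
agree up to sign. -/
theorem eq_or_eq_neg_of_twisted [FiniteDimensional ℝ V] (hQ : ∀ v, Q v = -B v v)
    (hs : ∀ v w, B v w = B w v) (hpos : ∀ v, v ≠ 0 → 0 < B v v) (g : V →ₗ[ℝ] V)
    {s t : CliffordAlgebra Q} (hs₁ : s ∈ unitary (CliffordAlgebra Q))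
    (ht₁ : t ∈ unitary (CliffordAlgebra Q))
    (hs₂ : ∀ v, involute s * ι Q v = ι Q (g v) * s)
    (ht₂ : ∀ v, involute t * ι Q v = ι Q (g v) * t) : s = t ∨ s = -t := by
  obtain ⟨a1, a2⟩ := Unitary.mem_iff.1 hs₁
  obtain ⟨b1, b2⟩ := Unitary.mem_iff.1 ht₁
  have i1 : involute (star t) * involute t = 1 := by rw [← map_mul, b1, map_one]
  -- The quotient of two lifts of the same isometry is twisted-central, hence a real scalar `r`;
  -- unitarity of both lifts then forces `r² = 1`.
  obtain ⟨r, hr⟩ := eq_scalar_of_twisted_central hQ hs hpos (star t * s) fun v => by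
    have e : ι Q v * star t = involute (star t) * ι Q (g v) := by
      calc ι Q v * star t = involute (star t) * involute t * ι Q v * star t := by
            rw [i1, one_mul]
        _ = involute (star t) * ι Q (g v) * (t * star t) := by
            rw [mul_assoc (involute (star t)), ht₂]; noncomm_ring
        _ = _ := by rw [b2, mul_one]
    rw [map_mul, mul_assoc, hs₂, ← mul_assoc, ← e, mul_assoc]
  have hst : s = r • t := by
    calc s = t * star t * s := by rw [b2, one_mul]
      _ = t * algebraMap ℝ _ r := by rw [mul_assoc, hr]
      _ = _ := by rw [← Algebra.commutes, Algebra.smul_def]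
  have hr2 : (algebraMap ℝ (CliffordAlgebra Q)) (r * r) = algebraMap ℝ _ 1 := by
    rw [map_one, ← a1, hst, CliffordAlgebra.star_smul, smul_mul_smul_comm, b1,
      Algebra.algebraMap_eq_smul_one]
  have hinj : Function.Injective (algebraMap ℝ (CliffordAlgebra Q)) :=
    FaithfulSMul.algebraMap_injective _ _
  rcases mul_self_eq_one_iff.1 (hinj hr2) with h | h
  · left; rw [hst, h, one_smul]
  · right; rw [hst, h, neg_smul, one_smul]

/-- Some lift `t` lies in Pin and `s = ±t`. The sign is harmless because `-1` is the square of a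
unit vector, which requires `V ≠ 0`. This lets a lift given by an explicit formula be recognized as
an element of Pin. -/
theorem mem_pinGroup_of_isometry [FiniteDimensional ℝ V] [Nontrivial V] (hQ : ∀ v, Q v = -B v v)
    (hs : ∀ v w, B v w = B w v) (hpos : ∀ v, v ≠ 0 → 0 < B v v) (g : V →ₗ[ℝ] V)
    (hg : ∀ v w, B (g v) (g w) = B v w) {s : CliffordAlgebra Q}
    (hs₁ : s ∈ unitary (CliffordAlgebra Q))
    (hs₂ : ∀ v, involute s * ι Q v = ι Q (g v) * s) : s ∈ pinGroup Q := by
  obtain ⟨t, ht, h⟩ := exists_pin_of_isometry hQ hs hpos g hg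
  have hneg : (-1 : CliffordAlgebra Q) ∈ pinGroup Q := by
    obtain ⟨b, hb⟩ := exists_orthonormal_basis hs hpos
    have hu : B (b ⟨0, Module.finrank_pos⟩) (b ⟨0, Module.finrank_pos⟩) = 1 := by simp [hb]
    rw [← ι_sq_of_unit hQ hu]
    exact mul_mem (ι_mem_pinGroup hQ hu) (ι_mem_pinGroup hQ hu)
  rcases eq_or_eq_neg_of_twisted hQ hs hpos g hs₁ (pinGroup.mem_unitary ht) hs₂ h with h | h
  · rwa [h]
  · rw [h, ← neg_one_mul]; exact mul_mem hneg ht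

variable (Q) in
/-- The intertwiner `∑ g(e_I) e_I⁻¹` in the Clifford algebra, for a list of orthonormal vectors. -/
def spinIntertwiner (g : V →ₗ[ℝ] V) : List V → CliffordAlgebra Q
  | [] => 1
  | e :: l => spinIntertwiner g l - ι Q (g e) * spinIntertwiner g l * ι Q e

/-- For a scalar `T`, each step replaces `T` by `T - e T e = 2 T`, as `e² = -1`. The nonzero value
at the identity is what makes the formula usable as a lift near the identity. -/
theorem spinIntertwiner_id (hQ : ∀ v, Q v = -B v v) (l : List V) (hl : ∀ e ∈ l, B e e = 1) :
    spinIntertwiner Q LinearMap.id l = algebraMap ℝ _ (2 ^ l.length) := by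
  induction l with
  | nil => simp [spinIntertwiner]
  | cons e l ih =>
    rw [spinIntertwiner, ih fun f hf => hl f (List.mem_cons_of_mem _ hf), LinearMap.id_apply,
      ← Algebra.commutes, mul_assoc, ι_sq_of_unit hQ (hl e (List.mem_cons_self)),
      mul_neg_one, sub_neg_eq_add, ← map_add, List.length_cons, pow_succ, mul_two]

theorem spinIntertwiner_mem_even (g : V →ₗ[ℝ] V) (l : List V) :
    spinIntertwiner Q g l ∈ even Q := by
  induction l with
  | nil => exact one_mem _
  | cons e l ih =>
    refine sub_mem ih ?_
    have h := SetLike.mul_mem_graded (A := evenOdd Q)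
      (SetLike.mul_mem_graded (A := evenOdd Q) (ι_mem_evenOdd_one Q (g e)) ih)
      (ι_mem_evenOdd_one Q e)
    exact h

/-- With `T' = T - g(e) T e`, the relations `e² = g(e)² = -1` give `T' e = T e + g(e) T = g(e) T'`.
For `f` orthogonal to `e`, moving `f` past `e` and `g(f)` past `g(e)` produces two signs that
cancel. Unlike the product of reflections, this intertwiner is polynomial in `g`, so it can be
differentiated. -/
theorem spinIntertwiner_comm (hQ : ∀ v, Q v = -B v v)
    (hs : ∀ v w, B v w = B w v) (g : V →ₗ[ℝ] V)
    (hg : ∀ v w, B (g v) (g w) = B v w) (l : List V) (hl : ∀ e ∈ l, B e e = 1)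
    (ho : l.Pairwise fun e f => B e f = 0) :
    ∀ f ∈ l, spinIntertwiner Q g l * ι Q f = ι Q (g f) * spinIntertwiner Q g l := by
  induction l with
  | nil => simp
  | cons e l ih =>
    rw [List.pairwise_cons] at ho
    have ih' := ih (fun f hf => hl f (List.mem_cons_of_mem _ hf)) ho.2
    have he := hl e List.mem_cons_self
    have e1 := ι_sq_of_unit hQ he
    have e2 := ι_sq_of_unit (Q := Q) (u := g e) hQ (by rw [hg, he])
    intro f hf
    rw [spinIntertwiner]
    set T := spinIntertwiner Q g l
    rcases List.mem_cons.1 hf with rfl | hf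
    · rw [sub_mul, mul_sub, mul_assoc _ (ι Q f), e1, ← mul_assoc, ← mul_assoc, e2]
      noncomm_ring
    · have a1 := clifford_relation hQ hs e f
      have a2 := clifford_relation hQ hs (g e) (g f)
      rw [ho.1 f hf, mul_zero, map_zero] at a1
      rw [hg, ho.1 f hf, mul_zero, map_zero] at a2
      have a3 : ι Q e * ι Q f = -(ι Q f * ι Q e) := eq_neg_of_add_eq_zero_left a1
      have a4 : ι Q (g f) * ι Q (g e) = -(ι Q (g e) * ι Q (g f)) :=
        eq_neg_of_add_eq_zero_right a2
      rw [sub_mul, mul_sub, ih' f hf, mul_assoc _ (ι Q e), a3, ← mul_assoc, ← mul_assoc, a4]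
      rw [mul_neg, neg_mul, neg_mul, ← mul_assoc, mul_assoc _ T, ih' f hf]
      noncomm_ring

theorem spinIntertwiner_comm_of_basis (hQ : ∀ v, Q v = -B v v)
    (hs : ∀ v w, B v w = B w v) (g : V →ₗ[ℝ] V)
    (hg : ∀ v w, B (g v) (g w) = B v w) {n : ℕ} (b : Module.Basis (Fin n) ℝ V)
    (hb : ∀ i j, B (b i) (b j) = if i = j then 1 else 0) (v : V) :
    spinIntertwiner Q g (List.ofFn b) * ι Q v = ι Q (g v) * spinIntertwiner Q g (List.ofFn b) := by
  have h := spinIntertwiner_comm hQ hs g hg (List.ofFn b)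
    (by simp [hb]) (by
      rw [List.pairwise_ofFn]
      intro i j hij
      rw [hb, if_neg hij.ne])
  have h' : ∀ i, spinIntertwiner Q g (List.ofFn b) * ι Q (b i)
      = ι Q (g (b i)) * spinIntertwiner Q g (List.ofFn b) := fun i => h _ (by simp)
  rw [← b.sum_repr v]
  simp only [map_sum, map_smul, Finset.mul_sum, Finset.sum_mul, mul_smul_comm, smul_mul_assoc, h']

/-- The element `star T * T` is even and commutes with all vectors, so it is twisted-central. The
scalar is the spinor norm by which `T` has to be normalized. -/
theorem star_mul_self_spinIntertwiner [FiniteDimensional ℝ V] (hQ : ∀ v, Q v = -B v v)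
    (hs : ∀ v w, B v w = B w v) (hpos : ∀ v, v ≠ 0 → 0 < B v v) (g : V →ₗ[ℝ] V)
    {T : CliffordAlgebra Q} (hT : T ∈ even Q) (h : ∀ v, T * ι Q v = ι Q (g v) * T) :
    ∃ q : ℝ, star T * T = algebraMap ℝ _ q := by
  refine eq_scalar_of_twisted_central hQ hs hpos _ fun v => ?_
  have h1 : ι Q v * star T = star T * ι Q (g v) := by
    have := congrArg star (h v)
    simpa [star_mul, star_ι_clifford] using this
  have h2 : involute (star T * T) = star T * T := by
    have h3 : involute T = T := involute_eq_of_mem_even hT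
    rw [map_mul, h3, star_def, ← reverse_involute_commute.eq, h3, h3]
  rw [h2, mul_assoc, h, ← mul_assoc, ← mul_assoc, h1]

/-- In a finite-dimensional algebra a one-sided inverse is two-sided. -/
theorem mem_unitary_of_star_mul_self [FiniteDimensional ℝ V] {s : CliffordAlgebra Q}
    (h : star s * s = 1) : s ∈ unitary (CliffordAlgebra Q) := by
  have : Invertible (2 : ℝ) := invertibleOfNonzero two_ne_zero
  have := finite_cliffordAlgebra Q
  have : IsNoetherianRing (CliffordAlgebra Q) := IsNoetherianRing.of_finite ℝ _
  exact Unitary.mem_iff.2 ⟨h, mul_eq_one_comm.1 h⟩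

/-- An infinitesimal spin element is determined by its adjoint action. -/
theorem eq_of_commutator_eq [FiniteDimensional ℝ V] (hQ : ∀ v, Q v = -B v v)
    (hs : ∀ v w, B v w = B w v) (hpos : ∀ v, v ≠ 0 → 0 < B v v) {σ τ : CliffordAlgebra Q}
    (h1 : involute σ = σ) (h2 : involute τ = τ) (h3 : star σ = -σ) (h4 : star τ = -τ)
    (h : ∀ v, σ * ι Q v - ι Q v * σ = τ * ι Q v - ι Q v * τ) : σ = τ := by
  obtain ⟨r, hr⟩ := eq_scalar_of_twisted_central hQ hs hpos (σ - τ) fun v => by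
    rw [map_sub, h1, h2, sub_mul, mul_sub]
    have := h v
    rw [sub_eq_sub_iff_add_eq_add] at this
    rw [sub_eq_sub_iff_add_eq_add, this]; abel
  -- The difference is a scalar, fixed by `star`, and also skew for `star`; so it vanishes.
  have hst : star (σ - τ) = -(σ - τ) := by rw [star_sub, h3, h4]; abel
  rw [hr, CliffordAlgebra.star_algebraMap] at hst
  have : r = 0 := by
    have hinj : Function.Injective (algebraMap ℝ (CliffordAlgebra Q)) :=
      FaithfulSMul.algebraMap_injective _ _
    have := hinj (hst.trans (map_neg _ _).symm)
    linarith
  rw [this, map_zero] at hr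
  exact sub_eq_zero.1 hr

end SpinLift

end

section

/-! ### Weak continuity and vector-valued integrals -/

section WeakContinuity

/-- All linear functionals of `f` are continuous. -/
def WeakContinuous (𝕜 : Type*) [RCLike 𝕜] {T V : Type*} [TopologicalSpace T] [AddCommGroup V]
    [Module 𝕜 V] (f : T → V) : Prop :=
  ∀ φ : Module.Dual 𝕜 V, Continuous fun t => φ (f t)

variable {𝕜 : Type*} [RCLike 𝕜] {T V W U : Type*} [TopologicalSpace T] [AddCommGroup V]
  [Module 𝕜 V] [AddCommGroup W] [Module 𝕜 W] [AddCommGroup U] [Module 𝕜 U]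

theorem apply_eq_sum_coord {ι : Type*} [Fintype ι] (e : Module.Basis ι 𝕜 V) (L : V →ₗ[𝕜] W) (v : V) :
    L v = ∑ i, e.coord i v • L (e i) := by
  conv_lhs => rw [← e.sum_repr v, map_sum]
  simp only [map_smul, Module.Basis.coord_apply]

/-- Expanding the first argument in a basis reduces to products of continuous scalar functions. Only
one factor has to be finite-dimensional; the other will be `X`. -/
theorem WeakContinuous.bilin [FiniteDimensional 𝕜 V] {f : T → V} {g : T → W}
    (hf : WeakContinuous 𝕜 f) (hg : WeakContinuous 𝕜 g) (b : V →ₗ[𝕜] W →ₗ[𝕜] U) :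
    WeakContinuous 𝕜 fun t => b (f t) (g t) := fun φ => by
  let e := Module.finBasis 𝕜 V
  have : ∀ t, φ (b (f t) (g t)) = ∑ i, e.coord i (f t) * (φ ∘ₗ b (e i)) (g t) := fun t => by
    exact apply_eq_sum_coord e (φ ∘ₗ b.flip (g t)) (f t)
  simp only [this]
  exact continuous_finsetSum _ fun i _ => (hf _).mul (hg _)

theorem WeakContinuous.hom [FiniteDimensional 𝕜 V] {f : T → V →ₗ[𝕜] W}
    (hf : ∀ v, WeakContinuous 𝕜 fun t => f t v) : WeakContinuous 𝕜 f := fun φ => by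
  let e := Module.finBasis 𝕜 V
  have : ∀ t, φ (f t) = ∑ i, (φ ∘ₗ LinearMap.smulRightₗ (e.coord i)) (f t (e i)) := fun t => by
    have : f t = ∑ i, (e.coord i).smulRight (f t (e i)) := by
      refine e.ext fun j => ?_
      simp [LinearMap.sum_apply, Finsupp.single_apply, ite_smul]
    conv_lhs => rw [this, map_sum]
    rfl
  simp only [this]
  exact continuous_finsetSum _ fun i _ => hf _ _

end WeakContinuity

section Averaging

open MeasureTheory

variable {H : Type*} [TopologicalSpace H] [CompactSpace H]
  [MeasurableSpace H] [BorelSpace H] (μ : Measure H) [IsProbabilityMeasure μ]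
  {V W : Type*} [AddCommGroup V] [Module ℂ V] [AddCommGroup W] [Module ℂ W]

theorem integrable_of_continuous {f : H → ℂ} (hf : Continuous f) : Integrable f μ :=
  hf.integrable_of_hasCompactSupport (HasCompactSupport.of_compactSpace f)

omit [BorelSpace H] [IsProbabilityMeasure μ] [CompactSpace H] [MeasurableSpace H] in
theorem eq_of_forall_dual {v w : V} (h : ∀ φ : Module.Dual ℂ V, φ v = φ w) : v = w :=
  sub_eq_zero.1 ((Module.forall_dual_apply_eq_zero_iff ℂ _).1 fun φ => by rw [map_sub, h, sub_self])

theorem exists_weakIntegral {F : H → V} (hF : WeakContinuous ℂ F) (S : Submodule ℂ V)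
    [FiniteDimensional ℂ S] (hS : ∀ h, F h ∈ S) :
    ∃ v ∈ S, ∀ φ : Module.Dual ℂ V, φ v = ∫ h, φ (F h) ∂μ := by
  let e := Module.finBasis ℂ S
  -- A linear retraction onto `S` turns the coordinates of `S` into functionals on `V`, so weak
  -- continuity makes the coordinates of `F` integrable.
  obtain ⟨p, hp⟩ := S.subtype.exists_leftInverse_of_injective S.ker_subtype
  refine ⟨((∑ i, (∫ h, e.coord i (p (F h)) ∂μ) • e i : S) : V), Submodule.coe_mem _, fun φ => ?_⟩
  have hval : ∀ h, F h = ∑ i, e.coord i (p (F h)) • ((e i : S) : V) := fun h => by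
    have h1 : p (F h) = ⟨F h, hS h⟩ := LinearMap.congr_fun hp ⟨F h, hS h⟩
    refine Eq.trans ?_ (apply_eq_sum_coord e S.subtype (p (F h)))
    rw [h1]; rfl
  have : ∀ h, φ (F h) = ∑ i, e.coord i (p (F h)) * φ (e i) := fun h => by
    conv_lhs => rw [hval h]
    simp
  simp only [this]
  rw [integral_finsetSum _ fun i _ => Integrable.mul_const
    (f := fun h => e.coord i (p (F h)))
    (integrable_of_continuous μ (hF (e.coord i ∘ₗ p))) _]
  simp [integral_mul_const]

/-- The weak integral of a weakly continuous function with values in a finite-dimensional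
subspace. -/
def weakIntegral (F : H → V) : V :=
  Classical.epsilon fun v => ∀ φ : Module.Dual ℂ V, φ v = ∫ h, φ (F h) ∂μ

theorem weakIntegral_spec {F : H → V} (hF : WeakContinuous ℂ F) (S : Submodule ℂ V)
    [FiniteDimensional ℂ S] (hS : ∀ h, F h ∈ S) (φ : Module.Dual ℂ V) :
    φ (weakIntegral μ F) = ∫ h, φ (F h) ∂μ := by
  obtain ⟨v, -, hv⟩ := exists_weakIntegral μ hF S hS
  exact Classical.epsilon_spec (p := fun v => ∀ φ : Module.Dual ℂ V, φ v = ∫ h, φ (F h) ∂μ)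
    ⟨v, hv⟩ φ

end Averaging

/-! ### Locally finite continuous representations -/

section Representations

variable {H : Type*} [Group H]
  {V W U : Type*} [AddCommGroup V] [Module ℂ V] [AddCommGroup W] [Module ℂ W]
  [AddCommGroup U] [Module ℂ U]

/-- Every vector lies in a finite-dimensional invariant subspace. -/
def IsLocallyFiniteRep (ρ : Representation ℂ H V) : Prop :=
  ∀ x : V, ∃ S : Submodule ℂ V, FiniteDimensional ℂ S ∧ x ∈ S ∧ ∀ h, ∀ y ∈ S, ρ h y ∈ S

theorem isLocallyFiniteRep_of_finite [FiniteDimensional ℂ V] (ρ : Representation ℂ H V) :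
    IsLocallyFiniteRep ρ := fun _ =>
  ⟨⊤, inferInstance, Submodule.mem_top, fun _ _ _ => Submodule.mem_top⟩

variable {ρ : Representation ℂ H V} {σ : Representation ℂ H W}

theorem IsLocallyFiniteRep.exists_of_finset (hρ : IsLocallyFiniteRep ρ) (s : Finset V) :
    ∃ S : Submodule ℂ V, FiniteDimensional ℂ S ∧ (∀ x ∈ s, x ∈ S) ∧ ∀ h, ∀ y ∈ S, ρ h y ∈ S := by
  classical
  induction s using Finset.induction_on with
  | empty => exact ⟨⊥, inferInstance, by simp, by simp⟩
  | insert a s _ ih =>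
    obtain ⟨S, h1, h2, h3⟩ := ih
    obtain ⟨T, k1, k2, k3⟩ := hρ a
    refine ⟨S ⊔ T, inferInstance, ?_, fun h y hy => ?_⟩
    · intro x hx
      rcases Finset.mem_insert.1 hx with rfl | hx
      · exact Submodule.mem_sup_right k2
      · exact Submodule.mem_sup_left (h2 x hx)
    · obtain ⟨y, hy', z, hz, rfl⟩ := Submodule.mem_sup.1 hy
      rw [map_add]
      exact Submodule.add_mem_sup (h3 h y hy') (k3 h z hz)

theorem IsLocallyFiniteRep.exists_of_finite (hρ : IsLocallyFiniteRep ρ) (F : Submodule ℂ V)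
    [FiniteDimensional ℂ F] :
    ∃ S : Submodule ℂ V, FiniteDimensional ℂ S ∧ F ≤ S ∧ ∀ h, ∀ y ∈ S, ρ h y ∈ S := by
  obtain ⟨s, hs⟩ := (Submodule.fg_iff_finiteDimensional F).2 inferInstance
  obtain ⟨S, h1, h2, h3⟩ := hρ.exists_of_finset s
  exact ⟨S, h1, by rw [← hs, Submodule.span_le]; exact h2, h3⟩

theorem IsLocallyFiniteRep.of_injective (hσ : IsLocallyFiniteRep σ) (f : V →ₗ[ℂ] W)
    (hf : ∀ h v, f (ρ h v) = σ h (f v)) (hi : Function.Injective f) : IsLocallyFiniteRep ρ :=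
  fun x => by
  obtain ⟨S, h1, h2, h3⟩ := hσ (f x)
  refine ⟨S.comap f, ?_, h2, fun h y hy => ?_⟩
  · exact FiniteDimensional.of_injective (f.restrict (p := S.comap f) (q := S) fun _ h => h)
      fun a b hab => Subtype.ext (hi (congrArg Subtype.val hab))
  · rw [Submodule.mem_comap, hf]
    exact h3 h _ hy

theorem IsLocallyFiniteRep.of_surjective (hρ : IsLocallyFiniteRep ρ) (f : V →ₗ[ℂ] W)
    (hf : ∀ h v, f (ρ h v) = σ h (f v)) (hi : Function.Surjective f) : IsLocallyFiniteRep σ :=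
  fun x => by
  obtain ⟨x, rfl⟩ := hi x
  obtain ⟨S, h1, h2, h3⟩ := hρ x
  refine ⟨S.map f, inferInstance, Submodule.mem_map_of_mem h2, ?_⟩
  rintro h _ ⟨y, hy, rfl⟩
  exact ⟨ρ h y, h3 h y hy, hf h y⟩

variable [TopologicalSpace H]

/-- Continuity is tested on all algebraic functionals, and each functional on `V` is the pullback of
one on `W` through a linear left inverse of `f`. -/
theorem IsContinuousRep.of_injective (hσ : IsContinuousRep σ) (f : V →ₗ[ℂ] W)
    (hf : ∀ h v, f (ρ h v) = σ h (f v)) (hi : Function.Injective f) : IsContinuousRep ρ :=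
  fun x φ => by
  obtain ⟨p, hp⟩ := f.exists_leftInverse_of_injective (LinearMap.ker_eq_bot.2 hi)
  have : ∀ h, φ (ρ h x) = (φ ∘ₗ p) (σ h (f x)) := fun h => by
    rw [← hf]; exact congrArg φ (LinearMap.congr_fun hp _).symm
  simp only [this]
  exact hσ _ _

theorem IsContinuousRep.of_surjective (hρ : IsContinuousRep ρ) (f : V →ₗ[ℂ] W)
    (hf : ∀ h v, f (ρ h v) = σ h (f v)) (hi : Function.Surjective f) : IsContinuousRep σ :=
  fun x φ => by
  obtain ⟨x, rfl⟩ := hi x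
  simp only [← hf]
  exact hρ x (φ ∘ₗ f)

omit [TopologicalSpace H] in
theorem isIrreducible_of [Nontrivial V]
    (h : ∀ S : Submodule ℂ V, (∀ h, ∀ y ∈ S, ρ h y ∈ S) → S = ⊥ ∨ S = ⊤) :
    ρ.IsIrreducible where
  exists_pair_ne := ⟨⊥, ⊤, fun h => bot_ne_top (α := Submodule ℂ V)
    (congrArg Subrepresentation.toSubmodule h)⟩
  eq_bot_or_eq_top S := (h S.toSubmodule S.apply_mem_toSubmodule).imp
    (fun h => Subrepresentation.toSubmodule_injective h)
    fun h => Subrepresentation.toSubmodule_injective h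

omit [TopologicalSpace H] in
theorem eq_bot_or_eq_top_of_isIrreducible (hρ : ρ.IsIrreducible) (S : Submodule ℂ V)
    (h : ∀ h, ∀ y ∈ S, ρ h y ∈ S) : S = ⊥ ∨ S = ⊤ :=
  (hρ.eq_bot_or_eq_top ⟨S, h⟩).imp (congrArg Subrepresentation.toSubmodule)
    (congrArg Subrepresentation.toSubmodule)

omit [TopologicalSpace H] in
theorem intertwiningMap_apply (f : Representation.IntertwiningMap ρ σ) (h : H) (v : V) :
    f (ρ h v) = σ h (f v) :=
  Representation.IntertwiningMap.isIntertwining _ _ f h v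

theorem exists_irrep_equiv [FiniteDimensional ℂ V] [Nontrivial V] (hρ : IsContinuousRep ρ)
    (hirr : ∀ S : Submodule ℂ V, (∀ h, ∀ y ∈ S, ρ h y ∈ S) → S = ⊥ ∨ S = ⊤) :
    ∃ (γ : FDIrrep H) (f : Representation.IntertwiningMap γ.ρ ρ), Function.Bijective f := by
  obtain ⟨n, ⟨e⟩⟩ : ∃ n : ℕ, Nonempty ((Fin n → ℂ) ≃ₗ[ℂ] V) :=
    ⟨_, ⟨(Module.finBasis ℂ V).equivFun.symm⟩⟩
  obtain ⟨τ, hτ⟩ : ∃ τ : Representation ℂ H (Fin n → ℂ),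
      ∀ h v, e (τ h v) = ρ h (e v) :=
    ⟨{ toFun := fun h => e.symm.toLinearMap ∘ₗ ρ h ∘ₗ e.toLinearMap
       map_one' := by rw [map_one]; ext; simp
       map_mul' := fun x y => by rw [map_mul]; ext; simp }, fun h v => e.apply_symm_apply _⟩
  have : Nontrivial (Fin n → ℂ) := e.symm.injective.nontrivial
  refine ⟨⟨_, τ, isIrreducible_of fun S hS => ?_, hρ.of_injective e.toLinearMap hτ e.injective⟩,
    ⟨e.toLinearMap, fun h => LinearMap.ext fun v => hτ h v⟩, e.bijective⟩
  rcases hirr (S.map e.toLinearMap) (by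
    rintro h _ ⟨y, hy, rfl⟩
    exact ⟨τ h y, hS h y hy, hτ h y⟩) with h | h
  · left
    exact Submodule.map_injective_of_injective (f := e.toLinearMap) e.injective (h.trans (Submodule.map_bot _).symm)
  · right
    refine eq_top_iff.2 fun x _ => ?_
    obtain ⟨y, hy, hyx⟩ : e x ∈ S.map e.toLinearMap := by rw [h]; trivial
    rwa [← e.injective hyx]

/-- Every nonzero finite-dimensional continuous representation contains an irreducible one. -/
theorem exists_irrep_of_finite [FiniteDimensional ℂ V] [Nontrivial V] (hρ : IsContinuousRep ρ) :
    ∃ (γ : FDIrrep H) (f : Representation.IntertwiningMap γ.ρ ρ), Function.Injective f := by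
  classical
  -- A nonzero invariant subspace of least dimension is irreducible.
  have hex : ∃ n, ∃ S : Submodule ℂ V, (∀ h, ∀ y ∈ S, ρ h y ∈ S) ∧ S ≠ ⊥ ∧
      Module.finrank ℂ S = n := ⟨_, ⊤, fun _ _ _ => Submodule.mem_top, top_ne_bot, rfl⟩
  obtain ⟨S, hS, hS0, hSn⟩ := Nat.find_spec hex
  have hmin : ∀ S' : Submodule ℂ V, (∀ h, ∀ y ∈ S', ρ h y ∈ S') → S' ≠ ⊥ → S' ≤ S → S' = S :=
    fun S' h1 h2 h3 => Submodule.eq_of_le_of_finrank_le h3 (by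
      rw [hSn]; exact Nat.find_min' hex ⟨S', h1, h2, rfl⟩)
  have : Nontrivial S := Submodule.nontrivial_iff_ne_bot.2 hS0
  obtain ⟨γ, f, hf⟩ := exists_irrep_equiv (ρ := restrictRep ρ S hS)
    (hρ.of_injective S.subtype (fun _ _ => rfl) Subtype.val_injective) fun T hT => by
      by_cases h0 : T = ⊥
      · exact Or.inl h0
      · right
        have hTS := hmin (T.map S.subtype) (by
          rintro h _ ⟨y, hy, rfl⟩
          exact ⟨_, hT h y hy, rfl⟩)
          (fun h => h0 (Submodule.map_injective_of_injective (f := S.subtype)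
            Subtype.val_injective (h.trans (Submodule.map_bot _).symm)))
          (Submodule.map_subtype_le S T)
        refine eq_top_iff.2 fun x _ => ?_
        obtain ⟨y, hy, hyx⟩ : (x : V) ∈ T.map S.subtype := by rw [hTS]; exact x.2
        rwa [← Subtype.ext hyx]
  exact ⟨γ, ⟨S.subtype ∘ₗ f.toLinearMap, fun h => LinearMap.ext fun v =>
    congrArg Subtype.val (intertwiningMap_apply f h v)⟩, Subtype.val_injective.comp hf.1⟩

theorem exists_irrep [Nontrivial V] (hρ : IsContinuousRep ρ) (hl : IsLocallyFiniteRep ρ) :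
    ∃ (γ : FDIrrep H) (f : Representation.IntertwiningMap γ.ρ ρ), Function.Injective f := by
  obtain ⟨x, hx⟩ := exists_ne (0 : V)
  obtain ⟨S, h1, h2, h3⟩ := hl x
  have : Nontrivial S := ⟨⟨⟨x, h2⟩, 0, fun h => hx (congrArg Subtype.val h)⟩⟩
  obtain ⟨γ, f, hf⟩ := exists_irrep_of_finite
    (ρ := restrictRep ρ S h3) (hρ.of_injective S.subtype (fun _ _ => rfl) Subtype.val_injective)
  exact ⟨γ, ⟨S.subtype ∘ₗ f.toLinearMap, fun h => LinearMap.ext fun v =>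
    congrArg Subtype.val (intertwiningMap_apply f h v)⟩, Subtype.val_injective.comp hf⟩

/-- If every irreducible representation has finite multiplicity in `σ`, so has every
finite-dimensional continuous representation. -/
theorem finite_intertwiningMap_of_finite (hσ : HasFiniteMultiplicities σ) (n : ℕ) :
    ∀ {V : Type*} [AddCommGroup V] [Module ℂ V] [FiniteDimensional ℂ V]
    (ρ : Representation ℂ H V) (_ : IsContinuousRep ρ) (_ : Module.finrank ℂ V = n),
    Module.Finite ℂ (Representation.IntertwiningMap ρ σ) := by
  induction n using Nat.strong_induction_on with
  | _ n ih =>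
  intro V _ _ _ ρ hρ hn
  rcases subsingleton_or_nontrivial V with hV | hV
  · have : Subsingleton (Representation.IntertwiningMap ρ σ) :=
      ⟨fun f g => Representation.IntertwiningMap.ext (Subsingleton.elim _ _)⟩
    infer_instance
  · obtain ⟨γ, f, hf⟩ := exists_irrep_of_finite hρ
    let S := LinearMap.range f.toLinearMap
    have hS : ∀ h, ∀ y ∈ S, ρ h y ∈ S := by
      rintro h _ ⟨y, rfl⟩
      exact ⟨γ.ρ h y, intertwiningMap_apply f h y⟩
    have hn' : Module.finrank ℂ (V ⧸ S) < n := by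
      have h1 := S.finrank_quotient_add_finrank
      have h2 : 0 < Module.finrank ℂ S := by
        have : Nontrivial (Fin γ.dim → ℂ) := by
          have := γ.irreducible
          obtain ⟨A, B, hAB⟩ := this.exists_pair_ne
          by_contra hc
          rw [not_nontrivial_iff_subsingleton] at hc
          exact hAB (Subrepresentation.toSubmodule_injective (Subsingleton.elim _ _))
        rw [LinearMap.finrank_range_of_inj hf]
        exact Module.finrank_pos
      omega
    have hq := ih _ hn' (ρ.quotient S hS) (hρ.of_surjective S.mkQ (fun _ _ => rfl)
      S.mkQ_surjective) rfl
    have hγ := hσ γ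
    let A : Representation.IntertwiningMap ρ σ →ₗ[ℂ] Representation.IntertwiningMap γ.ρ σ :=
      { toFun := fun g => g.comp f
        map_add' := fun _ _ => rfl
        map_smul' := fun _ _ => rfl }
    -- Left exactness of `Hom(·, σ)`: intertwiners vanishing on the irreducible subspace `S` factor
    -- through the quotient, whose dimension is smaller. The two outer terms are finite-dimensional,
    -- hence so is the middle one.
    let C : LinearMap.ker A →ₗ[ℂ] Representation.IntertwiningMap (ρ.quotient S hS) σ :=
      { toFun := fun g => ⟨S.liftQ g.1.toLinearMap (by
            rintro _ ⟨y, rfl⟩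
            exact congrArg (fun t : Representation.IntertwiningMap γ.ρ σ => t y) g.2), fun h => by
            ext v
            exact intertwiningMap_apply g.1 h v⟩
        map_add' := fun _ _ => Representation.IntertwiningMap.ext (by ext; rfl)
        map_smul' := fun _ _ => Representation.IntertwiningMap.ext (by ext; rfl) }
    have hC : Function.Injective C := fun g g' h => Subtype.ext
      (Representation.IntertwiningMap.ext (LinearMap.ext fun v =>
        congrArg (fun t : Representation.IntertwiningMap (ρ.quotient S hS) σ => t (S.mkQ v)) h))
    have := FiniteDimensional.of_injective C hC
    have h3 : (LinearMap.ker A).FG := (Submodule.fg_iff_finiteDimensional _).2 this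
    have h4 : (LinearMap.range A).FG := (Submodule.fg_iff_finiteDimensional _).2 inferInstance
    refine Module.finite_def.2 (Submodule.fg_of_fg_map_of_fg_inf_ker A ?_ ?_)
    · rwa [Submodule.map_top]
    · rwa [top_inf_eq]

end Representations

/-! ### Averaging over a compact group and lifting of intertwiners -/

section Lifting

open MeasureTheory

variable {H : Type*} [Group H] [TopologicalSpace H] [IsTopologicalGroup H] [CompactSpace H]
  {V W F : Type*} [AddCommGroup V] [Module ℂ V] [AddCommGroup W] [Module ℂ W]
  [AddCommGroup F] [Module ℂ F] [FiniteDimensional ℂ F]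

/-- A compact group has a left-invariant probability measure, which is positive on open sets. -/
theorem exists_haar_probability (H : Type*) [Group H] [TopologicalSpace H] [IsTopologicalGroup H]
    [CompactSpace H] [MeasurableSpace H] [BorelSpace H] :
    ∃ μ : Measure H, IsProbabilityMeasure μ ∧ μ.IsMulLeftInvariant ∧ μ.IsOpenPosMeasure :=
  ⟨Measure.haarMeasure ⊤, ⟨by
    have := Measure.haarMeasure_self (K₀ := (⊤ : TopologicalSpace.PositiveCompacts H))
    simpa using this⟩, inferInstance, inferInstance⟩

/-- Averaging a linear map over a compact group. -/
theorem exists_average [MeasurableSpace H] [BorelSpace H] (μ : Measure H) [IsProbabilityMeasure μ]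
    [μ.IsMulLeftInvariant] {ρ : Representation ℂ H V} {γ : Representation ℂ H F}
    (hρ : IsContinuousRep ρ) (hl : IsLocallyFiniteRep ρ) (hγ : IsContinuousRep γ) (f₀ : F →ₗ[ℂ] V) :
    ∃ g : Representation.IntertwiningMap γ ρ, ∀ x (φ : Module.Dual ℂ V),
      φ (g x) = ∫ h, φ (ρ h (f₀ (γ h⁻¹ x))) ∂μ := by
  obtain ⟨S, hS1, hS2, hS3⟩ := hl.exists_of_finite (LinearMap.range f₀)
  let A : F → H → V := fun x h => ρ h (f₀ (γ h⁻¹ x))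
  have hA : ∀ x, WeakContinuous ℂ (A x) := fun x => by
    have h1 : WeakContinuous ℂ fun h : H => γ h⁻¹ x := fun φ => (hγ x φ).comp continuous_inv
    have h2 : ∀ y : V, WeakContinuous ℂ fun h : H => ρ h y := fun y φ => hρ y φ
    intro φ
    let e := Module.finBasis ℂ F
    have : ∀ h, φ (A x h) = ∑ i, e.coord i (γ h⁻¹ x) * φ (ρ h (f₀ (e i))) := fun h => by
      exact apply_eq_sum_coord e (φ ∘ₗ ρ h ∘ₗ f₀) (γ h⁻¹ x)
    simp only [this]
    exact continuous_finsetSum _ fun i _ => (h1 _).mul (h2 _ _)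
  -- Local finiteness confines the integrand to one finite-dimensional subspace, in which the
  -- integral exists.
  have hAS : ∀ x h, A x h ∈ S := fun x h => hS3 h _ (hS2 ⟨_, rfl⟩)
  have spec : ∀ x (φ : Module.Dual ℂ V), φ (weakIntegral μ (A x)) = ∫ h, φ (A x h) ∂μ :=
    fun x => weakIntegral_spec μ (hA x) S (hAS x)
  have hint : ∀ x (φ : Module.Dual ℂ V), Integrable (fun h => φ (A x h)) μ :=
    fun x φ => integrable_of_continuous μ (hA x φ)
  let g : F →ₗ[ℂ] V :=
    { toFun := fun x => weakIntegral μ (A x)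
      map_add' := fun x y => eq_of_forall_dual fun φ => by
        rw [map_add, spec, spec, spec, ← integral_add (hint _ _) (hint _ _)]
        simp [A]
      map_smul' := fun c x => eq_of_forall_dual fun φ => by
        rw [map_smul, spec, RingHom.id_apply, spec, smul_eq_mul, ← integral_const_mul]
        simp [A] }
  refine ⟨⟨g, fun k => LinearMap.ext fun x => eq_of_forall_dual fun φ => ?_⟩, spec⟩
  change φ (weakIntegral μ (A (γ k x))) = (φ ∘ₗ ρ k) (weakIntegral μ (A x))
  -- Equivariance is the substitution `h ↦ k h` in the integral.
  rw [spec, spec, ← integral_mul_left_eq_self _ k]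
  congr 1
  ext h
  simp only [A, mul_inv_rev, map_mul, LinearMap.comp_apply]
  simp only [Module.End.mul_apply]
  rw [← Module.End.mul_apply (γ k⁻¹), ← map_mul, inv_mul_cancel, map_one, Module.End.one_apply]

/-- Intertwiners from finite-dimensional representations of a compact group lift along surjections
of locally finite continuous representations. -/
theorem exists_lift_intertwiningMap {ρ : Representation ℂ H V} {σ : Representation ℂ H W}
    {γ : Representation ℂ H F} (hρ : IsContinuousRep ρ) (hl : IsLocallyFiniteRep ρ)
    (hγ : IsContinuousRep γ) (q : V →ₗ[ℂ] W) (hq : ∀ h v, q (ρ h v) = σ h (q v))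
    (hqs : Function.Surjective q) (f : Representation.IntertwiningMap γ σ) :
    ∃ g : Representation.IntertwiningMap γ ρ, ∀ x, q (g x) = f x := by
  let _ : MeasurableSpace H := borel H
  have : BorelSpace H := ⟨rfl⟩
  obtain ⟨μ, _, _, -⟩ := exists_haar_probability H
  obtain ⟨s, hs⟩ := q.exists_rightInverse_of_surjective (LinearMap.range_eq_top.2 hqs)
  -- The average of a merely linear lift is still a lift: after applying `q` the integrand is the
  -- constant `f x`, and the measure has mass one.
  obtain ⟨g, hg⟩ := exists_average μ hρ hl hγ (s ∘ₗ f.toLinearMap)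
  refine ⟨g, fun x => eq_of_forall_dual fun φ => (hg x (φ ∘ₗ q)).trans ?_⟩
  have : ∀ h, (φ ∘ₗ q) (ρ h ((s ∘ₗ f.toLinearMap) (γ h⁻¹ x))) = φ (f x) := fun h => by
    have h1 : q (s (f (γ h⁻¹ x))) = f (γ h⁻¹ x) := LinearMap.congr_fun hs _
    change φ (q (ρ h (s (f (γ h⁻¹ x))))) = _
    rw [hq, h1, intertwiningMap_apply, ← Module.End.mul_apply (σ h), ← map_mul, mul_inv_cancel,
      map_one, Module.End.one_apply]
  simp only [this]
  simp

end Lifting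

end

section

/-! ### The index of an odd equivariant operator -/

section IndexFormula

variable {H : Type*} [Group H] [TopologicalSpace H]
  {V : Type*} [AddCommGroup V] [Module ℂ V] {ρ : Representation ℂ H V} {T : Module.End ℂ V}
  (hT : ∀ h y, ρ h (T y) = T (ρ h y))

theorem multiplicity_add_finrank_ker {U N : Type*} [AddCommGroup U] [Module ℂ U]
    {σ : Representation ℂ H U} {γ : FDIrrep H} [AddCommGroup N] [Module ℂ N]
    [FiniteDimensional ℂ N] (Ψ : N →ₗ[ℂ] Representation.IntertwiningMap γ.ρ σ)
    (hΨ : Function.Surjective Ψ) :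
    multiplicity γ σ + Module.finrank ℂ (LinearMap.ker Ψ) = Module.finrank ℂ N := by
  have h1 := LinearMap.finrank_range_add_finrank_ker (K := ℂ) Ψ
  rwa [LinearMap.range_eq_top.2 hΨ, finrank_top] at h1

/-- Composition with an equivariant operator mapping the invariant subspace `A` to `A'`. -/
def postcompOn {A A' : Submodule ℂ V} (hA : ∀ h, ∀ y ∈ A, ρ h y ∈ A)
    (hA' : ∀ h, ∀ y ∈ A', ρ h y ∈ A') (hAA' : ∀ y ∈ A, T y ∈ A') (γ : FDIrrep H) :
    Representation.IntertwiningMap γ.ρ (restrictRep ρ A hA) →ₗ[ℂ]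
      Representation.IntertwiningMap γ.ρ (restrictRep ρ A' hA') where
  toFun f := ⟨T.restrict hAA' ∘ₗ f.toLinearMap, fun h => LinearMap.ext fun x => Subtype.ext (by
    change T (f (γ.ρ h x) : A) = ρ h (T (f x : A))
    rw [intertwiningMap_apply, hT]; rfl)⟩
  map_add' f g := Representation.IntertwiningMap.ext (by
    ext x; exact map_add T _ _)
  map_smul' c f := Representation.IntertwiningMap.ext (by
    ext x; exact map_smul T _ _)

variable [IsTopologicalGroup H] [CompactSpace H]

/-- The cycles `ker T ∩ A` surject onto the corresponding part of the cohomology, so averaging lifts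
`f` to an intertwiner with values in cycles. -/
theorem exists_lift_cohomologyPart (hρ : IsContinuousRep ρ) (hl : IsLocallyFiniteRep ρ)
    {A : Submodule ℂ V} (hA : ∀ h, ∀ y ∈ A, ρ h y ∈ A) (γ : FDIrrep H)
    (f : Representation.IntertwiningMap γ.ρ (restrictRep (cohomologyRep ρ T hT)
      (cohomologyPart T A) (cohomologyRep_mem_part ρ T hT A hA))) :
    ∃ g : Representation.IntertwiningMap γ.ρ (restrictRep ρ A hA),
      ∃ hg : ∀ x, T (g x : A) = 0, ∀ x, ((f x : cohomologyPart T A) : Cohomology T) =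
        (kerInterRange T).mkQ ⟨(g x : A), hg x⟩ := by
  let C : Submodule ℂ V := LinearMap.ker T ⊓ A
  have hC : ∀ h, ∀ y ∈ C, ρ h y ∈ C := fun h y hy =>
    ⟨by have : T y = 0 := hy.1
        exact LinearMap.mem_ker.2 (by rw [← hT, this, map_zero]), hA h y hy.2⟩
  let q : C →ₗ[ℂ] cohomologyPart T A :=
    { toFun := fun c => ⟨(kerInterRange T).mkQ ⟨c, c.2.1⟩, ⟨⟨c, c.2.1⟩, c.2.2, rfl⟩⟩
      map_add' := fun _ _ => rfl
      map_smul' := fun _ _ => rfl }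
  obtain ⟨g, hg⟩ := exists_lift_intertwiningMap (ρ := restrictRep ρ C hC)
    (σ := restrictRep (cohomologyRep ρ T hT) (cohomologyPart T A)
      (cohomologyRep_mem_part ρ T hT A hA)) (γ := γ.ρ)
    (hρ.of_injective C.subtype (fun _ _ => rfl) Subtype.val_injective)
    (hl.of_injective C.subtype (fun _ _ => rfl) Subtype.val_injective) γ.continuous q
    (fun _ _ => rfl) (by
      rintro ⟨_, ⟨y, hy, rfl⟩⟩
      exact ⟨⟨y, y.2, hy⟩, rfl⟩) f
  refine ⟨⟨Submodule.inclusion inf_le_right ∘ₗ g.toLinearMap, fun h => LinearMap.ext fun x =>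
    Subtype.ext (congrArg Subtype.val (intertwiningMap_apply g h x) :)⟩, fun x => (g x).2.1,
    fun x => ?_⟩
  rw [← hg x]
  rfl

variable (hρ : IsContinuousRep ρ) (hl : IsLocallyFiniteRep ρ)
  {A A' : Submodule ℂ V} (hA : ∀ h, ∀ y ∈ A, ρ h y ∈ A) (hA' : ∀ h, ∀ y ∈ A', ρ h y ∈ A')
  (hc : Disjoint A A') (hc' : A ⊔ A' = ⊤) (hAA' : ∀ y ∈ A, T y ∈ A') (hA'A : ∀ y ∈ A', T y ∈ A)
  (γ : FDIrrep H)

include hρ hl hc hc' hAA' in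
-- Since `T` is odd and `A ⊕ A'` is everything, an element of `A` in the image of `T` is already in
-- the image of `A'`. So `f` takes values in `T(A')` and lifts along the surjection `A' → T(A')`.
theorem exists_postcompOn_eq (f : Representation.IntertwiningMap γ.ρ (restrictRep ρ A hA))
    (hf : ∀ x, ∃ y, T y = (f x : A)) :
    ∃ g : Representation.IntertwiningMap γ.ρ (restrictRep ρ A' hA'),
      postcompOn hT hA' hA hA'A γ g = f := by
  have hr : ∀ x, ∃ b : A', T.restrict hA'A b = f x := fun x => by
    obtain ⟨y, hy⟩ := hf x
    obtain ⟨a, ha, b, hb, rfl⟩ := Submodule.mem_sup.1 (hc' ▸ Submodule.mem_top : y ∈ A ⊔ A')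
    refine ⟨⟨b, hb⟩, Subtype.ext ?_⟩
    have h1 : T a = (f x : A) - T b := by rw [← hy, map_add, add_sub_cancel_right]
    have h2 : T a = 0 := Submodule.disjoint_def.1 hc _
      (h1 ▸ sub_mem (f x).2 (hA'A b hb)) (hAA' a ha)
    exact (sub_eq_zero.1 (h1 ▸ h2)).symm
  let I := LinearMap.range (T.restrict hA'A)
  have hI : ∀ h, ∀ y ∈ I, restrictRep ρ A hA h y ∈ I := by
    rintro h _ ⟨y, rfl⟩
    exact ⟨restrictRep ρ A' hA' h y, Subtype.ext (hT h y).symm⟩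
  let f' : Representation.IntertwiningMap γ.ρ (restrictRep (restrictRep ρ A hA) I hI) :=
    ⟨f.toLinearMap.codRestrict I hr, fun h => LinearMap.ext fun x =>
      Subtype.ext (intertwiningMap_apply f h x)⟩
  obtain ⟨g, hg⟩ := exists_lift_intertwiningMap (ρ := restrictRep ρ A' hA')
    (σ := restrictRep (restrictRep ρ A hA) I hI) (γ := γ.ρ)
    (hρ.of_injective A'.subtype (fun _ _ => rfl) Subtype.val_injective)
    (hl.of_injective A'.subtype (fun _ _ => rfl) Subtype.val_injective) γ.continuous
    (T.restrict hA'A).rangeRestrict (fun h v => Subtype.ext (Subtype.ext (hT h v).symm))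
    (LinearMap.surjective_rangeRestrict _) f'
  exact ⟨g, Representation.IntertwiningMap.ext (LinearMap.ext fun x =>
    congrArg Subtype.val (hg x))⟩

include hρ hl hc hc' in
-- Exactness of `Hom(γ, ·)` identifies intertwiners into the cohomology with the kernel of `T` on
-- intertwiners into `A`, modulo the image of `T` from intertwiners into `A'`. Only `T² = 0` on
-- images of `γ` is required; the formula is written additively to avoid truncated subtraction.
theorem multiplicity_cohomologyPart_of_sq_eq_zero
    (hfin : Module.Finite ℂ (Representation.IntertwiningMap γ.ρ (restrictRep ρ A hA)))
    (hsq : ∀ (f : Representation.IntertwiningMap γ.ρ (restrictRep ρ A' hA')) x,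
      T (T (f x : A')) = 0) :
    multiplicity γ (restrictRep (cohomologyRep ρ T hT) (cohomologyPart T A)
        (cohomologyRep_mem_part ρ T hT A hA)) +
      Module.finrank ℂ (LinearMap.range (postcompOn hT hA' hA hA'A γ)) =
      Module.finrank ℂ (LinearMap.ker (postcompOn hT hA hA' hAA' γ)) := by
  have hker : ∀ f : LinearMap.ker (postcompOn hT hA hA' hAA' γ), ∀ x, T (f.1 x : A) = 0 :=
    fun f x => congrArg (fun t : Representation.IntertwiningMap γ.ρ (restrictRep ρ A' hA') =>
      ((t x : A') : V)) f.2
  let Ψ : LinearMap.ker (postcompOn hT hA hA' hAA' γ) →ₗ[ℂ]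
      Representation.IntertwiningMap γ.ρ (restrictRep (cohomologyRep ρ T hT) (cohomologyPart T A)
        (cohomologyRep_mem_part ρ T hT A hA)) :=
    { toFun := fun f => ⟨
        { toFun := fun x => ⟨(kerInterRange T).mkQ ⟨(f.1 x : A), hker f x⟩,
            ⟨⟨(f.1 x : A), hker f x⟩, (f.1 x).2, rfl⟩⟩
          map_add' := fun x y => Subtype.ext (by
            change (kerInterRange T).mkQ _ = (kerInterRange T).mkQ _ + (kerInterRange T).mkQ _
            rw [← map_add]
            congr 1
            exact Subtype.ext (congrArg Subtype.val (map_add f.1 x y) :))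
          map_smul' := fun c x => Subtype.ext (by
            change (kerInterRange T).mkQ _ = c • (kerInterRange T).mkQ _
            rw [← map_smul]
            congr 1
            exact Subtype.ext (congrArg Subtype.val (map_smul f.1 c x) :)) },
        fun h => LinearMap.ext fun x => Subtype.ext (by
          change (kerInterRange T).mkQ _ = (kerInterRange T).mkQ _
          congr 1
          exact Subtype.ext (congrArg Subtype.val (intertwiningMap_apply f.1 h x) :))⟩
      map_add' := fun f g => Representation.IntertwiningMap.ext (LinearMap.ext fun x => rfl)
      map_smul' := fun c f => Representation.IntertwiningMap.ext (LinearMap.ext fun x => rfl) }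
  have hsurj : Function.Surjective Ψ := fun f => by
    obtain ⟨g, hg, h⟩ := exists_lift_cohomologyPart hT hρ hl hA γ f
    refine ⟨⟨g, LinearMap.mem_ker.2 (Representation.IntertwiningMap.ext (LinearMap.ext fun x =>
      Subtype.ext (hg x)))⟩, Representation.IntertwiningMap.ext (LinearMap.ext fun x =>
      Subtype.ext (h x).symm)⟩
  have hle : LinearMap.range (postcompOn hT hA' hA hA'A γ) ≤
      LinearMap.ker (postcompOn hT hA hA' hAA' γ) := by
    rintro _ ⟨g, rfl⟩
    exact LinearMap.mem_ker.2 (Representation.IntertwiningMap.ext (LinearMap.ext fun x =>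
      Subtype.ext (hsq g x)))
  -- The class of an intertwiner vanishes when its values are in the image of `T`, and then the
  -- intertwiner itself has the form `T ∘ g`.
  have hkerΨ : (LinearMap.ker Ψ).map (Submodule.subtype _) =
      LinearMap.range (postcompOn hT hA' hA hA'A γ) := by
    ext f
    constructor
    · rintro ⟨f, hf, rfl⟩
      obtain ⟨g, hg⟩ := exists_postcompOn_eq hT hρ hl hA hA' hc hc' hAA' hA'A γ f.1 fun x => by
        have h1 : (kerInterRange T).mkQ ⟨(f.1 x : A), hker f x⟩ = 0 :=
          congrArg (fun t : Representation.IntertwiningMap γ.ρ (restrictRep (cohomologyRep ρ T hT)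
            (cohomologyPart T A) (cohomologyRep_mem_part ρ T hT A hA)) =>
            ((t x : cohomologyPart T A) : Cohomology T)) hf
        exact (Submodule.Quotient.mk_eq_zero _).1 h1
      exact ⟨g, hg⟩
    · intro hf
      refine ⟨⟨f, hle hf⟩, ?_, rfl⟩
      obtain ⟨g, rfl⟩ := hf
      refine LinearMap.mem_ker.2 (Representation.IntertwiningMap.ext (LinearMap.ext fun x =>
        Subtype.ext ?_))
      exact (Submodule.Quotient.mk_eq_zero _).2 ⟨(g x : A'), rfl⟩
  have h1 := multiplicity_add_finrank_ker (U := cohomologyPart T A)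
    (σ := restrictRep (cohomologyRep ρ T hT) (cohomologyPart T A)
      (cohomologyRep_mem_part ρ T hT A hA)) (γ := γ)
    (N := LinearMap.ker (postcompOn hT hA hA' hAA' γ)) Ψ hsurj
  rw [← hkerΨ, LinearEquiv.finrank_eq (Submodule.equivMapOfInjective _
    (Submodule.subtype_injective _) _).symm]
  exact h1

include hρ hl in
-- A lift `g` to cycles satisfies `0 = T² g = c g`, so `g = 0`.
theorem multiplicity_cohomologyPart_of_sq_ne_zero {c : ℂ} (hc0 : c ≠ 0)
    (hsq : ∀ (f : Representation.IntertwiningMap γ.ρ (restrictRep ρ A hA)) x,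
      T (T (f x : A)) = c • ((f x : A) : V)) :
    multiplicity γ (restrictRep (cohomologyRep ρ T hT) (cohomologyPart T A)
        (cohomologyRep_mem_part ρ T hT A hA)) = 0 := by
  have : Subsingleton (Representation.IntertwiningMap γ.ρ (restrictRep (cohomologyRep ρ T hT)
      (cohomologyPart T A) (cohomologyRep_mem_part ρ T hT A hA))) := by
    refine subsingleton_of_forall_eq 0 fun f => ?_
    obtain ⟨g, hg, h⟩ := exists_lift_cohomologyPart hT hρ hl hA γ f
    refine Representation.IntertwiningMap.ext (LinearMap.ext fun x => Subtype.ext ?_)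
    refine (h x).trans ?_
    have h0 : ((g x : A) : V) = 0 := by
      have := hsq g x
      rw [hg, map_zero] at this
      exact (smul_eq_zero.1 this.symm).resolve_left hc0
    exact (Submodule.Quotient.mk_eq_zero _).2 ⟨0, by rw [map_zero]; exact h0.symm⟩
  exact Module.finrank_zero_of_subsingleton

include hT in
omit [IsTopologicalGroup H] [CompactSpace H] in
-- Composition with `T` is injective on intertwiners because its square is an invertible scalar.
-- Used in both directions, this gives equality of multiplicities.
theorem finrank_le_of_postcompOn {c : ℂ} (hc0 : c ≠ 0)
    (hfin : Module.Finite ℂ (Representation.IntertwiningMap γ.ρ (restrictRep ρ A' hA')))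
    (hsq : ∀ (f : Representation.IntertwiningMap γ.ρ (restrictRep ρ A hA)) x,
      T (T (f x : A)) = c • ((f x : A) : V)) (hAA' : ∀ y ∈ A, T y ∈ A') :
    multiplicity γ (restrictRep ρ A hA) ≤ multiplicity γ (restrictRep ρ A' hA') := by
  refine LinearMap.finrank_le_finrank_of_injective (f := postcompOn hT hA hA' hAA' γ)
    ((injective_iff_map_eq_zero _).2 fun f hf => ?_)
  refine Representation.IntertwiningMap.ext (LinearMap.ext fun x => Subtype.ext ?_)
  have h1 : T (f x : A) = 0 :=
    congrArg (fun t : Representation.IntertwiningMap γ.ρ (restrictRep ρ A' hA') =>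
      ((t x : A') : V)) hf
  have h2 := hsq f x
  rw [h1, map_zero] at h2
  exact (smul_eq_zero.1 h2.symm).resolve_left hc0

include hρ hl hc hc' hAA' hA'A in
/-- The index formula: if the square of an odd equivariant operator acts by a scalar on each
isotypic component, then the Euler characteristic of its cohomology equals that of the space. -/
theorem multiplicity_sub_cohomologyPart
    (hfin : Module.Finite ℂ (Representation.IntertwiningMap γ.ρ (restrictRep ρ A hA)))
    (hfin' : Module.Finite ℂ (Representation.IntertwiningMap γ.ρ (restrictRep ρ A' hA')))
    {c : ℂ} (hsq : ∀ (f : Representation.IntertwiningMap γ.ρ ρ) x, T (T (f x)) = c • f x) :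
    (multiplicity γ (restrictRep (cohomologyRep ρ T hT) (cohomologyPart T A)
        (cohomologyRep_mem_part ρ T hT A hA)) : ℤ) -
      multiplicity γ (restrictRep (cohomologyRep ρ T hT) (cohomologyPart T A')
        (cohomologyRep_mem_part ρ T hT A' hA')) =
      (multiplicity γ (restrictRep ρ A hA) : ℤ) - multiplicity γ (restrictRep ρ A' hA') := by
  have hs1 : ∀ (f : Representation.IntertwiningMap γ.ρ (restrictRep ρ A hA)) x,
      T (T (f x : A)) = c • ((f x : A) : V) := fun f x => hsq ⟨A.subtype ∘ₗ f.toLinearMap,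
    fun h => LinearMap.ext fun x => congrArg Subtype.val (intertwiningMap_apply f h x)⟩ x
  have hs2 : ∀ (f : Representation.IntertwiningMap γ.ρ (restrictRep ρ A' hA')) x,
      T (T (f x : A')) = c • ((f x : A') : V) := fun f x => hsq ⟨A'.subtype ∘ₗ f.toLinearMap,
    fun h => LinearMap.ext fun x => congrArg Subtype.val (intertwiningMap_apply f h x)⟩ x
  by_cases hc0 : c = 0
  · have e1 := multiplicity_cohomologyPart_of_sq_eq_zero hT hρ hl hA hA' hc hc' hAA' hA'A γ hfin
      fun f x => by rw [hs2, hc0, zero_smul]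
    have e2 := multiplicity_cohomologyPart_of_sq_eq_zero hT hρ hl hA' hA hc.symm
      (by rwa [sup_comm]) hA'A hAA' γ hfin' fun f x => by rw [hs1, hc0, zero_smul]
    -- The rank of each of the two maps enters once through `e1` or `e2` and once through
    -- rank-nullity, and cancels in the difference.
    have e3 := LinearMap.finrank_range_add_finrank_ker (K := ℂ) (postcompOn hT hA hA' hAA' γ)
    have e4 := LinearMap.finrank_range_add_finrank_ker (K := ℂ) (postcompOn hT hA' hA hA'A γ)
    simp only [multiplicity] at *
    omega
  · rw [multiplicity_cohomologyPart_of_sq_ne_zero hT hρ hl hA γ hc0 hs1,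
      multiplicity_cohomologyPart_of_sq_ne_zero hT hρ hl hA' γ hc0 hs2,
      le_antisymm (finrank_le_of_postcompOn hT hA hA' γ hc0 hfin' hs1 hAA')
        (finrank_le_of_postcompOn hT hA' hA γ hc0 hfin hs2 hA'A)]
    simp

end IndexFormula

end

section

/-! ### The preferred chart at the identity -/

section ChartAtOne

open Filter Topology VectorField

universe u v

variable (E : Type u) [NormedAddCommGroup E] [NormedSpace ℝ E] (G : Type v)
  [TopologicalSpace G] [ChartedSpace E G] [Group G]

/-- The preferred chart at `1`, as a map to `E`. -/
def logChart : G → E := extChartAt 𝓘(ℝ, E) (1 : G)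

/-- The inverse of the preferred chart at `1`. -/
def expChart : E → G := (extChartAt 𝓘(ℝ, E) (1 : G)).symm

/-- The image of `1` in the preferred chart at `1`. -/
def chartOrigin : E := logChart E G 1

@[simp] theorem expChart_origin : expChart E G (chartOrigin E G) = 1 :=
  extChartAt_to_inv (I := 𝓘(ℝ, E)) (1 : G)

theorem logChart_one : logChart E G 1 = chartOrigin E G := rfl

theorem expChart_logChart {g : G} (hg : g ∈ (extChartAt 𝓘(ℝ, E) (1 : G)).source) :
    expChart E G (logChart E G g) = g :=
  (extChartAt 𝓘(ℝ, E) (1 : G)).left_inv hg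

theorem eventually_expChart_logChart : ∀ᶠ g in 𝓝 (1 : G), expChart E G (logChart E G g) = g :=
  Filter.eventually_of_mem (extChartAt_source_mem_nhds (I := 𝓘(ℝ, E)) (1 : G))
    fun _ hg => expChart_logChart E G hg

theorem target_mem_nhds : (extChartAt 𝓘(ℝ, E) (1 : G)).target ∈ 𝓝 (chartOrigin E G) :=
  extChartAt_target_mem_nhds (I := 𝓘(ℝ, E)) (1 : G)

theorem eventually_logChart_expChart :
    ∀ᶠ x in 𝓝 (chartOrigin E G), logChart E G (expChart E G x) = x :=
  Filter.eventually_of_mem (target_mem_nhds E G)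
    fun _ hx => (extChartAt 𝓘(ℝ, E) (1 : G)).right_inv hx

variable [LieGroup 𝓘(ℝ, E) ∞ G]

theorem contMDiffAt_expChart {x : E} (hx : x ∈ (extChartAt 𝓘(ℝ, E) (1 : G)).target) :
    ContMDiffAt 𝓘(ℝ, E) 𝓘(ℝ, E) ∞ (expChart E G) x :=
  have := LieGroup.toContMDiffMul (I := 𝓘(ℝ, E)) (n := ∞) (G := G)
  have : IsManifold 𝓘(ℝ, E) ∞ G := inferInstance
  (contMDiffOn_extChartAt_symm (1 : G)).contMDiffAt
    ((isOpen_extChartAt_target (I := 𝓘(ℝ, E)) (1 : G)).mem_nhds hx)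

theorem contMDiffAt_expChart_origin :
    ContMDiffAt 𝓘(ℝ, E) 𝓘(ℝ, E) ∞ (expChart E G) (chartOrigin E G) :=
  contMDiffAt_expChart E G (mem_of_mem_nhds (target_mem_nhds E G))

omit [LieGroup 𝓘(ℝ, E) ∞ G] in
theorem contMDiffAt_logChart_one : ContMDiffAt 𝓘(ℝ, E) 𝓘(ℝ, E) ∞ (logChart E G) (1 : G) :=
  contMDiffAt_extChartAt

omit [LieGroup 𝓘(ℝ, E) ∞ G] in
theorem continuousAt_logChart_one : ContinuousAt (logChart E G) (1 : G) :=
  (contMDiffAt_logChart_one E G).continuousAt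

variable {E G}

omit [LieGroup 𝓘(ℝ, E) ∞ G] in
/-- A function into `G` that is smooth near a point sent to `1` is smooth in the chart. -/
theorem contDiffAt_logChart_comp {F : Type*} [NormedAddCommGroup F] [NormedSpace ℝ F] {f : F → G}
    {x : F} (hf : ContMDiffAt 𝓘(ℝ, F) 𝓘(ℝ, E) ∞ f x) (hx : f x = 1) :
    ContDiffAt ℝ ∞ (fun y => logChart E G (f y)) x := by
  rw [← contMDiffAt_iff_contDiffAt]
  have := contMDiffAt_logChart_one E G
  rw [← hx] at this
  exact this.comp x hf

omit [LieGroup 𝓘(ℝ, E) ∞ G] in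
-- The tangent space at `1` is the model space through this very chart, so velocities become
-- ordinary derivatives. All later differentiation of curves goes through this form.
theorem hasVelocityAtOne_iff {c : ℝ → G} {Z : LieAlg E G} :
    HasVelocityAtOne c Z ↔ c 0 = 1 ∧ ContinuousAt c 0 ∧
      HasDerivAt (fun t => logChart E G (c t)) (Z : E) 0 := by
  unfold HasVelocityAtOne
  refine and_congr_right fun h0 => ?_
  refine and_congr_right fun hc => ?_
  have e : writtenInExtChartAt 𝓘(ℝ, ℝ) 𝓘(ℝ, E) 0 c = fun t => logChart E G (c t) := by
    funext t
    simp only [writtenInExtChartAt, logChart, h0, mfld_simps, chartAt_self_eq]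
  have key : ∀ (f : ℝ → E) (z : E), HasFDerivWithinAt f
      (ContinuousLinearMap.toSpanSingleton ℝ z : ℝ →L[ℝ] E) Set.univ 0 ↔ HasDerivAt f z 0 :=
    fun f z => by rw [hasFDerivWithinAt_univ, hasDerivAt_iff_hasFDerivAt]
  refine Iff.trans ?_ (key _ Z)
  rw [← e]
  have h1 : Set.range (𝓘(ℝ, ℝ) : ℝ → ℝ) = Set.univ := by simp only [mfld_simps]
  have h2 : extChartAt 𝓘(ℝ, ℝ) (0 : ℝ) 0 = 0 := by simp only [mfld_simps, chartAt_self_eq]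
  rw [← h1]
  conv_rhs => rw [← h2]
  exact Iff.rfl

omit [LieGroup 𝓘(ℝ, E) ∞ G] in
theorem diffAtOne_eq {f : G → G} (h1 : f 1 = 1) (hf : MDifferentiableAt 𝓘(ℝ, E) 𝓘(ℝ, E) f 1)
    (X : LieAlg E G) : (diffAtOne f X : E) =
      fderiv ℝ (fun x => logChart E G (f (expChart E G x))) (chartOrigin E G) (X : E) := by
  have e : writtenInExtChartAt 𝓘(ℝ, E) 𝓘(ℝ, E) 1 f
      = fun x => logChart E G (f (expChart E G x)) := by
    funext x
    simp only [writtenInExtChartAt, logChart, expChart, h1, Function.comp]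
  have h2 : Set.range (𝓘(ℝ, E) : E → E) = Set.univ := by simp only [mfld_simps]
  refine (congrArg (fun L => (L X : E)) hf.mfderiv).trans ?_
  rw [← fderivWithin_univ, ← e, ← h2]
  rfl

end ChartAtOne

end

section

/-! ### The derivative of the adjoint action in a chart -/

section AdjointDerivative

open Filter Topology VectorField

universe u v

variable (E : Type u) [NormedAddCommGroup E] [NormedSpace ℝ E] (G : Type v)
  [TopologicalSpace G] [ChartedSpace E G] [Group G]

/-- The multiplication in the preferred chart at `1`. -/
def chartMul (p : E × E) : E := logChart E G (expChart E G p.1 * expChart E G p.2)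

/-- The conjugation in the preferred chart at `1`. -/
def chartConj (p : E × E) : E :=
  logChart E G (expChart E G p.1 * expChart E G p.2 * (expChart E G p.1)⁻¹)

variable [LieGroup 𝓘(ℝ, E) ∞ G]

theorem contMDiffAt_expChart_fst :
    ContMDiffAt 𝓘(ℝ, E × E) 𝓘(ℝ, E) ∞ (fun p : E × E => expChart E G p.1)
      (chartOrigin E G, chartOrigin E G) :=
  (contMDiffAt_expChart_origin E G).comp (chartOrigin E G, chartOrigin E G)
    contDiff_fst.contMDiff.contMDiffAt

theorem contMDiffAt_expChart_snd :
    ContMDiffAt 𝓘(ℝ, E × E) 𝓘(ℝ, E) ∞ (fun p : E × E => expChart E G p.2)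
      (chartOrigin E G, chartOrigin E G) :=
  (contMDiffAt_expChart_origin E G).comp (chartOrigin E G, chartOrigin E G)
    contDiff_snd.contMDiff.contMDiffAt

theorem contMDiffAt_expChart_mul :
    ContMDiffAt 𝓘(ℝ, E × E) 𝓘(ℝ, E) ∞ (fun p : E × E => expChart E G p.1 * expChart E G p.2)
      (chartOrigin E G, chartOrigin E G) :=
  (contMDiffAt_expChart_fst E G).mul (contMDiffAt_expChart_snd E G)

theorem contMDiffAt_expChart_conj :
    ContMDiffAt 𝓘(ℝ, E × E) 𝓘(ℝ, E) ∞
      (fun p : E × E => expChart E G p.1 * expChart E G p.2 * (expChart E G p.1)⁻¹)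
      (chartOrigin E G, chartOrigin E G) :=
  (contMDiffAt_expChart_mul E G).mul (contMDiffAt_expChart_fst E G).inv

theorem contDiffAt_chartMul :
    ContDiffAt ℝ ∞ (chartMul E G) (chartOrigin E G, chartOrigin E G) :=
  contDiffAt_logChart_comp (contMDiffAt_expChart_mul E G) (by simp)

theorem contDiffAt_chartConj :
    ContDiffAt ℝ ∞ (chartConj E G) (chartOrigin E G, chartOrigin E G) :=
  contDiffAt_logChart_comp (contMDiffAt_expChart_conj E G) (by simp)

omit [LieGroup 𝓘(ℝ, E) ∞ G] in
theorem eventually_differentiableAt {F F' : Type*} [NormedAddCommGroup F] [NormedSpace ℝ F]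
    [NormedAddCommGroup F'] [NormedSpace ℝ F'] {f : F → F'} {x : F} (hf : ContDiffAt ℝ ∞ f x) :
    ∀ᶠ y in 𝓝 x, DifferentiableAt ℝ f y :=
  ((hf.of_le (m := 1) (by simp)).eventually (by simp)).mono fun _ h => h.differentiableAt (by simp)

omit [LieGroup 𝓘(ℝ, E) ∞ G] in
theorem eventually_fst {p : E × E → Prop} (h : ∀ᶠ q in 𝓝 (chartOrigin E G, chartOrigin E G), p q) :
    ∀ᶠ x in 𝓝 (chartOrigin E G), p (x, chartOrigin E G) :=
  (Continuous.tendsto (f := fun x : E => (x, chartOrigin E G)) (by fun_prop) _).eventually h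

omit [LieGroup 𝓘(ℝ, E) ∞ G] in
theorem eventually_snd {p : E × E → Prop} (h : ∀ᶠ q in 𝓝 (chartOrigin E G, chartOrigin E G), p q) :
    ∀ᶠ x in 𝓝 (chartOrigin E G), p (chartOrigin E G, x) :=
  (Continuous.tendsto (f := fun x : E => (chartOrigin E G, x)) (by fun_prop) _).eventually h

variable {E G}

omit [LieGroup 𝓘(ℝ, E) ∞ G] in
theorem fderiv_partial_right {F F' F'' : Type*} [NormedAddCommGroup F] [NormedSpace ℝ F]
    [NormedAddCommGroup F'] [NormedSpace ℝ F'] [NormedAddCommGroup F''] [NormedSpace ℝ F'']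
    {f : F × F' → F''} {x : F} {y : F'} (hf : DifferentiableAt ℝ f (x, y)) (w : F') :
    fderiv ℝ (fun y => f (x, y)) y w = fderiv ℝ f (x, y) (0, w) := by
  have h := hf.hasFDerivAt.comp y (hasFDerivAt_prodMk_right x y)
  have e : (f ∘ fun y => (x, y)) = fun y => f (x, y) := rfl
  rw [e] at h
  rw [h.fderiv]
  rfl

omit [LieGroup 𝓘(ℝ, E) ∞ G] in
theorem fderiv_partial_left {F F' F'' : Type*} [NormedAddCommGroup F] [NormedSpace ℝ F]
    [NormedAddCommGroup F'] [NormedSpace ℝ F'] [NormedAddCommGroup F''] [NormedSpace ℝ F'']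
    {f : F × F' → F''} {x : F} {y : F'} (hf : DifferentiableAt ℝ f (x, y)) (w : F) :
    fderiv ℝ (fun x => f (x, y)) x w = fderiv ℝ f (x, y) (w, 0) := by
  have h := HasFDerivAt.comp (f := fun x => (x, y)) x hf.hasFDerivAt
    (hasFDerivAt_prodMk_left (𝕜 := ℝ) x y)
  have e : (f ∘ fun x => (x, y)) = fun x => f (x, y) := rfl
  rw [e] at h
  rw [h.fderiv]
  rfl

theorem eventually_Ad_expChart (Y : LieAlg E G) : ∀ᶠ x in 𝓝 (chartOrigin E G),
    (Ad (expChart E G x) Y : E) = fderiv ℝ (chartConj E G) (x, chartOrigin E G) (0, (Y : E)) := by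
  filter_upwards [eventually_fst E G (eventually_differentiableAt (contDiffAt_chartConj E G))]
    with x hx
  refine (diffAtOne_eq (by simp) (mdifferentiableAt_conj _ _) Y).trans ?_
  exact fderiv_partial_right hx (Y : E)

omit [LieGroup 𝓘(ℝ, E) ∞ G] in
theorem chartConj_origin (x : E) : chartConj E G (x, chartOrigin E G) = chartOrigin E G := by
  simp [chartConj, logChart_one]

/-- The identity `(x y x⁻¹) x = x y` characterizes conjugation without an inverse on the outside, so
differentiating it involves only derivatives of the product and of the conjugation. -/
theorem eventually_chartMul_chartConj : ∀ᶠ p in 𝓝 (chartOrigin E G, chartOrigin E G),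
    chartMul E G (chartConj E G p, p.1) = chartMul E G p := by
  have h := (contMDiffAt_expChart_conj E G).continuousAt
  have h2 : ∀ᶠ g in 𝓝 (expChart E G (chartOrigin E G, chartOrigin E G).1 *
      expChart E G (chartOrigin E G, chartOrigin E G).2 *
      (expChart E G (chartOrigin E G, chartOrigin E G).1)⁻¹), expChart E G (logChart E G g) = g := by
    simpa using eventually_expChart_logChart E G
  filter_upwards [h.eventually h2] with p hp
  simp only [chartMul, chartConj, hp, inv_mul_cancel_right]

/-- This is the derivative of `(x y x⁻¹) x = x y` in `y` at `y = 1`; the inner derivative is `Ad x`.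
-/
theorem eventually_fderiv_chartMul (w : E) : ∀ᶠ x in 𝓝 (chartOrigin E G),
    fderiv ℝ (chartMul E G) (chartOrigin E G, x)
      (fderiv ℝ (chartConj E G) (x, chartOrigin E G) (0, w), 0) =
    fderiv ℝ (chartMul E G) (x, chartOrigin E G) (0, w) := by
  have hm := eventually_differentiableAt (contDiffAt_chartMul E G)
  filter_upwards [eventually_fst E G hm, eventually_snd E G hm,
    eventually_fst E G (eventually_differentiableAt (contDiffAt_chartConj E G)),
    eventually_fst E G (eventually_chartMul_chartConj (E := E) (G := G)).eventually_nhds]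
    with x h1 h2 h3 h4
  have h5 : (fun y => chartMul E G (chartConj E G (x, y), x)) =ᶠ[𝓝 (chartOrigin E G)]
      fun y => chartMul E G (x, y) :=
    (Continuous.tendsto (f := fun y : E => (x, y)) (by fun_prop) _).eventually h4
  have h6 := h5.fderiv_eq (𝕜 := ℝ)
  rw [← fderiv_partial_right h1, ← h6]
  have h7 : HasFDerivAt (fun y => chartConj E G (x, y)) _ (chartOrigin E G) :=
    h3.hasFDerivAt.comp _ (hasFDerivAt_prodMk_right x _)
  have h8 : DifferentiableAt ℝ (chartMul E G)
      (chartConj E G (x, chartOrigin E G), x) := by rwa [chartConj_origin]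
  have h9 := (h8.hasFDerivAt.comp (chartOrigin E G) (h7.prodMk (hasFDerivAt_const x _))).fderiv
  have e : (chartMul E G ∘ fun y => (chartConj E G (x, y), x)) =
    fun y => chartMul E G (chartConj E G (x, y), x) := rfl
  rw [e] at h9
  rw [h9, chartConj_origin]
  rfl

theorem fderiv_chartMul_origin (w : E) :
    fderiv ℝ (chartMul E G) (chartOrigin E G, chartOrigin E G) (w, 0) = w := by
  have h1 := (eventually_differentiableAt (contDiffAt_chartMul E G)).self_of_nhds
  rw [← fderiv_partial_left h1]
  have h2 : (fun x => chartMul E G (x, chartOrigin E G)) =ᶠ[𝓝 (chartOrigin E G)] id := by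
    filter_upwards [eventually_logChart_expChart E G] with x hx
    simp [chartMul, hx]
  rw [h2.fderiv_eq, fderiv_id]
  rfl

/-- The second derivative of the multiplication at the identity. -/
theorem differentiableAt_fderiv_chartMul :
    DifferentiableAt ℝ (fderiv ℝ (chartMul E G)) (chartOrigin E G, chartOrigin E G) :=
  ((contDiffAt_chartMul E G).fderiv_right (m := 1) (by norm_cast)).differentiableAt (by simp)

theorem differentiableAt_fderiv_chartConj :
    DifferentiableAt ℝ (fderiv ℝ (chartConj E G)) (chartOrigin E G, chartOrigin E G) :=
  ((contDiffAt_chartConj E G).fderiv_right (m := 1) (by norm_cast)).differentiableAt (by simp)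

omit [LieGroup 𝓘(ℝ, E) ∞ G] in
-- Here `m` is the product, `C` the conjugation, and `a` the curve `Ad(γ t) y`. Differentiating
-- `hev` at `0` gives `D²m((0,z),(y,0)) + a'(0) = D²m((z,0),(0,y))`, and symmetry of the second
-- derivative rewrites the first term. The conjugation serves only to know that `a` is
-- differentiable; its second derivative is never computed.
theorem hasDerivAt_of_fderiv_eq {F : Type*} [NormedAddCommGroup F] [NormedSpace ℝ F]
    {m C : F × F → F} {o z y : F} {γ a : ℝ → F}
    (dm : HasFDerivAt (fderiv ℝ m) (fderiv ℝ (fderiv ℝ m) (o, o)) (o, o)) (dC : HasFDerivAt (fderiv ℝ C) (fderiv ℝ (fderiv ℝ C) (o, o)) (o, o))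
    (hsymm : fderiv ℝ (fderiv ℝ m) (o, o) (0, z) (y, 0) =
      fderiv ℝ (fderiv ℝ m) (o, o) (y, 0) (0, z))
    (hm : ∀ w, fderiv ℝ m (o, o) (w, 0) = w) (hx0 : γ 0 = o) (hd : HasDerivAt γ z 0)
    (hY : a 0 = y) (hA : a =ᶠ[𝓝 0] fun t => fderiv ℝ C (γ t, o) (0, y))
    (hev : (fun t => fderiv ℝ m (o, γ t) (a t, 0)) =ᶠ[𝓝 0] fun t => fderiv ℝ m (γ t, o) (0, y)) :
    HasDerivAt a (fderiv ℝ (fderiv ℝ m) (o, o) (z, 0) (0, y) -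
        fderiv ℝ (fderiv ℝ m) (o, o) (y, 0) (0, z)) 0 := by
  subst hx0
  have hleft : HasDerivAt (fun t => (γ t, γ 0)) (z, (0 : F)) 0 := hd.prodMk (hasDerivAt_const _ _)
  have hright : HasDerivAt (fun t => (γ 0, γ t)) ((0 : F), z) 0 := (hasDerivAt_const _ _).prodMk hd
  have b1 := dC.comp_hasDerivAt_of_eq 0 hleft rfl
  have b2 := dm.comp_hasDerivAt_of_eq 0 hleft rfl
  have b3 := dm.comp_hasDerivAt_of_eq 0 hright rfl
  have a1 := b1.clm_apply (hasDerivAt_const (0 : ℝ) ((0 : F), y))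
  have a2 := b2.clm_apply (hasDerivAt_const (0 : ℝ) ((0 : F), y))
  obtain ⟨A', hA'⟩ : ∃ A' : F, HasDerivAt a A' 0 := ⟨_, a1.congr_of_eventuallyEq hA⟩
  have a3 := b3.clm_apply (hA'.prodMk (hasDerivAt_const (0 : ℝ) (0 : F)))
  have key := a3.unique (a2.congr_of_eventuallyEq hev)
  rw [hY] at key
  simp only [map_zero, add_zero, Function.comp] at key
  rw [hm, hsymm] at key
  rw [← key, add_sub_cancel_left]
  exact hA'

/-- The derivative at `0` of `t ↦ Ad (c t) Y`, in the preferred chart at `1`. -/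
theorem hasDerivAt_Ad_chart {c : ℝ → G} {Z : LieAlg E G} (hc : HasVelocityAtOne c Z)
    (Y : LieAlg E G) : HasDerivAt (fun t => (Ad (c t) Y : E))
      (fderiv ℝ (fderiv ℝ (chartMul E G)) (chartOrigin E G, chartOrigin E G) ((Z : E), 0)
          (0, (Y : E)) -
        fderiv ℝ (fderiv ℝ (chartMul E G)) (chartOrigin E G, chartOrigin E G) ((Y : E), 0)
          (0, (Z : E))) 0 := by
  obtain ⟨h0, hcont, hd⟩ := hasVelocityAtOne_iff.1 hc
  have hx0 : logChart E G (c 0) = chartOrigin E G := by rw [h0]; rfl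
  have hxc : Tendsto (fun t => logChart E G (c t)) (𝓝 0) (𝓝 (chartOrigin E G)) := by
    rw [← hx0]; exact hd.continuousAt
  have hct : Tendsto c (𝓝 0) (𝓝 1) := by rw [← h0]; exact hcont
  have hA : (fun t => (Ad (c t) Y : E)) =ᶠ[𝓝 0] fun t =>
      fderiv ℝ (chartConj E G) (logChart E G (c t), chartOrigin E G) (0, (Y : E)) := by
    filter_upwards [hxc.eventually (eventually_Ad_expChart Y),
      hct.eventually (eventually_expChart_logChart E G)] with t h1 h2
    rw [← h1, h2]
  refine hasDerivAt_of_fderiv_eq (F := E) (C := chartConj E G)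
    (differentiableAt_fderiv_chartMul (E := E) (G := G)).hasFDerivAt
    (differentiableAt_fderiv_chartConj (E := E) (G := G)).hasFDerivAt
    ((contDiffAt_chartMul E G).isSymmSndFDerivAt
      (by rw [minSmoothness_of_isRCLikeNormedField]; norm_cast) _ _)
    fderiv_chartMul_origin hx0 hd ?_ hA ?_
  · rw [h0]; exact Ad_one Y
  · filter_upwards [hA, hxc.eventually (eventually_fderiv_chartMul (E := E) (G := G) Y)]
      with t h1 h2
    exact (congrArg (fun w => fderiv ℝ (chartMul E G) (chartOrigin E G, logChart E G (c t))
      ((w : E), (0 : E))) h1).trans h2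

end AdjointDerivative

end

section

/-! ### The differential of `Ad` is the Lie bracket -/

section BracketFormula

open Filter Topology VectorField

universe u v

variable {E : Type u} [NormedAddCommGroup E] [NormedSpace ℝ E] {G : Type v}
  [TopologicalSpace G] [ChartedSpace E G] [Group G]

theorem mfderiv_eq_fderiv_expChart {f : G → E} (hf : MDifferentiableAt 𝓘(ℝ, E) 𝓘(ℝ, E) f 1)
    (Y : E) : (mfderiv 𝓘(ℝ, E) 𝓘(ℝ, E) f 1 Y : E) =
      fderiv ℝ (fun x => f (expChart E G x)) (chartOrigin E G) Y := by
  have e : writtenInExtChartAt 𝓘(ℝ, E) 𝓘(ℝ, E) 1 f = fun x => f (expChart E G x) := by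
    funext x
    simp only [writtenInExtChartAt, expChart, Function.comp, mfld_simps, chartAt_self_eq]
  have h2 : Set.range (𝓘(ℝ, E) : E → E) = Set.univ := by simp only [mfld_simps]
  refine (congrArg (fun L => (L Y : E)) hf.mfderiv).trans ?_
  rw [← fderivWithin_univ, ← e, ← h2]
  rfl

variable [LieGroup 𝓘(ℝ, E) ∞ G]

/-- A left invariant vector field in the preferred chart at `1`. -/
theorem eventually_mpullback_mulInvariantVectorField (Y : LieAlg E G) :
    ∀ᶠ x in 𝓝 (chartOrigin E G),
      (mpullbackWithin 𝓘(ℝ, E) 𝓘(ℝ, E) (extChartAt 𝓘(ℝ, E) (1 : G)).symm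
        (mulInvariantVectorField Y) (Set.range 𝓘(ℝ, E)) x : E) =
      fderiv ℝ (chartMul E G) (x, chartOrigin E G) (0, (Y : E)) := by
  have := LieGroup.toContMDiffMul (I := 𝓘(ℝ, E)) (n := ∞) (G := G)
  have : IsManifold 𝓘(ℝ, E) ∞ G := inferInstance
  have : IsManifold 𝓘(ℝ, E) 1 G := IsManifold.of_le (n := ∞) (by norm_cast)
  filter_upwards [target_mem_nhds E G,
    eventually_fst E G (eventually_differentiableAt (contDiffAt_chartMul E G))] with x hx hd
  have hsrc : (extChartAt 𝓘(ℝ, E) (1 : G)).symm x ∈ (extChartAt 𝓘(ℝ, E) (1 : G)).source :=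
    (extChartAt 𝓘(ℝ, E) (1 : G)).map_target hx
  have hinv := ContinuousLinearMap.inverse_eq
    (mfderivWithin_extChartAt_symm_comp_mfderiv_extChartAt (I := 𝓘(ℝ, E)) hx)
    (mfderiv_extChartAt_comp_mfderivWithin_extChartAt_symm (I := 𝓘(ℝ, E)) hx)
  have hl : MDifferentiableAt 𝓘(ℝ, E) 𝓘(ℝ, E) (logChart E G) (expChart E G x) :=
    mdifferentiableAt_extChartAt (by simpa [expChart] using hsrc)
  have hmul : MDifferentiableAt 𝓘(ℝ, E) 𝓘(ℝ, E) (fun g : G => expChart E G x * g) 1 :=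
    (contMDiff_mul_left (I := 𝓘(ℝ, E)) (n := ∞) (a := expChart E G x)).mdifferentiableAt (by simp)
  have hl' : MDifferentiableAt 𝓘(ℝ, E) 𝓘(ℝ, E) (logChart E G)
      ((fun g : G => expChart E G x * g) 1) := by simpa using hl
  have hcomp := mfderiv_comp (I := 𝓘(ℝ, E)) (I' := 𝓘(ℝ, E)) (I'' := 𝓘(ℝ, E)) (1 : G) hl' hmul
  have h3 := mfderiv_eq_fderiv_expChart (hl'.comp (1 : G) hmul) (Y : E)
  have aux : ∀ y : G, y = expChart E G x → ∀ v : E,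
      (mfderiv 𝓘(ℝ, E) 𝓘(ℝ, E) (logChart E G) y v : E)
      = (mfderiv 𝓘(ℝ, E) 𝓘(ℝ, E) (logChart E G) (expChart E G x) v : E) := by
    rintro _ rfl _; rfl
  -- The inverse of the derivative of the inverse chart is the derivative of the chart, so the
  -- pullback of the field is the derivative at `1` of the chart composed with left translation.
  refine (congrArg (fun L => (L (mulInvariantVectorField Y (expChart E G x)) : E)) hinv).trans ?_
  refine (aux ((fun g : G => expChart E G x * g) 1) (mul_one _) _).symm.trans ?_
  refine (congrArg (fun L => (L Y : E)) hcomp).symm.trans (h3.trans ?_)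
  exact fderiv_partial_right hd (Y : E)

omit [LieGroup 𝓘(ℝ, E) ∞ G] in
-- Fields of the form `x ↦ ∂₂m(x, o) v` take the value `v` at `o`, and their derivatives there are
-- mixed second derivatives of `m`. The bracket is therefore the same expression as the derivative
-- of `Ad` found above.
theorem lieBracketWithin_eq_of_eventually {F : Type*} [NormedAddCommGroup F] [NormedSpace ℝ F]
    {m : F × F → F} {o v w : F} {V W : F → F}
    (dm : HasFDerivAt (fderiv ℝ m) (fderiv ℝ (fderiv ℝ m) (o, o)) (o, o))
    (hm : ∀ w, fderiv ℝ m (o, o) (0, w) = w)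
    (hV : ∀ᶠ x in 𝓝 o, V x = fderiv ℝ m (x, o) (0, v))
    (hW : ∀ᶠ x in 𝓝 o, W x = fderiv ℝ m (x, o) (0, w)) :
    lieBracketWithin ℝ V W Set.univ o = fderiv ℝ (fderiv ℝ m) (o, o) (v, 0) (0, w) -
        fderiv ℝ (fderiv ℝ m) (o, o) (w, 0) (0, v) := by
  have key : ∀ (U : F → F) (u a : F), (∀ᶠ x in 𝓝 o, U x = fderiv ℝ m (x, o) (0, u)) →
      fderiv ℝ U o a = fderiv ℝ (fderiv ℝ m) (o, o) (a, 0) (0, u) := by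
    intro U u a hU
    have h1 : HasFDerivAt (fun x => fderiv ℝ m (x, o)) _ o :=
      HasFDerivAt.comp (f := fun x => (x, o)) o dm (hasFDerivAt_prodMk_left (𝕜 := ℝ) o o)
    have h2 := h1.clm_apply (hasFDerivAt_const ((0 : F), u) o)
    rw [Filter.EventuallyEq.fderiv_eq hU, h2.fderiv]
    simp
  rw [lieBracketWithin_eq]
  simp only [fderivWithin_univ]
  rw [key V v _ hV, key W w _ hW, hV.self_of_nhds, hW.self_of_nhds, hm, hm]

theorem fderiv_chartMul_origin_right (w : E) :
    fderiv ℝ (chartMul E G) (chartOrigin E G, chartOrigin E G) (0, w) = w := by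
  have h1 := (eventually_differentiableAt (contDiffAt_chartMul E G)).self_of_nhds
  rw [← fderiv_partial_right h1]
  have h2 : (fun x => chartMul E G (chartOrigin E G, x)) =ᶠ[𝓝 (chartOrigin E G)] id := by
    filter_upwards [eventually_logChart_expChart E G] with x hx
    simp [chartMul, hx]
  rw [h2.fderiv_eq, fderiv_id]
  rfl

theorem bracket_eq_fderiv_chartMul (Z Y : LieAlg E G) : ((⁅Z, Y⁆ : LieAlg E G) : E) =
    fderiv ℝ (fderiv ℝ (chartMul E G)) (chartOrigin E G, chartOrigin E G) ((Z : E), 0)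
          (0, (Y : E)) -
        fderiv ℝ (fderiv ℝ (chartMul E G)) (chartOrigin E G, chartOrigin E G) ((Y : E), 0)
          (0, (Z : E)) := by
  refine Eq.trans ?_ (lieBracketWithin_eq_of_eventually (F := E)
    (differentiableAt_fderiv_chartMul (E := E) (G := G)).hasFDerivAt
    fderiv_chartMul_origin_right
    (eventually_mpullback_mulInvariantVectorField Z)
    (eventually_mpullback_mulInvariantVectorField Y))
  have hs : (extChartAt 𝓘(ℝ, E) (1 : G)).symm ⁻¹' Set.univ ∩ Set.range 𝓘(ℝ, E) =
      (Set.univ : Set E) := by simp only [mfld_simps]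
  -- The bracket in the chart is transported back to the tangent space at `1`, where the derivative
  -- of the chart is the identity.
  have hid : (mfderiv 𝓘(ℝ, E) 𝓘(ℝ, E) (extChartAt 𝓘(ℝ, E) (1 : G)) 1 : E →L[ℝ] E) =
      ContinuousLinearMap.id ℝ E := mfderiv_extChartAt_self (I := 𝓘(ℝ, E)) (x := (1 : G))
  have hinv : ∀ v : E, ((mfderiv 𝓘(ℝ, E) 𝓘(ℝ, E) (extChartAt 𝓘(ℝ, E) (1 : G)) 1 :
      E →L[ℝ] E).inverse v : E) = v := by
    intro v; rw [hid]; exact congrArg (fun L : E →L[ℝ] E => L v) ContinuousLinearMap.inverse_id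
  refine (hinv _).trans ?_
  rw [hs]
  rfl

/-- The differential of `Ad` at `1` is `ad`. -/
theorem hasDerivAt_Ad {c : ℝ → G} {Z : LieAlg E G} (hc : HasVelocityAtOne c Z)
    (Y : LieAlg E G) :
    HasDerivAt (fun t => (Ad (c t) Y : E)) ((⁅Z, Y⁆ : LieAlg E G) : E) 0 := by
  have h := hasDerivAt_Ad_chart hc Y
  rwa [← bracket_eq_fderiv_chartMul] at h

theorem continuousAt_Ad_one (Y : LieAlg E G) : ContinuousAt (fun g : G => (Ad g Y : E)) 1 := by
  have h1 : ContinuousAt (fun x => fderiv ℝ (chartConj E G) (x, chartOrigin E G) (0, (Y : E)))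
      (logChart E G 1) := by
    have h2 : ContinuousAt (fun x : E => (x, chartOrigin E G)) (chartOrigin E G) := by fun_prop
    have h3 : ContinuousAt (fderiv ℝ (chartConj E G)) (chartOrigin E G, chartOrigin E G) :=
      (differentiableAt_fderiv_chartConj (E := E) (G := G)).continuousAt
    exact (ContinuousAt.comp (f := fun x : E => (x, chartOrigin E G)) h3 h2).clm_apply
      continuousAt_const
  refine (h1.comp (continuousAt_logChart_one E G)).congr ?_
  filter_upwards [(continuousAt_logChart_one E G).eventually (eventually_Ad_expChart Y),
    eventually_expChart_logChart E G] with g h2 h3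
  rw [h3] at h2
  exact h2.symm

/-- Continuity at `1` propagates through `Ad g = Ad g₀ ∘ Ad (g₀⁻¹ g)`. -/
theorem continuous_Ad [FiniteDimensional ℝ E] (Y : LieAlg E G) :
    Continuous (fun g : G => (Ad g Y : E)) := by
  have : IsTopologicalGroup G := topologicalGroup_of_lieGroup 𝓘(ℝ, E) ∞
  refine continuous_iff_continuousAt.2 fun g₀ => ?_
  let L : E →ₗ[ℝ] E := Ad (E := E) g₀
  have hL : Continuous L := L.continuous_of_finiteDimensional
  have h1 : ContinuousAt (fun g : G => (Ad g Y : E)) (g₀⁻¹ * g₀) := by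
    rw [inv_mul_cancel]; exact continuousAt_Ad_one Y
  have h2 : ContinuousAt (fun g : G => (Ad (g₀⁻¹ * g) Y : E)) g₀ :=
    ContinuousAt.comp (f := fun g : G => g₀⁻¹ * g) h1 (by fun_prop)
  refine (hL.continuousAt.comp h2).congr (Eventually.of_forall fun g => ?_)
  have h3 := Ad_mul g₀ (g₀⁻¹ * g) Y
  rw [mul_inv_cancel_left] at h3
  exact h3.symm

end BracketFormula

end

section

/-! ### Curves in the fixed-point group `K` -/

section FixedPointCurves

open Filter Topology

universe u v

/-- A smooth involution is linear near a fixed point, in suitable coordinates. -/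
theorem exists_linearization {F : Type*} [NormedAddCommGroup F] [NormedSpace ℝ F]
    [CompleteSpace F] {τ : F → F} {o : F} (hτ : ContDiffAt ℝ ∞ τ o) (ho : τ o = o)
    (hinv : ∀ᶠ x in 𝓝 o, τ (τ x) = x) : ∃ ψ η : F → F, ContDiffAt ℝ ∞ η 0 ∧ η 0 = o ∧
      HasFDerivAt η (ContinuousLinearMap.id ℝ F) 0 ∧ Tendsto ψ (𝓝 o) (𝓝 0) ∧
      (∀ᶠ u in 𝓝 0, fderiv ℝ τ o u = u → τ (η u) = η u) ∧
      (∀ᶠ x in 𝓝 o, τ x = x → fderiv ℝ τ o (ψ x) = ψ x ∧ η (ψ x) = x) := by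
  set A := fderiv ℝ τ o with hA
  have hd : HasFDerivAt τ A o := (hτ.differentiableAt (by simp)).hasFDerivAt
  have hd' : HasFDerivAt τ A (τ o) := by rwa [ho]
  have hAA : ∀ u, A (A u) = u := fun u => by
    have h1 : HasFDerivAt (fun x => τ (τ x)) (A.comp A) o := hd'.comp o hd
    have h2 := h1.unique ((hasFDerivAt_id o).congr_of_eventuallyEq hinv)
    exact congrArg (fun L => L u) h2
  -- Bochner's averaging over the group generated by the involution: since `A² = 1`, one has `ψ ∘ τ
  -- = A ∘ ψ`, and the derivative of `ψ` at `o` is the identity. The inverse function theorem then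
  -- makes `ψ` a chart in which `τ` is `A`.
  let ψ : F → F := fun x => (2⁻¹ : ℝ) • ((x - o) + A (τ x - o))
  have hψ : ContDiffAt ℝ ∞ ψ o :=
    ((contDiffAt_id.sub contDiffAt_const).add
      (A.contDiff.contDiffAt.comp o (hτ.sub contDiffAt_const))).const_smul _
  have hψ0 : ψ o = 0 := by simp [ψ, ho]
  have hdψ : HasFDerivAt ψ ((ContinuousLinearEquiv.refl ℝ F : F ≃L[ℝ] F) : F →L[ℝ] F) o := by
    have h1 : HasFDerivAt ψ ((2⁻¹ : ℝ) • (ContinuousLinearMap.id ℝ F + A.comp A)) o :=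
      (((hasFDerivAt_id o).sub_const o).add
        (A.hasFDerivAt.comp o (hd.sub_const o))).const_smul _
    refine h1.congr_fderiv ?_
    ext u
    have h2 : (2⁻¹ : ℝ) • u + (2⁻¹ : ℝ) • u = u := by
      rw [← add_smul]; norm_num
    simpa [hAA] using h2
  have hstrict : HasStrictFDerivAt ψ
      ((ContinuousLinearEquiv.refl ℝ F : F ≃L[ℝ] F) : F →L[ℝ] F) o :=
    hψ.hasStrictFDerivAt' hdψ (by simp)
  have hψτ : ∀ᶠ x in 𝓝 o, ψ (τ x) = A (ψ x) := by
    filter_upwards [hinv] with x hx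
    simp only [ψ, hx, map_smul, map_add, hAA, add_comm]
  have hη0 : hstrict.localInverse ψ _ o 0 = o := by
    have := hstrict.localInverse_apply_image
    rwa [hψ0] at this
  have hηt : Tendsto (hstrict.localInverse ψ _ o) (𝓝 0) (𝓝 o) := by
    have := hstrict.localInverse_tendsto
    rwa [hψ0] at this
  refine ⟨ψ, hstrict.localInverse ψ _ o, ?_, hη0, ?_, ?_, ?_, ?_⟩
  · have := hψ.to_localInverse hdψ (by simp)
    rw [hψ0] at this
    exact this
  · have := hstrict.to_localInverse.hasFDerivAt
    rw [hψ0] at this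
    exact this
  · rw [← hψ0]; exact hψ.continuousAt
  -- If `A u = u` then `ψ (τ (η u)) = A u = u`; applying the local inverse `η` gives `τ (η u) = η
  -- u`.
  · have h1 := hstrict.eventually_right_inverse
    rw [hψ0] at h1
    have h2 := hηt.eventually hψτ
    have h3 : ∀ᶠ x in 𝓝 o, hstrict.localInverse ψ _ o (ψ (τ x)) = τ x := by
      have h4 : Tendsto τ (𝓝 o) (𝓝 o) := by
        have := hτ.continuousAt.tendsto; rwa [ho] at this
      exact h4.eventually hstrict.eventually_left_inverse
    filter_upwards [h1, h2, hηt.eventually h3] with u hu1 hu2 hu3 hu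
    rw [← hu3, hu2, hu1, hu]
  · filter_upwards [hstrict.eventually_left_inverse] with x hx hfix
    refine ⟨?_, hx⟩
    simp only [ψ, hfix, map_smul, map_add, hAA, add_comm]

namespace ReductiveStructure

variable {E : Type u} [NormedAddCommGroup E] [NormedSpace ℝ E] {G : Type v}
  [TopologicalSpace G] [ChartedSpace E G] [Group G] [LieGroup 𝓘(ℝ, E) ∞ G]
  (R : ReductiveStructure E G)

/-- The involution `θ` in the preferred chart at `1`. -/
def chartθ (x : E) : E := logChart E G (R.θ (expChart E G x))

theorem contDiffAt_chartθ : ContDiffAt ℝ ∞ R.chartθ (chartOrigin E G) := by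
  refine contDiffAt_logChart_comp (f := fun x => R.θ (expChart E G x)) ?_ (by simp)
  exact ContMDiffAt.comp (chartOrigin E G) (R.contMDiff_θ.contMDiffAt)
    (contMDiffAt_expChart_origin E G)

theorem chartθ_origin : R.chartθ (chartOrigin E G) = chartOrigin E G := by
  simp [chartθ, logChart_one]

theorem eventually_chartθ_chartθ :
    ∀ᶠ x in 𝓝 (chartOrigin E G), R.chartθ (R.chartθ x) = x := by
  have h1 : ContinuousAt (fun x => R.θ (expChart E G x)) (chartOrigin E G) :=
    R.contMDiff_θ.continuous.continuousAt.comp (contMDiffAt_expChart_origin E G).continuousAt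
  have h2 : ∀ᶠ g in 𝓝 (R.θ (expChart E G (chartOrigin E G))),
      expChart E G (logChart E G g) = g := by
    simpa using eventually_expChart_logChart E G
  filter_upwards [h1.eventually h2, eventually_logChart_expChart E G] with x hx hx'
  simp only [chartθ, hx, R.θ_θ, hx']

theorem diffAtOne_θ_eq (Z : LieAlg E G) :
    (diffAtOne R.θ Z : E) = fderiv ℝ R.chartθ (chartOrigin E G) (Z : E) :=
  diffAtOne_eq (map_one _) (R.contMDiff_θ.mdifferentiableAt (by simp)) Z

/-- The velocity of a curve in `K` lies in `𝔨₀`. -/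
theorem diffAtOne_θ_of_hasVelocityAtOne {c : ℝ → G} {Z : LieAlg E G} (hc : HasVelocityAtOne c Z)
    (hK : ∀ t, R.θ (c t) = c t) : diffAtOne R.θ Z = Z := by
  obtain ⟨h0, hcont, hd⟩ := hasVelocityAtOne_iff.1 hc
  have hx0 : logChart E G (c 0) = chartOrigin E G := by rw [h0]; rfl
  have h1 : HasFDerivAt R.chartθ (fderiv ℝ R.chartθ (chartOrigin E G)) (logChart E G (c 0)) := by
    rw [hx0]; exact (R.contDiffAt_chartθ.differentiableAt (by simp)).hasFDerivAt
  have h2 := HasFDerivAt.comp_hasDerivAt (E := E) (F := E) (0 : ℝ) h1 hd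
  have h3 : (R.chartθ ∘ fun t => logChart E G (c t)) =ᶠ[𝓝 0] fun t => logChart E G (c t) := by
    have hct : Tendsto c (𝓝 0) (𝓝 1) := by rw [← h0]; exact hcont
    filter_upwards [hct.eventually (eventually_expChart_logChart E G)] with t ht
    simp only [Function.comp, chartθ, ht, hK]
  exact (R.diffAtOne_θ_eq Z).trans
    (HasDerivAt.unique (F := E) (h2.congr_of_eventuallyEq h3.symm) hd)

variable [CompleteSpace E]

/-- Smooth coordinates near `1` in which `K` is the vector space `𝔨₀`. -/
theorem exists_chart_fixed : ∃ (χ : E → G) (ψ : G → E), χ 0 = 1 ∧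
    ContMDiffAt 𝓘(ℝ, E) 𝓘(ℝ, E) ∞ χ 0 ∧
    HasFDerivAt (fun u => logChart E G (χ u)) (ContinuousLinearMap.id ℝ E) 0 ∧
    (∀ᶠ u : E in 𝓝 0, (diffAtOne R.θ (u : LieAlg E G) : E) = u → R.θ (χ u) = χ u) ∧
    Tendsto ψ (𝓝 1) (𝓝 0) ∧
    (∀ᶠ g in 𝓝 (1 : G), R.θ g = g →
      (diffAtOne R.θ (ψ g : LieAlg E G) : E) = ψ g ∧ χ (ψ g) = g) := by
  obtain ⟨ψ, η, hη, hη0, hdη, hψ, h1, h2⟩ := exists_linearization R.contDiffAt_chartθ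
    R.chartθ_origin R.eventually_chartθ_chartθ
  have hηt : Tendsto η (𝓝 0) (𝓝 (chartOrigin E G)) := by
    rw [← hη0]; exact hη.continuousAt
  have hl := (continuousAt_logChart_one E G).tendsto
  refine ⟨fun u => expChart E G (η u), fun g => ψ (logChart E G g), by simp [hη0], ?_, ?_, ?_,
    hψ.comp hl, ?_⟩
  · have h3 := contMDiffAt_expChart_origin E G
    rw [← hη0] at h3
    exact h3.comp 0 hη.contMDiffAt
  · refine hdη.congr_of_eventuallyEq ?_
    filter_upwards [hηt.eventually (eventually_logChart_expChart E G)] with u hu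
    exact hu
  · have h3 : ContinuousAt (fun x => R.θ (expChart E G x)) (chartOrigin E G) :=
      R.contMDiff_θ.continuous.continuousAt.comp (contMDiffAt_expChart_origin E G).continuousAt
    have h4 : ∀ᶠ g in 𝓝 (R.θ (expChart E G (chartOrigin E G))),
      expChart E G (logChart E G g) = g := by
      simpa using eventually_expChart_logChart E G
    filter_upwards [h1, hηt.eventually (h3.eventually h4)] with u hu hu' hfix
    have h5 := hu ((R.diffAtOne_θ_eq _).symm.trans hfix)
    exact hu'.symm.trans (congrArg (expChart E G) h5)
  · filter_upwards [hl.eventually h2, eventually_expChart_logChart E G] with g hg hg' hfix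
    obtain ⟨h3, h4⟩ := hg (by simp only [chartθ, hg', hfix])
    exact ⟨(R.diffAtOne_θ_eq _).trans h3, by rw [h4, hg']⟩

omit [CompleteSpace E] in
-- The left logarithmic derivative of `t ↦ χ (t u)` is a partial derivative of `(p, q) ↦ log (χ p⁻¹
-- χ q)` on the diagonal. In this form it can be bounded uniformly near `0`.
theorem hasVelocityAtOne_inv_mul {χ : E → G} {u : E} {t : ℝ} (hχ : ContinuousAt χ (t • u))
    (hd : DifferentiableAt ℝ (fun p : E × E => logChart E G ((χ p.1)⁻¹ * χ p.2)) (t • u, t • u)) :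
    HasVelocityAtOne (fun h : ℝ => (χ (t • u))⁻¹ * χ ((t + h) • u))
      (fderiv ℝ (fun p : E × E => logChart E G ((χ p.1)⁻¹ * χ p.2)) (t • u, t • u) (0, u) :
        E) := by
  have : IsTopologicalGroup G := topologicalGroup_of_lieGroup 𝓘(ℝ, E) ∞
  refine hasVelocityAtOne_iff.2 ⟨by simp, ?_, ?_⟩
  · have h1 : ContinuousAt (fun h : ℝ => (t + h) • u) 0 := by fun_prop
    have h2 : ContinuousAt χ ((fun h : ℝ => (t + h) • u) 0) := by simpa using hχ
    exact continuousAt_const.mul (ContinuousAt.comp (f := fun h : ℝ => (t + h) • u) h2 h1)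
  · have h1 : HasDerivAt (fun h : ℝ => (t • u, (t + h) • u)) ((0 : E), u) 0 := by
      refine (hasDerivAt_const _ _).prodMk ?_
      simpa using ((hasDerivAt_id (0 : ℝ)).const_add t).smul_const u
    have h2 := hd.hasFDerivAt
    have h3 : (t • u, t • u) = (fun h : ℝ => (t • u, (t + h) • u)) 0 := by simp
    rw [h3] at h2
    have h4 := h2.comp_hasDerivAt (0 : ℝ) h1
    rw [← h3] at h4
    exact h4

/-- Every element of `𝔨₀` is the velocity of a curve in `K`. -/
theorem exists_curve_hasVelocityAtOne (Z : E) (hZ : diffAtOne R.θ (Z : LieAlg E G) = Z) :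
    ∃ c : ℝ → R.K, HasVelocityAtOne (fun t => (c t : G)) Z := by
  classical
  obtain ⟨χ, ψ, h0, hsm, hd, hfix, -, -⟩ := R.exists_chart_fixed
  have h1 : HasDerivAt (fun t : ℝ => t • Z) (Z : E) 0 := by
    simpa using (hasDerivAt_id (0 : ℝ)).smul_const (Z : E)
  have h2 : Tendsto (fun t : ℝ => t • Z) (𝓝 0) (𝓝 0) := by
    have := h1.continuousAt.tendsto
    simpa using this
  let c : ℝ → R.K := fun t =>
    if h : R.θ (χ (t • Z)) = χ (t • Z) then ⟨χ (t • Z), h⟩ else 1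
  have hc : ∀ᶠ t in 𝓝 (0 : ℝ), (c t : G) = χ (t • Z) := by
    filter_upwards [h2.eventually hfix] with t ht
    have h3 := ht (by
      refine (map_smul (diffAtOne R.θ) t (Z : LieAlg E G)).trans ?_
      exact congrArg (fun w : E => t • w) hZ)
    simp only [c, dif_pos h3]
  have hc0 : (c 0 : G) = 1 := by rw [hc.self_of_nhds]; simpa using h0
  refine ⟨c, hasVelocityAtOne_iff.2 ⟨hc0, ?_, ?_⟩⟩
  · have h4 : ContinuousAt (fun t : ℝ => χ (t • Z)) 0 := by
      refine ContinuousAt.comp (f := fun t : ℝ => t • Z) ?_ h1.continuousAt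
      simpa using hsm.continuousAt
    exact h4.congr (hc.mono fun t ht => ht.symm)
  · have h4 : HasFDerivAt (fun u => logChart E G (χ u)) (ContinuousLinearMap.id ℝ E)
      ((0 : ℝ) • Z) := by simpa using hd
    have h5 : HasDerivAt (fun t : ℝ => logChart E G (χ (t • Z))) Z 0 := by
      have h6 := h4.comp_hasDerivAt (0 : ℝ) h1
      exact h6
    exact h5.congr_of_eventuallyEq (hc.mono fun t ht => congrArg (logChart E G) ht)

/-- Elements of `K` close to `1` are the endpoints of short curves in `K`. -/
theorem exists_short_curve {O : Set G} (hO : O ∈ 𝓝 (1 : G)) {δ : ℝ} (hδ : 0 < δ) :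
    ∃ N ∈ 𝓝 (1 : G), ∀ k : R.K, (k : G) ∈ N → ∃ c : ℝ → R.K, c 0 = 1 ∧ c 1 = k ∧
      (∀ t ∈ Set.Icc (0 : ℝ) 1, (c t : G) ∈ O) ∧ ∀ t ∈ Set.Icc (0 : ℝ) 1, ∃ Z : E,
        ‖Z‖ ≤ δ ∧ diffAtOne R.θ Z = Z ∧
        HasVelocityAtOne (fun h => (((c t)⁻¹ * c (t + h) : R.K) : G)) Z := by
  classical
  have := LieGroup.toContMDiffMul (I := 𝓘(ℝ, E)) (n := ∞) (G := G)
  have : IsManifold 𝓘(ℝ, E) ∞ G := inferInstance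
  have : IsManifold 𝓘(ℝ, E) 1 G := IsManifold.of_le (n := ∞) (by norm_cast)
  obtain ⟨χ, ψ, h0, hsm, -, hfix, hψ, hψχ⟩ := R.exists_chart_fixed
  set F : E × E → E := fun p => logChart E G ((χ p.1)⁻¹ * χ p.2) with hF
  have hsm1 : ContMDiffAt 𝓘(ℝ, E × E) 𝓘(ℝ, E) ∞ (fun p : E × E => χ p.1) (0, 0) :=
    ContMDiffAt.comp (f := Prod.fst) ((0, 0) : E × E) hsm contDiff_fst.contMDiff.contMDiffAt
  have hsm2 : ContMDiffAt 𝓘(ℝ, E × E) 𝓘(ℝ, E) ∞ (fun p : E × E => χ p.2) (0, 0) :=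
    ContMDiffAt.comp (f := Prod.snd) ((0, 0) : E × E) hsm contDiff_snd.contMDiff.contMDiffAt
  have hFsm : ContDiffAt ℝ ∞ F (0, 0) :=
    contDiffAt_logChart_comp (hsm1.inv.mul hsm2) (by simp [h0])
  have hFd := eventually_differentiableAt hFsm
  have hFb : ∀ᶠ p in 𝓝 ((0, 0) : E × E), ‖fderiv ℝ F p‖ < ‖fderiv ℝ F (0, 0)‖ + 1 :=
    ((hFsm.fderiv_right (m := 1) (by norm_cast)).continuousAt.norm).eventually_lt_const
      (by linarith)
  have hχc : ∀ᶠ u in 𝓝 (0 : E), ContinuousAt χ u := by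
    exact ((contMDiffAt_iff_contMDiffAt_nhds (n := 1) (by simp)).1
      (hsm.of_le (m := 1) (by norm_cast))).mono fun u hu => hu.continuousAt
  have hχO : ∀ᶠ u in 𝓝 (0 : E), χ u ∈ O := by
    have := hsm.continuousAt.tendsto
    rw [h0] at this
    exact this hO
  set C := ‖fderiv ℝ F (0, 0)‖ + 1 with hC
  have hCpos : 0 < C := by positivity
  have hev := (hFd.and hFb)
  obtain ⟨ε₁, hε₁, hB₁⟩ := Metric.eventually_nhds_iff_ball.1 hev
  obtain ⟨ε₂, hε₂, hB₂⟩ := Metric.eventually_nhds_iff_ball.1 (hfix.and (hχc.and hχO))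
  -- The halves keep `t u` in the two good balls for all `|t| < 2`, and `δ / C` bounds the velocity,
  -- as `C` bounds the derivative of `F`.
  set r := min (min (ε₁ / 2) (ε₂ / 2)) (δ / C) with hr
  have hrpos : 0 < r := by positivity
  have hr1 : r ≤ ε₁ / 2 := (min_le_left _ _).trans (min_le_left _ _)
  have hr2 : r ≤ ε₂ / 2 := (min_le_left _ _).trans (min_le_right _ _)
  have hr3 : r ≤ δ / C := min_le_right _ _
  have hN := (hψ.eventually (Metric.ball_mem_nhds (0 : E) hrpos)).and hψχ
  refine ⟨_, hN, fun k hk => ?_⟩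
  obtain ⟨hu, hk'⟩ := hk
  obtain ⟨hAu, hχk⟩ := hk' k.2
  set u := ψ (k : G) with hudef
  have hur : ‖u‖ < r := by simpa using hu
  let c : ℝ → R.K := fun t => if h : R.θ (χ (t • u)) = χ (t • u) then ⟨χ (t • u), h⟩ else 1
  -- The margin beyond `[0, 1]` leaves room for two-sided derivatives at the endpoints.
  have hball : ∀ t : ℝ, |t| < 2 → t • u ∈ Metric.ball (0 : E) (2 * r) := fun t ht => by
    rw [mem_ball_zero_iff, norm_smul, Real.norm_eq_abs]
    nlinarith [abs_nonneg t, norm_nonneg u]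
  have hc : ∀ t : ℝ, |t| < 2 → (c t : G) = χ (t • u) := fun t ht => by
    have h3 := (hB₂ (t • u) (Metric.ball_subset_ball (by linarith) (hball t ht))).1 (by
      refine (map_smul (diffAtOne R.θ) t (u : LieAlg E G)).trans ?_
      exact congrArg (fun w : E => t • w) hAu)
    simp only [c, dif_pos h3]
  have habs : ∀ t ∈ Set.Icc (0 : ℝ) 1, |t| < 2 := fun t ht => by
    rw [abs_of_nonneg ht.1]; linarith [ht.2]
  refine ⟨c, Subtype.ext ?_, Subtype.ext ?_, fun t ht => ?_, fun t ht => ?_⟩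
  · rw [hc 0 (by simp)]; simpa using h0
  · rw [hc 1 (by simp)]; simpa using hχk
  · rw [hc t (habs t ht)]
    exact (hB₂ _ (Metric.ball_subset_ball (by linarith) (hball t (habs t ht)))).2.2
  · have htu := hball t (habs t ht)
    have h5 := (hB₂ _ (Metric.ball_subset_ball (by linarith) htu)).2.1
    have h6 := hB₁ (t • u, t • u) (by
      rw [mem_ball_zero_iff] at htu
      have h7 : ((0 : E), (0 : E)) = 0 := rfl
      rw [h7, mem_ball_zero_iff, Prod.norm_def]
      simp only [max_self]
      linarith)
    have hvel := hasVelocityAtOne_inv_mul (χ := χ) (u := u) (t := t) h5 h6.1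
    have hvel' : HasVelocityAtOne (fun h => (((c t)⁻¹ * c (t + h) : R.K) : G))
        (fderiv ℝ F (t • u, t • u) (0, u) : E) := by
      obtain ⟨a1, a2, a3⟩ := hasVelocityAtOne_iff.1 hvel
      have hev2 : (fun h => (((c t)⁻¹ * c (t + h) : R.K) : G)) =ᶠ[𝓝 0]
          fun h : ℝ => (χ (t • u))⁻¹ * χ ((t + h) • u) := by
        have h8 : ∀ᶠ h in 𝓝 (0 : ℝ), |t + h| < 2 := by
          have : ContinuousAt (fun h : ℝ => |t + h|) 0 := by fun_prop
          exact this.eventually_lt_const (by simpa using habs t ht)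
        filter_upwards [h8] with h hh
        rw [Subgroup.coe_mul, Subgroup.coe_inv, hc t (habs t ht), hc (t + h) hh]
      refine hasVelocityAtOne_iff.2 ⟨by simp, a2.congr hev2.symm, ?_⟩
      exact a3.congr_of_eventuallyEq (hev2.fun_comp (logChart E G))
    refine ⟨_, ?_, R.diffAtOne_θ_of_hasVelocityAtOne hvel' fun h => ((c t)⁻¹ * c (t + h)).2, hvel'⟩
    calc ‖fderiv ℝ F (t • u, t • u) (0, u)‖ ≤ ‖fderiv ℝ F (t • u, t • u)‖ * ‖((0 : E), u)‖ :=
          ContinuousLinearMap.le_opNorm _ _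
      _ ≤ C * (δ / C) := by
          refine mul_le_mul h6.2.le ?_ (norm_nonneg _) hCpos.le
          rw [Prod.norm_def]
          simp only [norm_zero]
          exact max_le (by positivity) (hur.le.trans hr3)
      _ = δ := by field_simp

end ReductiveStructure

end FixedPointCurves

end

/-! ### The local section of `K̃ → K` -/

section

theorem exists_dual_one (𝕜 : Type*) {V : Type*} [Field 𝕜] [Ring V] [Nontrivial V] [Algebra 𝕜 V] :
    ∃ l : Module.Dual 𝕜 V, l 1 = 1 := by
  obtain ⟨f, hf⟩ : ∃ f : Module.Dual 𝕜 V, f 1 ≠ 0 := by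
    by_contra! h
    exact one_ne_zero ((Module.forall_dual_apply_eq_zero_iff 𝕜 (1 : V)).1 h)
  exact ⟨(f 1)⁻¹ • f, by simp [hf]⟩

namespace ReductiveStructure

open Filter Topology

universe u v

variable {E : Type u} [NormedAddCommGroup E] [NormedSpace ℝ E] {G : Type v}
  [TopologicalSpace G] [ChartedSpace E G] [Group G] [LieGroup 𝓘(ℝ, E) ∞ G]
  (R : ReductiveStructure E G)

theorem Q₀_apply (v : R.p₀) : R.Q₀ v = -R.Bp₀ v v := rfl

theorem Bp₀_comm (v w : R.p₀) : R.Bp₀ v w = R.Bp₀ w v := R.B_symm _ _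

theorem Bp₀_pos (v : R.p₀) (hv : v ≠ 0) : 0 < R.Bp₀ v v :=
  R.B_pos v v.2 fun h => hv (Subtype.ext h)

theorem AdP_one_eq : R.AdP 1 = LinearMap.id := LinearMap.ext R.AdP_one

instance : CompactSpace R.K := isCompact_iff_compactSpace.1 R.isCompact_fixed

variable [FiniteDimensional ℝ E]

theorem finite_Cl₀ : Module.Finite ℝ R.Cl₀ :=
  have : Invertible (2 : ℝ) := invertibleOfNonzero two_ne_zero
  finite_cliffordAlgebra R.Q₀

instance : IsModuleTopology ℝ R.Cl₀ := ⟨rfl⟩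

instance : IsTopologicalRing R.Cl₀ :=
  have := R.finite_Cl₀
  IsModuleTopology.isTopologicalRing (R := ℝ) (D := R.Cl₀)

theorem continuous_star_Cl₀ : Continuous (star : R.Cl₀ → R.Cl₀) := by
  have := R.finite_Cl₀
  have : ContinuousAdd R.Cl₀ := inferInstance
  let L : R.Cl₀ →ₗ[ℝ] R.Cl₀ :=
    CliffordAlgebra.reverse.comp (CliffordAlgebra.involute (Q := R.Q₀)).toLinearMap
  exact (IsModuleTopology.continuous_of_linearMap L :)

instance : IsTopologicalGroup (spinGroup R.Q₀) where
  continuous_inv := (R.continuous_star_Cl₀.comp continuous_subtype_val).subtype_mk _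

instance : IsTopologicalGroup R.K :=
  have : IsTopologicalGroup G := topologicalGroup_of_lieGroup 𝓘(ℝ, E) ∞
  inferInstance

instance : IsTopologicalGroup R.Ktilde := inferInstance

theorem continuous_KtildeToK : Continuous R.KtildeToK :=
  continuous_fst.comp continuous_subtype_val

/-- The component in `Cl(𝔭₀)` of an element of `K̃`. -/
def spinPart (a : R.Ktilde) : R.Cl₀ := (a.1.2 : R.Cl₀)

theorem continuous_spinPart : Continuous R.spinPart :=
  continuous_subtype_val.comp (continuous_snd.comp continuous_subtype_val)

theorem spinPart_one : R.spinPart 1 = 1 := rfl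

theorem spinPart_comm (a : R.Ktilde) (v : R.p₀) : R.spinPart a * CliffordAlgebra.ι R.Q₀ v =
    CliffordAlgebra.ι R.Q₀ (R.AdP (R.KtildeToK a) v) * R.spinPart a := a.2 v

theorem Ktilde_ext {a b : R.Ktilde} (h1 : R.KtildeToK a = R.KtildeToK b)
    (h2 : R.spinPart a = R.spinPart b) : a = b :=
  Subtype.ext (Prod.ext h1 (Subtype.ext h2))

theorem continuous_dual_AdP (φ : Module.Dual ℝ R.p₀) (v : R.p₀) :
    Continuous fun k : R.K => φ (R.AdP k v) := by
  obtain ⟨f, hf⟩ := LinearMap.exists_extend φ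
  let f' : E →ₗ[ℝ] ℝ := f
  have h1 : Continuous f' := f'.continuous_of_finiteDimensional
  refine (h1.comp ((continuous_Ad (v : LieAlg E G)).comp continuous_subtype_val)).congr fun k => ?_
  exact LinearMap.congr_fun hf (R.AdP k v)

/-- An orthonormal basis of `𝔭₀`. -/
def orthoBasis : Module.Basis (Fin (Module.finrank ℝ R.p₀)) ℝ R.p₀ :=
  (exists_orthonormal_basis R.Bp₀_comm R.Bp₀_pos).choose

theorem Bp₀_orthoBasis (i j) : R.Bp₀ (R.orthoBasis i) (R.orthoBasis j) = if i = j then 1 else 0 :=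
  (exists_orthonormal_basis R.Bp₀_comm R.Bp₀_pos).choose_spec i j

theorem continuous_ι_AdP (v : R.p₀) :
    Continuous fun k : R.K => CliffordAlgebra.ι R.Q₀ (R.AdP k v) := by
  have h : ∀ k : R.K, CliffordAlgebra.ι R.Q₀ (R.AdP k v) =
      ∑ i, R.orthoBasis.coord i (R.AdP k v) • CliffordAlgebra.ι R.Q₀ (R.orthoBasis i) := fun k => by
    conv_lhs => rw [← R.orthoBasis.sum_repr (R.AdP k v)]
    simp only [map_sum, map_smul, Module.Basis.coord_apply]
  simp only [h]
  exact continuous_finsetSum _ fun i _ => Continuous.smul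
    (f := fun k : R.K => R.orthoBasis.coord i (R.AdP k v))
    (g := fun _ => CliffordAlgebra.ι R.Q₀ (R.orthoBasis i))
    (R.continuous_dual_AdP (R.orthoBasis.coord i) v) continuous_const

/-- A scalar multiple of a lift of `Ad(k)` to the spin group, for `k` close to `1`. -/
def preLift (k : R.K) : R.Cl₀ := spinIntertwiner R.Q₀ (R.AdP k) (List.ofFn R.orthoBasis)

theorem continuous_spinIntertwiner (l : List R.p₀) :
    Continuous fun k : R.K => spinIntertwiner R.Q₀ (R.AdP k) l := by
  induction l with
  | nil => exact continuous_const
  | cons e l ih => exact ih.sub (((R.continuous_ι_AdP e).mul ih).mul continuous_const)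

theorem continuous_preLift : Continuous R.preLift := R.continuous_spinIntertwiner _

theorem preLift_one : R.preLift 1 = algebraMap ℝ _ (2 ^ Module.finrank ℝ R.p₀) := by
  unfold preLift
  rw [AdP_one_eq, spinIntertwiner_id R.Q₀_apply _ (by
    intro e he
    obtain ⟨i, rfl⟩ := (List.mem_ofFn' _ _).1 he
    simp [Bp₀_orthoBasis]), List.length_ofFn]

theorem preLift_comm (k : R.K) (v : R.p₀) : R.preLift k * CliffordAlgebra.ι R.Q₀ v =
    CliffordAlgebra.ι R.Q₀ (R.AdP k v) * R.preLift k :=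
  spinIntertwiner_comm_of_basis R.Q₀_apply R.Bp₀_comm (R.AdP k) (R.Bp₀_AdP k) R.orthoBasis
    R.Bp₀_orthoBasis v

theorem preLift_mem_even (k : R.K) : R.preLift k ∈ CliffordAlgebra.even R.Q₀ :=
  spinIntertwiner_mem_even _ _

/-- A linear form on `Cl(𝔭₀)` with value `1` at `1`. -/
def unitForm : Module.Dual ℝ R.Cl₀ := (exists_dual_one ℝ (V := R.Cl₀)).choose

theorem unitForm_one : R.unitForm 1 = 1 := (exists_dual_one ℝ (V := R.Cl₀)).choose_spec

theorem unitForm_algebraMap (r : ℝ) : R.unitForm (algebraMap ℝ _ r) = r := by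
  rw [Algebra.algebraMap_eq_smul_one, map_smul, unitForm_one, smul_eq_mul, mul_one]

theorem continuous_unitForm : Continuous R.unitForm :=
  IsModuleTopology.continuous_of_linearMap _

/-- The spinor norm of `R.preLift k`. -/
def liftNorm (k : R.K) : ℝ := R.unitForm (star (R.preLift k) * R.preLift k)

theorem continuous_liftNorm : Continuous R.liftNorm :=
  R.continuous_unitForm.comp ((R.continuous_star_Cl₀.comp R.continuous_preLift).mul
    R.continuous_preLift)

theorem star_preLift_mul (k : R.K) :
    star (R.preLift k) * R.preLift k = algebraMap ℝ _ (R.liftNorm k) := by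
  obtain ⟨q, hq⟩ := star_mul_self_spinIntertwiner R.Q₀_apply R.Bp₀_comm R.Bp₀_pos (R.AdP k)
    (R.preLift_mem_even k) (R.preLift_comm k)
  rw [liftNorm, hq, unitForm_algebraMap]

theorem liftNorm_one : R.liftNorm 1 = (2 ^ Module.finrank ℝ R.p₀) ^ 2 := by
  rw [liftNorm, preLift_one, CliffordAlgebra.star_algebraMap, ← map_mul, unitForm_algebraMap, sq]

/-- A lift of `Ad(k)` to the spin group, for `k` close to `1`. -/
def spinLift (k : R.K) : R.Cl₀ := (Real.sqrt (R.liftNorm k))⁻¹ • R.preLift k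

theorem spinLift_one : R.spinLift 1 = 1 := by
  rw [spinLift, liftNorm_one, preLift_one, Real.sqrt_sq (by positivity),
    Algebra.algebraMap_eq_smul_one, inv_smul_smul₀ (by positivity)]

theorem spinLift_comm (k : R.K) (v : R.p₀) : R.spinLift k * CliffordAlgebra.ι R.Q₀ v =
    CliffordAlgebra.ι R.Q₀ (R.AdP k v) * R.spinLift k := by
  rw [spinLift, smul_mul_assoc, preLift_comm, mul_smul_comm]

theorem spinLift_mem_even (k : R.K) : R.spinLift k ∈ CliffordAlgebra.even R.Q₀ :=
  Subalgebra.smul_mem _ (R.preLift_mem_even k) _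

theorem spinLift_mem_unitary {k : R.K} (hk : 0 < R.liftNorm k) :
    R.spinLift k ∈ unitary R.Cl₀ := by
  refine mem_unitary_of_star_mul_self ?_
  rw [spinLift, CliffordAlgebra.star_smul, smul_mul_smul_comm, star_preLift_mul,
    Algebra.algebraMap_eq_smul_one, smul_smul, ← mul_inv, Real.mul_self_sqrt hk.le,
    inv_mul_cancel₀ hk.ne', one_smul]

theorem involute_spinLift (k : R.K) :
    CliffordAlgebra.involute (R.spinLift k) = R.spinLift k :=
  CliffordAlgebra.involute_eq_of_mem_even (R.spinLift_mem_even k)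

theorem spinLift_mem_spinGroup {k : R.K} (hk : 0 < R.liftNorm k) :
    R.spinLift k ∈ spinGroup R.Q₀ := by
  refine spinGroup.mem_iff.2 ⟨?_, R.spinLift_mem_even k⟩
  -- If `𝔭₀ = 0`, the sign argument of `mem_pinGroup_of_isometry` is not available; the list of
  -- basis vectors is then empty and the lift equals `1`.
  rcases subsingleton_or_nontrivial R.p₀ with h | h
  · have h0 : Module.finrank ℝ R.p₀ = 0 := Module.finrank_zero_of_subsingleton
    have hl : List.ofFn R.orthoBasis = [] := by
      rw [← List.length_eq_zero_iff, List.length_ofFn, h0]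
    have h1 : R.preLift k = 1 := by rw [preLift, hl]; rfl
    rw [spinLift, liftNorm, h1, star_one, one_mul, unitForm_one, Real.sqrt_one, inv_one, one_smul]
    exact one_mem _
  · refine mem_pinGroup_of_isometry R.Q₀_apply R.Bp₀_comm R.Bp₀_pos (R.AdP k) (R.Bp₀_AdP k)
      (R.spinLift_mem_unitary hk) fun v => ?_
    rw [involute_spinLift, spinLift_comm]

/-- The element `(k, spinLift k)` of `K̃`. -/
def liftElt (k : {k : R.K // 0 < R.liftNorm k}) : R.Ktilde :=
  ⟨(k.1, ⟨R.spinLift k.1, R.spinLift_mem_spinGroup k.2⟩), R.spinLift_comm k.1⟩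

theorem continuous_liftElt : Continuous R.liftElt := by
  have h1 : Continuous fun k : {k : R.K // 0 < R.liftNorm k} => R.spinLift k.1 := by
    have h2 : Continuous fun k : {k : R.K // 0 < R.liftNorm k} => R.liftNorm k.1 :=
      R.continuous_liftNorm.comp continuous_subtype_val
    exact (h2.sqrt.inv₀ fun k => (Real.sqrt_pos.2 k.2).ne').smul
      (R.continuous_preLift.comp continuous_subtype_val)
  exact (continuous_subtype_val.prodMk (h1.subtype_mk _)).subtype_mk _

theorem spinPart_mem_unitary (a : R.Ktilde) : R.spinPart a ∈ unitary R.Cl₀ :=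
  pinGroup.mem_unitary (spinGroup.mem_pin a.1.2.2)

theorem involute_spinPart (a : R.Ktilde) :
    CliffordAlgebra.involute (R.spinPart a) = R.spinPart a :=
  spinGroup.involute_eq a.1.2.2

theorem spinPart_eq_or (a : R.Ktilde) (h : 0 < R.liftNorm (R.KtildeToK a)) :
    R.spinPart a = R.spinLift (R.KtildeToK a) ∨ R.spinPart a = -R.spinLift (R.KtildeToK a) :=
  eq_or_eq_neg_of_twisted R.Q₀_apply R.Bp₀_comm R.Bp₀_pos (R.AdP (R.KtildeToK a))
    (R.spinPart_mem_unitary a) (R.spinLift_mem_unitary h)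
    (fun v => by rw [involute_spinPart, spinPart_comm])
    (fun v => by rw [involute_spinLift, spinLift_comm])

end ReductiveStructure

end

section

open Filter Topology

/-! ### Weak derivatives -/

section WeakDerivative

/-- The function `f` has derivative `f'` at `t` after composition with any linear form. -/
def HasWeakDerivAt (𝕜 : Type*) {V : Type*} [RCLike 𝕜] [AddCommGroup V] [Module 𝕜 V]
    (f : ℝ → V) (f' : V) (t : ℝ) : Prop :=
  ∀ φ : Module.Dual 𝕜 V, HasDerivAt (fun s => φ (f s)) (φ f') t

variable {𝕜 : Type*} [RCLike 𝕜] {V W U : Type*} [AddCommGroup V] [Module 𝕜 V] [AddCommGroup W]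
  [Module 𝕜 W] [AddCommGroup U] [Module 𝕜 U] {f : ℝ → V} {g : ℝ → W} {f' : V} {g' : W} {t : ℝ}

theorem HasWeakDerivAt.map (hf : HasWeakDerivAt 𝕜 f f' t) (L : V →ₗ[𝕜] W) :
    HasWeakDerivAt 𝕜 (fun s => L (f s)) (L f') t := fun φ => hf (φ.comp L)

theorem HasWeakDerivAt.add {h : ℝ → V} {h' : V} (hf : HasWeakDerivAt 𝕜 f f' t)
    (hh : HasWeakDerivAt 𝕜 h h' t) : HasWeakDerivAt 𝕜 (fun s => f s + h s) (f' + h') t := fun φ => by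
  simpa only [map_add] using (hf φ).fun_add (hh φ)

theorem hasWeakDerivAt_const (v : V) : HasWeakDerivAt 𝕜 (fun _ => v) 0 t := fun φ => by
  simpa only [map_zero] using hasDerivAt_const t (φ v)

theorem HasWeakDerivAt.unique {f'' : V} (hf : HasWeakDerivAt 𝕜 f f' t)
    (hf' : HasWeakDerivAt 𝕜 f f'' t) : f' = f'' := by
  rw [← sub_eq_zero, ← Module.forall_dual_apply_eq_zero_iff 𝕜]
  intro φ
  rw [map_sub, (hf φ).unique (hf' φ), sub_self]

theorem HasWeakDerivAt.congr {h : ℝ → V} (hf : HasWeakDerivAt 𝕜 f f' t) (hh : h =ᶠ[𝓝 t] f) :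
    HasWeakDerivAt 𝕜 h f' t := fun φ => (hf φ).congr_of_eventuallyEq (hh.fun_comp φ)

theorem hasWeakDerivAt_of_hasDerivAt {f : ℝ → 𝕜} {f' : 𝕜} (hf : HasDerivAt f f' t) :
    HasWeakDerivAt 𝕜 f f' t := fun φ => by
  have e : ∀ x, φ x = x * φ 1 := fun x => by
    rw [← smul_eq_mul, ← map_smul, smul_eq_mul, mul_one]
  simp only [e (f _), e f']
  exact hf.mul_const _

/-- The product rule, for a bilinear map one of whose factors is finite-dimensional. -/
theorem HasWeakDerivAt.bilin [FiniteDimensional 𝕜 V] (hf : HasWeakDerivAt 𝕜 f f' t)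
    (hg : HasWeakDerivAt 𝕜 g g' t) (β : V →ₗ[𝕜] W →ₗ[𝕜] U) :
    HasWeakDerivAt 𝕜 (fun s => β (f s) (g s)) (β f' (g t) + β (f t) g') t := fun φ => by
  let e := Module.finBasis 𝕜 V
  have key : ∀ v w, φ (β v w) = ∑ i, e.coord i v * φ (β (e i) w) := fun v w => by
    conv_lhs => rw [← e.sum_repr v]
    simp only [map_sum, map_smul, LinearMap.sum_apply, LinearMap.smul_apply, smul_eq_mul,
      Module.Basis.coord_apply]
  have e1 : (fun s => φ (β (f s) (g s))) = fun s => ∑ i, e.coord i (f s) * φ (β (e i) (g s)) :=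
    funext fun s => key _ _
  rw [e1, map_add, key f', key (f t), ← Finset.sum_add_distrib]
  exact HasDerivAt.fun_sum fun i _ => (hf (e.coord i)).mul (hg (φ.comp (β (e i))))

/-- Real-linear images of a weakly differentiable function in a complex vector space. -/
theorem HasWeakDerivAt.mapComplex {V W : Type*} [AddCommGroup V] [Module ℝ V]
    [FiniteDimensional ℝ V] [AddCommGroup W] [Module ℂ W] {f : ℝ → V} {f' : V}
    (hf : HasWeakDerivAt ℝ f f' t) (L : V →+ W) (hL : ∀ (r : ℝ) v, L (r • v) = (r : ℂ) • L v) :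
    HasWeakDerivAt ℂ (fun s => L (f s)) (L f') t := fun φ => by
  let e := Module.finBasis ℝ V
  have key : ∀ v, φ (L v) = ∑ i, (e.coord i v : ℂ) * φ (L (e i)) := fun v => by
    conv_lhs => rw [← e.sum_repr v]
    simp only [map_sum, hL, map_smul, smul_eq_mul, Module.Basis.coord_apply]
  have e1 : (fun s => φ (L (f s))) = fun s => ∑ i, (e.coord i (f s) : ℂ) * φ (L (e i)) :=
    funext fun s => key _
  rw [e1, key f']
  exact HasDerivAt.fun_sum fun i _ => (hf (e.coord i)).ofReal_comp.mul_const _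

end WeakDerivative

/-! ### The differential of `θ` and the spin action of `𝔨₀` -/

namespace ReductiveStructure

universe u v

variable {E : Type u} [NormedAddCommGroup E] [NormedSpace ℝ E] {G : Type v}
  [TopologicalSpace G] [ChartedSpace E G] [Group G] [LieGroup 𝓘(ℝ, E) ∞ G]
  (R : ReductiveStructure E G)

theorem exists_curve (Z : E) : ∃ c : ℝ → G, HasVelocityAtOne c (Z : LieAlg E G) := by
  have h1 : HasDerivAt (fun t : ℝ => chartOrigin E G + t • Z) Z 0 := by
    simpa using ((hasDerivAt_id (0 : ℝ)).smul_const Z).const_add (chartOrigin E G)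
  have h2 : Tendsto (fun t : ℝ => chartOrigin E G + t • Z) (𝓝 0) (𝓝 (chartOrigin E G)) := by
    have := h1.continuousAt.tendsto
    simpa using this
  refine ⟨fun t => expChart E G (chartOrigin E G + t • Z), hasVelocityAtOne_iff.2
    ⟨by simp, ?_, ?_⟩⟩
  · refine ContinuousAt.comp (f := fun t : ℝ => chartOrigin E G + t • Z) ?_ h1.continuousAt
    have h3 : chartOrigin E G + (0 : ℝ) • Z = chartOrigin E G := by simp
    change ContinuousAt _ (chartOrigin E G + (0 : ℝ) • Z)
    rw [h3]
    exact (contMDiffAt_expChart_origin E G).continuousAt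
  · exact h1.congr_of_eventuallyEq (h2.eventually (eventually_logChart_expChart E G))

/-- The differential `dθ` of the Cartan involution, on the model space. -/
def dθ : E →ₗ[ℝ] E := diffAtOne R.θ

/-- The chain rule is applied to `θ (g x g⁻¹) = θ g · θ x · (θ g)⁻¹`. -/
theorem dθ_Ad (g : G) (Y : LieAlg E G) : diffAtOne R.θ (Ad g Y) = Ad (R.θ g) (diffAtOne R.θ Y) := by
  have hθ : MDifferentiableAt 𝓘(ℝ, E) 𝓘(ℝ, E) R.θ 1 := R.contMDiff_θ.mdifferentiableAt (by simp)
  have h1 := diffAtOne_comp (E := E) (f := R.θ) (h := fun x : G => g * x * g⁻¹) hθ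
    (mdifferentiableAt_conj _ _) (by simp) Y
  have h2 := diffAtOne_comp (E := E) (h := R.θ) (f := fun x : G => R.θ g * x * (R.θ g)⁻¹)
    (mdifferentiableAt_conj _ _) hθ (map_one _) Y
  unfold Ad
  rw [← h1, ← h2]
  simp only [map_mul, map_inv]

theorem hasVelocityAtOne_θ {c : ℝ → G} {Z : LieAlg E G} (hc : HasVelocityAtOne c Z) :
    HasVelocityAtOne (fun t => R.θ (c t)) (diffAtOne R.θ Z) := by
  obtain ⟨h0, hcont, hd⟩ := hasVelocityAtOne_iff.1 hc
  have hx0 : logChart E G (c 0) = chartOrigin E G := by rw [h0]; rfl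
  have h1 : HasFDerivAt R.chartθ (fderiv ℝ R.chartθ (chartOrigin E G)) (logChart E G (c 0)) := by
    rw [hx0]; exact (R.contDiffAt_chartθ.differentiableAt (by simp)).hasFDerivAt
  have h2 := HasFDerivAt.comp_hasDerivAt (E := E) (F := E) (0 : ℝ) h1 hd
  have h3 : (R.chartθ ∘ fun t => logChart E G (c t)) =ᶠ[𝓝 0]
      fun t => logChart E G (R.θ (c t)) := by
    have hct : Tendsto c (𝓝 0) (𝓝 1) := by rw [← h0]; exact hcont
    filter_upwards [hct.eventually (eventually_expChart_logChart E G)] with t ht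
    simp only [Function.comp, chartθ, ht]
  have h4 := h2.congr_of_eventuallyEq h3.symm
  refine hasVelocityAtOne_iff.2 ⟨by simp [h0],
    R.contMDiff_θ.continuous.continuousAt.comp hcont, ?_⟩
  have h5 : fderiv ℝ R.chartθ (chartOrigin E G) (Z : E) = R.dθ Z := (R.diffAtOne_θ_eq Z).symm
  rw [h5] at h4
  exact h4

variable [FiniteDimensional ℝ E]

/-- The differential of the Cartan involution is an automorphism of the Lie algebra. -/
theorem dθ_lie (Z Y : LieAlg E G) : diffAtOne R.θ ⁅Z, Y⁆ = ⁅diffAtOne R.θ Z, diffAtOne R.θ Y⁆ := by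
  -- The identity `dθ (Ad (c t) Y) = Ad (θ (c t)) (dθ Y)` is differentiated at `0` along a curve
  -- with velocity `Z`.
  obtain ⟨c, hc⟩ := exists_curve (E := E) (G := G) Z
  have h1 := hasDerivAt_Ad (R.hasVelocityAtOne_θ hc) (diffAtOne R.θ Y)
  have h2 : HasDerivAt (fun t => R.dθ (Ad (c t) Y)) (R.dθ (⁅Z, Y⁆ : LieAlg E G)) 0 := by
    let L : E →L[ℝ] E := R.dθ.toContinuousLinearMap
    have h3 := HasFDerivAt.comp_hasDerivAt (E := E) (F := E) (0 : ℝ) (L.hasFDerivAt)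
      (hasDerivAt_Ad hc Y)
    exact h3
  have h4 : (fun t => R.dθ (Ad (c t) Y)) = fun t => (Ad (R.θ (c t)) (diffAtOne R.θ Y) : E) :=
    funext fun t => R.dθ_Ad (c t) Y
  rw [h4] at h2
  exact HasDerivAt.unique (F := E) h2 h1

/-- The bracket of `Z ∈ 𝔨₀` with an element of `𝔭₀`. -/
def adP (Z : LieAlg E G) (hZ : diffAtOne R.θ Z = Z) : R.p₀ →ₗ[ℝ] R.p₀ :=
  LinearMap.restrict (LieAlgebra.ad ℝ (LieAlg E G) Z) fun Y hY => by
    change diffAtOne R.θ ⁅Z, Y⁆ = -⁅Z, Y⁆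
    have hY' : diffAtOne R.θ Y = -Y := hY
    rw [dθ_lie, hZ, hY', lie_neg]

theorem Bp₀_adP_left (Z : LieAlg E G) (hZ : diffAtOne R.θ Z = Z) (v w : R.p₀) :
    R.Bp₀ (R.adP Z hZ v) w = -R.Bp₀ v (R.adP Z hZ w) := by
  change R.B ⁅Z, (v : LieAlg E G)⁆ w = -R.B v ⁅Z, (w : LieAlg E G)⁆
  rw [← lie_skew, map_neg, LinearMap.neg_apply, R.B_lie]

/-- The element of `Cl(𝔭₀)` whose commutator with `v ∈ 𝔭₀` is `[Z, v]`. -/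
def spinDeriv (Z : LieAlg E G) : R.Cl₀ :=
  (4⁻¹ : ℝ) • ∑ i, ∑ j, R.B ⁅Z, (R.orthoBasis i : LieAlg E G)⁆ (R.orthoBasis j) •
    (CliffordAlgebra.ι R.Q₀ (R.orthoBasis i) * CliffordAlgebra.ι R.Q₀ (R.orthoBasis j))

theorem sum_Bp₀_orthoBasis (v : R.p₀) :
    ∑ i, R.Bp₀ (R.orthoBasis i) v • R.orthoBasis i = v := by
  have h : ∀ i, R.Bp₀ (R.orthoBasis i) v = R.orthoBasis.repr v i := fun i => by
    rw [← congrArg (R.Bp₀ (R.orthoBasis i)) (R.orthoBasis.sum_repr v), map_sum]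
    simp only [map_smul, Bp₀_orthoBasis, smul_eq_mul, mul_ite, mul_one, mul_zero,
      Finset.sum_ite_eq, Finset.mem_univ, if_true]
  simp only [h, R.orthoBasis.sum_repr]

/-- The commutator is expressed by anticommutators, `[ab, v] = a {b, v} - {a, v} b`, which are
scalars. -/
theorem ι_mul_ι_commutator (a b v : R.p₀) :
    CliffordAlgebra.ι R.Q₀ a * CliffordAlgebra.ι R.Q₀ b * CliffordAlgebra.ι R.Q₀ v -
      CliffordAlgebra.ι R.Q₀ v * (CliffordAlgebra.ι R.Q₀ a * CliffordAlgebra.ι R.Q₀ b) =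
    CliffordAlgebra.ι R.Q₀ ((2 * R.Bp₀ a v) • b - (2 * R.Bp₀ b v) • a) := by
  have h1 := clifford_relation R.Q₀_apply R.Bp₀_comm a v
  have h2 := clifford_relation R.Q₀_apply R.Bp₀_comm b v
  rw [Algebra.algebraMap_eq_smul_one] at h1 h2
  have e : CliffordAlgebra.ι R.Q₀ a * CliffordAlgebra.ι R.Q₀ b * CliffordAlgebra.ι R.Q₀ v -
      CliffordAlgebra.ι R.Q₀ v * (CliffordAlgebra.ι R.Q₀ a * CliffordAlgebra.ι R.Q₀ b) =
      CliffordAlgebra.ι R.Q₀ a * (CliffordAlgebra.ι R.Q₀ b * CliffordAlgebra.ι R.Q₀ v +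
        CliffordAlgebra.ι R.Q₀ v * CliffordAlgebra.ι R.Q₀ b) -
      (CliffordAlgebra.ι R.Q₀ a * CliffordAlgebra.ι R.Q₀ v +
        CliffordAlgebra.ι R.Q₀ v * CliffordAlgebra.ι R.Q₀ a) * CliffordAlgebra.ι R.Q₀ b := by
    noncomm_ring
  rw [e, h1, h2, mul_smul_comm, smul_mul_assoc, one_mul, mul_one, map_sub, map_smul, map_smul]
  module

/-- The commutators of `e_i e_j` with `v` give two sums; as `ad Z` is skew for `B`, they contribute
`2 [Z, v]` each, which explains the factor `1/4` in `spinDeriv`. -/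
theorem spinDeriv_commutator (Z : LieAlg E G) (hZ : diffAtOne R.θ Z = Z) (v : R.p₀) :
    R.spinDeriv Z * CliffordAlgebra.ι R.Q₀ v - CliffordAlgebra.ι R.Q₀ v * R.spinDeriv Z =
      CliffordAlgebra.ι R.Q₀ (R.adP Z hZ v) := by
  have h0 : ∀ i j, R.B ⁅Z, (R.orthoBasis i : LieAlg E G)⁆ (R.orthoBasis j) =
    R.Bp₀ (R.adP Z hZ (R.orthoBasis i)) (R.orthoBasis j) := fun i j => rfl
  simp only [spinDeriv, h0]
  rw [smul_mul_assoc, mul_smul_comm, ← smul_sub, Finset.sum_mul, Finset.mul_sum,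
    ← Finset.sum_sub_distrib]
  simp only [Finset.sum_mul, Finset.mul_sum, smul_mul_assoc, mul_smul_comm,
    ← Finset.sum_sub_distrib, ← smul_sub, ι_mul_ι_commutator]
  simp only [← map_smul, ← map_sum]
  congr 1
  simp only [smul_sub, smul_smul, Finset.sum_sub_distrib]
  have h1 : ∑ i, ∑ j, (R.Bp₀ (R.adP Z hZ (R.orthoBasis i)) (R.orthoBasis j) *
      (2 * R.Bp₀ (R.orthoBasis i) v)) • R.orthoBasis j = (2 : ℝ) • R.adP Z hZ v := by
    have h2 : ∀ i, ∑ j, (R.Bp₀ (R.adP Z hZ (R.orthoBasis i)) (R.orthoBasis j) *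
      (2 * R.Bp₀ (R.orthoBasis i) v)) • R.orthoBasis j =
        (2 : ℝ) • R.adP Z hZ (R.Bp₀ (R.orthoBasis i) v • R.orthoBasis i) := fun i => by
      rw [map_smul]
      conv_rhs => rw [← R.sum_Bp₀_orthoBasis (R.adP Z hZ (R.orthoBasis i))]
      rw [Finset.smul_sum, Finset.smul_sum]
      refine Finset.sum_congr rfl fun j _ => ?_
      rw [smul_smul, smul_smul, R.Bp₀_comm (R.orthoBasis j)]
      congr 1; ring
    simp only [h2]
    rw [← Finset.smul_sum, ← map_sum, sum_Bp₀_orthoBasis]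
  have h3 : ∑ i, ∑ j, (R.Bp₀ (R.adP Z hZ (R.orthoBasis i)) (R.orthoBasis j) *
      (2 * R.Bp₀ (R.orthoBasis j) v)) • R.orthoBasis i = -(2 : ℝ) • R.adP Z hZ v := by
    rw [neg_smul, ← h1, Finset.sum_comm, ← Finset.sum_neg_distrib]
    refine Finset.sum_congr rfl fun i _ => ?_
    rw [← Finset.sum_neg_distrib]
    refine Finset.sum_congr rfl fun j _ => ?_
    rw [R.Bp₀_adP_left, R.Bp₀_comm, ← neg_smul]
    congr 1; ring
  rw [h1, h3]
  module

theorem involute_spinDeriv (Z : LieAlg E G) :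
    CliffordAlgebra.involute (R.spinDeriv Z) = R.spinDeriv Z := by
  simp [spinDeriv]

/-- The operation `star` reverses each product `e_i e_j`, and the coefficients are skew in `i, j`.
-/
theorem star_spinDeriv (Z : LieAlg E G) (hZ : diffAtOne R.θ Z = Z) :
    star (R.spinDeriv Z) = -R.spinDeriv Z := by
  have h0 : ∀ i j, R.B ⁅Z, (R.orthoBasis i : LieAlg E G)⁆ (R.orthoBasis j) =
    R.Bp₀ (R.adP Z hZ (R.orthoBasis i)) (R.orthoBasis j) := fun i j => rfl
  simp only [spinDeriv, h0]
  rw [CliffordAlgebra.star_smul, star_sum, ← smul_neg, ← Finset.sum_neg_distrib]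
  congr 1
  simp only [star_sum, CliffordAlgebra.star_smul, star_mul, star_ι_clifford, neg_mul_neg]
  rw [Finset.sum_comm]
  refine Finset.sum_congr rfl fun i _ => ?_
  rw [← Finset.sum_neg_distrib]
  refine Finset.sum_congr rfl fun j _ => ?_
  rw [R.Bp₀_adP_left, R.Bp₀_comm, neg_smul]

/-- The curve `c` in `K̃` satisfies `c 0 = 1` and `c' 0 = Z`. -/
def HasVelocity (c : ℝ → R.Ktilde) (Z : LieAlg E G) : Prop :=
  c 0 = 1 ∧ ContinuousAt c 0 ∧ HasVelocityAtOne (fun t => (R.KtildeToK (c t) : G)) Z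

theorem HasVelocity.dθ_eq {R : ReductiveStructure E G} {c : ℝ → R.Ktilde} {Z : LieAlg E G}
    (hc : R.HasVelocity c Z) : diffAtOne R.θ Z = Z :=
  R.diffAtOne_θ_of_hasVelocityAtOne hc.2.2 fun t => (R.KtildeToK (c t)).2

end ReductiveStructure

end

section

open Filter Topology

/-! ### Curves in `K̃` and compactness of `K̃` -/

namespace ReductiveStructure

universe u v

variable {E : Type u} [NormedAddCommGroup E] [NormedSpace ℝ E] {G : Type v}
  [TopologicalSpace G] [ChartedSpace E G] [Group G] [LieGroup 𝓘(ℝ, E) ∞ G]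
  (R : ReductiveStructure E G) [FiniteDimensional ℝ E]

theorem hasWeakDerivAt_AdP {c : ℝ → R.K} {Z : LieAlg E G}
    (hc : HasVelocityAtOne (fun t => (c t : G)) Z) (hZ : diffAtOne R.θ Z = Z) (v : R.p₀) :
    HasWeakDerivAt ℝ (fun t => R.AdP (c t) v) (R.adP Z hZ v) 0 := fun φ => by
  obtain ⟨f, hf⟩ := LinearMap.exists_extend φ
  let L : E →L[ℝ] ℝ := (show E →ₗ[ℝ] ℝ from f).toContinuousLinearMap
  have h3 := HasFDerivAt.comp_hasDerivAt (E := ℝ) (F := E) (0 : ℝ) (L.hasFDerivAt)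
    (hasDerivAt_Ad hc (v : LieAlg E G))
  have h4 : ∀ w : R.p₀, φ w = f w := fun w => (LinearMap.congr_fun hf w).symm
  have h5 : (fun t => φ (R.AdP (c t) v)) = fun t => f (Ad (c t : G) (v : LieAlg E G)) :=
    funext fun t => h4 _
  rw [h5, h4]
  exact h3

theorem exists_hasWeakDerivAt_spinIntertwiner {c : ℝ → R.K} {Z : LieAlg E G}
    (hc : HasVelocityAtOne (fun t => (c t : G)) Z) (hZ : diffAtOne R.θ Z = Z) (l : List R.p₀) :
    ∃ σ, HasWeakDerivAt ℝ (fun t => spinIntertwiner R.Q₀ (R.AdP (c t)) l) σ 0 := by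
  have := R.finite_Cl₀
  induction l with
  | nil => exact ⟨0, hasWeakDerivAt_const _⟩
  | cons e l ih =>
    obtain ⟨σ, hσ⟩ := ih
    have h1 := ((R.hasWeakDerivAt_AdP hc hZ e).map (CliffordAlgebra.ι R.Q₀)).bilin hσ
      (LinearMap.mul ℝ R.Cl₀)
    exact ⟨_, hσ.add (h1.map (-LinearMap.mulRight ℝ (CliffordAlgebra.ι R.Q₀ e))) |>.congr
      (Eventually.of_forall fun t => by simp [spinIntertwiner, sub_eq_add_neg])⟩

/-- The lift is polynomial in `Ad` up to the normalization by a square root. Existence of the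
derivative is enough here; its value is determined algebraically in `HasVelocity.spinPart`. -/
theorem exists_hasWeakDerivAt_spinLift {c : ℝ → R.K} {Z : LieAlg E G}
    (hc : HasVelocityAtOne (fun t => (c t : G)) Z) (hZ : diffAtOne R.θ Z = Z) :
    ∃ σ, HasWeakDerivAt ℝ (fun t => R.spinLift (c t)) σ 0 := by
  have := R.finite_Cl₀
  obtain ⟨σ, hσ⟩ := R.exists_hasWeakDerivAt_spinIntertwiner hc hZ (List.ofFn R.orthoBasis)
  let star' : R.Cl₀ →ₗ[ℝ] R.Cl₀ :=
    CliffordAlgebra.reverse.comp (CliffordAlgebra.involute (Q := R.Q₀)).toLinearMap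
  have h1 := ((hσ.map star').bilin hσ (LinearMap.mul ℝ R.Cl₀)) R.unitForm
  have h2 : HasDerivAt (fun t => R.liftNorm (c t)) _ 0 := h1
  have h0 : c 0 = 1 := Subtype.ext hc.1
  have h3 : 0 < R.liftNorm (c 0) := by rw [h0, liftNorm_one]; positivity
  have h4 := hasWeakDerivAt_of_hasDerivAt ((h2.sqrt h3.ne').inv (Real.sqrt_pos.2 h3).ne')
  exact ⟨_, h4.bilin hσ (LinearMap.lsmul ℝ R.Cl₀)⟩

/-- The spin component of a curve in `K̃`. -/
theorem HasVelocity.spinPart {R : ReductiveStructure E G} {c : ℝ → R.Ktilde} {Z : LieAlg E G}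
    (hc : R.HasVelocity c Z) :
    HasWeakDerivAt ℝ (fun t => R.spinPart (c t)) (R.spinDeriv Z) 0 := by
  have hfin := R.finite_Cl₀
  have hZ := hc.dθ_eq
  obtain ⟨σ, hσ⟩ := R.exists_hasWeakDerivAt_spinLift hc.2.2 hZ
  have hK : ContinuousAt (fun t => R.KtildeToK (c t)) 0 :=
    R.continuous_KtildeToK.continuousAt.comp hc.2.1
  have hK0 : R.KtildeToK (c 0) = 1 := by rw [hc.1, map_one]
  have hs : ContinuousAt (fun t => R.unitForm (R.spinPart (c t))) 0 :=
    (R.continuous_unitForm.comp R.continuous_spinPart).continuousAt.comp hc.2.1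
  have hs0 : ∀ᶠ t in 𝓝 0, 0 < R.unitForm (R.spinPart (c t)) :=
    hs.eventually_const_lt (by beta_reduce; rw [hc.1, spinPart_one, unitForm_one]; exact one_pos)
  have hn0 : ∀ᶠ t in 𝓝 0, 0 < R.liftNorm (R.KtildeToK (c t)) :=
    (R.continuous_liftNorm.continuousAt.comp hK).eventually_const_lt
      (by rw [Function.comp, hK0, liftNorm_one]; positivity)
  have hl0 : ∀ᶠ t in 𝓝 0, 0 < R.unitForm (R.spinLift (R.KtildeToK (c t))) := by
    have := (hσ R.unitForm).continuousAt
    refine this.eventually_const_lt ?_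
    beta_reduce; rw [hK0, spinLift_one, unitForm_one]; exact one_pos
  have heq : (fun t => R.spinPart (c t)) =ᶠ[𝓝 0] fun t => R.spinLift (R.KtildeToK (c t)) := by
    -- Near `t = 0` the spin component is `±` the local lift; both have positive value under
    -- `unitForm`, so the sign is `+`.
    filter_upwards [hs0, hn0, hl0] with t h1 h2 h3
    rcases R.spinPart_eq_or (c t) h2 with h | h
    · exact h
    · rw [h, map_neg] at h1; linarith
  have hs' := hσ.congr heq
  have hone : R.spinPart (c 0) = 1 := by rw [hc.1, spinPart_one]
  -- Differentiating evenness, unitarity and the intertwining relation shows that `σ` is even, skew,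
  -- and has commutator `[Z, v]` with `v`. By `eq_of_commutator_eq` these properties determine `σ`.
  have e1 : CliffordAlgebra.involute σ = σ := by
    have h1 := hs'.map (CliffordAlgebra.involute (Q := R.Q₀)).toLinearMap
    refine h1.unique (hs'.congr (Eventually.of_forall fun t => ?_))
    exact R.involute_spinPart (c t)
  have e2 : star σ = -σ := by
    let star' : R.Cl₀ →ₗ[ℝ] R.Cl₀ :=
      CliffordAlgebra.reverse.comp (CliffordAlgebra.involute (Q := R.Q₀)).toLinearMap
    have h1 := (hs'.map star').bilin hs' (LinearMap.mul ℝ R.Cl₀)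
    have h2 : HasWeakDerivAt ℝ (fun _ : ℝ => (1 : R.Cl₀)) 0 0 := hasWeakDerivAt_const _
    have h3 := h1.unique (h2.congr (Eventually.of_forall fun t =>
      (Unitary.mem_iff.1 (R.spinPart_mem_unitary (c t))).1))
    simp only [hone, LinearMap.mul_apply'] at h3
    have h4 : star' 1 = 1 := star_one R.Cl₀
    rw [h4, mul_one, one_mul] at h3
    exact eq_neg_of_add_eq_zero_left h3
  have e3 : σ = R.spinDeriv Z := by
    refine eq_of_commutator_eq R.Q₀_apply R.Bp₀_comm R.Bp₀_pos e1 (R.involute_spinDeriv Z) e2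
      (R.star_spinDeriv Z hZ) fun v => ?_
    rw [R.spinDeriv_commutator Z hZ]
    have h1 := hs'.map (LinearMap.mulRight ℝ (CliffordAlgebra.ι R.Q₀ v))
    have h2 := ((R.hasWeakDerivAt_AdP hc.2.2 hZ v).map (CliffordAlgebra.ι R.Q₀)).bilin hs'
      (LinearMap.mul ℝ R.Cl₀)
    have h3 := h1.unique (h2.congr (Eventually.of_forall fun t => R.spinPart_comm (c t) v))
    simp only [hone, hK0, LinearMap.mulRight_apply, LinearMap.mul_apply', mul_one, AdP_one] at h3
    rw [h3, add_sub_cancel_right]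
  rw [← e3]
  exact hs'

/-- The lift of `K` to `K̃` near `1`. -/
def lift (k : R.K) : R.Ktilde := if h : 0 < R.liftNorm k then R.liftElt ⟨k, h⟩ else 1

theorem lift_eq {k : R.K} (h : 0 < R.liftNorm k) : R.lift k = R.liftElt ⟨k, h⟩ := dif_pos h

theorem KtildeToK_lift {k : R.K} (h : 0 < R.liftNorm k) : R.KtildeToK (R.lift k) = k := by
  rw [R.lift_eq h]; rfl

theorem spinPart_lift {k : R.K} (h : 0 < R.liftNorm k) : R.spinPart (R.lift k) = R.spinLift k := by
  rw [R.lift_eq h]; rfl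

theorem liftNorm_one_pos : 0 < R.liftNorm 1 := by rw [liftNorm_one]; positivity

theorem lift_one : R.lift 1 = 1 :=
  R.Ktilde_ext (by rw [R.KtildeToK_lift R.liftNorm_one_pos, map_one])
    (by rw [R.spinPart_lift R.liftNorm_one_pos, spinLift_one, spinPart_one])

theorem isOpen_liftNorm_pos : IsOpen {k | 0 < R.liftNorm k} :=
  isOpen_lt continuous_const R.continuous_liftNorm

theorem continuousAt_lift {k : R.K} (h : 0 < R.liftNorm k) : ContinuousAt R.lift k := by
  have h1 : ContinuousOn R.lift {k | 0 < R.liftNorm k} := by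
    rw [continuousOn_iff_continuous_domRestrict]
    refine R.continuous_liftElt.congr fun k => ?_
    exact (R.lift_eq k.2).symm
  exact h1.continuousAt (R.isOpen_liftNorm_pos.mem_nhds h)

theorem continuousAt_of_hasVelocityAtOne {c : ℝ → R.K} {t : ℝ} {Z : LieAlg E G}
    (hc : HasVelocityAtOne (fun h => (((c t)⁻¹ * c (t + h) : R.K) : G)) Z) :
    ContinuousAt c t := by
  have h1 := (hasVelocityAtOne_iff.1 hc).2.1
  have h2 : ContinuousAt (fun h => (c t)⁻¹ * c (t + h)) 0 :=
    Topology.IsInducing.subtypeVal.continuousAt_iff.2 h1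
  have h3 : ContinuousAt (fun s : ℝ => (c t)⁻¹ * c (t + (s - t))) t := by
    have h4 : ContinuousAt (fun s : ℝ => s - t) t := by fun_prop
    have h5 : ContinuousAt (fun h => (c t)⁻¹ * c (t + h)) ((fun s : ℝ => s - t) t) := by
      simpa using h2
    exact ContinuousAt.comp (f := fun s : ℝ => s - t) h5 h4
  refine ((continuousAt_const (y := c t)).mul h3).congr (Eventually.of_forall fun s => ?_)
  simp

/-- Every element of `𝔨₀` is the velocity of a curve in `K̃`. -/
theorem exists_hasVelocity {Z : LieAlg E G} (hZ : diffAtOne R.θ Z = Z) :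
    ∃ c, R.HasVelocity c Z := by
  have : CompleteSpace E := FiniteDimensional.complete ℝ E
  obtain ⟨c, hc⟩ := R.exists_curve_hasVelocityAtOne Z hZ
  have h0 : c 0 = 1 := Subtype.ext hc.1
  have h1 : ContinuousAt c 0 := Topology.IsInducing.subtypeVal.continuousAt_iff.2 (hasVelocityAtOne_iff.1 hc).2.1
  have h2 : 0 < R.liftNorm (c 0) := by rw [h0]; exact R.liftNorm_one_pos
  have h3 : (fun t => R.KtildeToK (R.lift (c t))) =ᶠ[𝓝 0] c := by
    filter_upwards [h1.eventually (R.isOpen_liftNorm_pos.mem_nhds h2)] with t ht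
    exact R.KtildeToK_lift ht
  refine ⟨fun t => R.lift (c t), by beta_reduce; rw [h0, lift_one], (R.continuousAt_lift h2).comp h1, ?_⟩
  obtain ⟨a1, a2, a3⟩ := hasVelocityAtOne_iff.1 hc
  refine hasVelocityAtOne_iff.2 ⟨(congrArg Subtype.val h3.self_of_nhds).trans a1, a2.congr ?_, ?_⟩
  · exact (h3.symm.fun_comp fun k : R.K => (k : G))
  · exact a3.congr_of_eventuallyEq (h3.fun_comp fun k : R.K => logChart E G (k : G))

/-- Elements of `K̃` close to `1` are the endpoints of short curves in `K̃`. -/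
theorem exists_short_curve_Ktilde {δ : ℝ} (hδ : 0 < δ) : ∃ U ∈ 𝓝 (1 : R.Ktilde), ∀ a ∈ U,
    ∃ c : ℝ → R.Ktilde, c 0 = 1 ∧ c 1 = a ∧ ∀ t ∈ Set.Icc (0 : ℝ) 1, ∃ Z : E, ‖Z‖ ≤ δ ∧
      R.HasVelocity (fun h => (c t)⁻¹ * c (t + h)) Z := by
  have : CompleteSpace E := FiniteDimensional.complete ℝ E
  -- The second condition makes `unitForm` positive on the lift, so that it distinguishes the two
  -- sheets of `K̃` and the lifted curve is seen to end at `a`.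
  have hΩ : {k : R.K | 0 < R.liftNorm k ∧ 0 < R.unitForm (R.preLift k)} ∈ 𝓝 (1 : R.K) := by
    refine Filter.inter_mem (R.isOpen_liftNorm_pos.mem_nhds R.liftNorm_one_pos) ?_
    refine (isOpen_lt continuous_const (R.continuous_unitForm.comp
      R.continuous_preLift)).mem_nhds ?_
    change 0 < R.unitForm (R.preLift 1)
    rw [preLift_one, unitForm_algebraMap]; positivity
  obtain ⟨O, hO, hOΩ⟩ := mem_nhds_induced _ _ _ |>.1 hΩ
  obtain ⟨N, hN, hc⟩ := R.exists_short_curve (O := O) hO hδ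
  have hU1 : Tendsto (fun a : R.Ktilde => (R.KtildeToK a : G)) (𝓝 1) (𝓝 1) :=
    (continuous_subtype_val.comp R.continuous_KtildeToK).tendsto' _ _ rfl
  have hU2 : ∀ᶠ a in 𝓝 (1 : R.Ktilde), 0 < R.unitForm (R.spinPart a) := by
    refine (isOpen_lt continuous_const (R.continuous_unitForm.comp
      R.continuous_spinPart)).mem_nhds ?_
    change 0 < R.unitForm (R.spinPart 1)
    rw [spinPart_one, unitForm_one]; exact one_pos
  refine ⟨_, (hU1.eventually hN).and hU2, fun a ha => ?_⟩
  obtain ⟨c, h0, h1, hcO, hcv⟩ := hc (R.KtildeToK a) ha.1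
  have hpos : ∀ t ∈ Set.Icc (0 : ℝ) 1, 0 < R.liftNorm (c t) ∧ 0 < R.unitForm (R.preLift (c t)) :=
    fun t ht => hOΩ (hcO t ht)
  refine ⟨fun t => R.lift (c t), by beta_reduce; rw [h0, lift_one], ?_, fun t ht => ?_⟩
  · have h2 := hpos 1 (by simp)
    beta_reduce
    rw [h1] at h2 ⊢
    refine R.Ktilde_ext (R.KtildeToK_lift h2.1) ?_
    rw [R.spinPart_lift h2.1]
    rcases R.spinPart_eq_or a h2.1 with h | h
    · exact h.symm
    · exfalso
      have h3 := ha.2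
      rw [h, map_neg, spinLift, map_smul, smul_eq_mul] at h3
      have h4 : 0 < (Real.sqrt (R.liftNorm (R.KtildeToK a)))⁻¹ := by
        have := Real.sqrt_pos.2 h2.1; positivity
      nlinarith [mul_pos h4 h2.2]
  · obtain ⟨Z, hZ, -, hvel⟩ := hcv t ht
    have hct := R.continuousAt_of_hasVelocityAtOne hvel
    have h2 := hpos t ht
    have h3 : ContinuousAt (fun h : ℝ => c (t + h)) 0 := by
      have h4 : ContinuousAt (fun h : ℝ => t + h) 0 := by fun_prop
      exact ContinuousAt.comp (f := fun h : ℝ => t + h) (by simpa using hct) h4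
    have h2' : 0 < R.liftNorm (c (t + 0)) := by simpa using h2.1
    have h5 : (fun h => R.KtildeToK ((R.lift (c t))⁻¹ * R.lift (c (t + h)))) =ᶠ[𝓝 0]
        fun h => (c t)⁻¹ * c (t + h) := by
      filter_upwards [h3.eventually (R.isOpen_liftNorm_pos.mem_nhds h2')] with h hh
      rw [map_mul, map_inv, R.KtildeToK_lift h2.1, R.KtildeToK_lift hh]
    refine ⟨Z, hZ, by simp, continuousAt_const.mul
      (ContinuousAt.comp (f := fun h : ℝ => c (t + h)) (R.continuousAt_lift h2') h3), ?_⟩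
    obtain ⟨a1, a2, a3⟩ := hasVelocityAtOne_iff.1 hvel
    refine hasVelocityAtOne_iff.2 ⟨by simp, a2.congr ?_, ?_⟩
    · exact (h5.symm.fun_comp fun k : R.K => (k : G))
    · exact a3.congr_of_eventuallyEq (h5.fun_comp fun k : R.K => logChart E G (k : G))

/-- Two lifts of the same element differ by a sign. The element `z` is `(1, -1)` when this belongs
to `K̃`; otherwise the second sheet is empty and `z = 1` serves. -/
theorem exists_eq_mul_lift : ∃ z : R.Ktilde, ∀ a : R.Ktilde, 0 < R.liftNorm (R.KtildeToK a) →
    a = R.lift (R.KtildeToK a) ∨ a = z * R.lift (R.KtildeToK a) := by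
  have key : ∀ a : R.Ktilde, 0 < R.liftNorm (R.KtildeToK a) →
      a = R.lift (R.KtildeToK a) ∨ R.spinPart a = -R.spinPart (R.lift (R.KtildeToK a)) := by
    intro a ha
    rcases R.spinPart_eq_or a ha with h | h
    · exact Or.inl (R.Ktilde_ext (R.KtildeToK_lift ha).symm (by rw [h, R.spinPart_lift ha]))
    · exact Or.inr (by rw [h, R.spinPart_lift ha])
  by_cases hz : ∃ z : R.Ktilde, R.KtildeToK z = 1 ∧ R.spinPart z = -1
  · obtain ⟨z, hz1, hz2⟩ := hz
    refine ⟨z, fun a ha => (key a ha).imp_right fun h => R.Ktilde_ext ?_ ?_⟩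
    · rw [map_mul, hz1, one_mul, R.KtildeToK_lift ha]
    · change _ = R.spinPart z * R.spinPart (R.lift (R.KtildeToK a))
      rw [h, hz2, neg_one_mul]
  · refine ⟨1, fun a ha => Or.inl ((key a ha).resolve_right fun h => hz
      ⟨a * (R.lift (R.KtildeToK a))⁻¹, ?_, ?_⟩)⟩
    · rw [map_mul, map_inv, R.KtildeToK_lift ha, mul_inv_cancel]
    · have h1 : R.spinPart (R.lift (R.KtildeToK a)) *
          R.spinPart (R.lift (R.KtildeToK a))⁻¹ = 1 :=
        (Unitary.mem_iff.1 (R.spinPart_mem_unitary (R.lift (R.KtildeToK a)))).2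
      change R.spinPart a * R.spinPart (R.lift (R.KtildeToK a))⁻¹ = -1
      rw [h, neg_mul, h1]

/-- The local section shows that the image contains a neighbourhood of `1`. Surjectivity is not
established; an open subgroup of the compact group `K` has finite index, which suffices later. -/
theorem isOpen_range_KtildeToK : IsOpen (R.KtildeToK.range : Set R.K) := by
  refine Subgroup.isOpen_of_mem_nhds _ (g := 1) ?_
  filter_upwards [R.isOpen_liftNorm_pos.mem_nhds R.liftNorm_one_pos] with k hk
  exact ⟨R.lift k, R.KtildeToK_lift hk⟩

/-- The two sheets over a compact neighbourhood `N` of `1` are compact, being images of `N` under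
the local section and its translate by `z`. Finitely many translates of them cover `K̃`, because the
image of `K̃` in `K` is an open, hence closed, subgroup of a compact group. -/
instance compactSpace_Ktilde : CompactSpace R.Ktilde := by
  set N : Set R.K := {k | R.liftNorm 1 / 2 ≤ R.liftNorm k} with hN
  have hNpos : ∀ k ∈ N, 0 < R.liftNorm k := fun k hk => by
    have := R.liftNorm_one_pos
    have hk' : R.liftNorm 1 / 2 ≤ R.liftNorm k := hk
    linarith
  have hNc : IsCompact N := (isClosed_le continuous_const R.continuous_liftNorm).isCompact
  have hN1 : N ∈ 𝓝 (1 : R.K) := by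
    refine Filter.mem_of_superset ((isOpen_lt continuous_const R.continuous_liftNorm).mem_nhds
      (show R.liftNorm 1 / 2 < R.liftNorm 1 by linarith [R.liftNorm_one_pos])) fun k hk => ?_
    exact (show R.liftNorm 1 / 2 < R.liftNorm k from hk).le
  obtain ⟨z, hz⟩ := R.exists_eq_mul_lift
  have hL : IsCompact (R.lift '' N) :=
    hNc.image_of_continuousOn fun k hk => (R.continuousAt_lift (hNpos k hk)).continuousWithinAt
  have hC : IsCompact (R.lift '' N ∪ (fun a => z * a) '' (R.lift '' N)) :=
    hL.union (hL.image (continuous_const_mul z))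
  have hrange : IsCompact (R.KtildeToK.range : Set R.K) :=
    (R.KtildeToK.range.isClosed_of_isOpen R.isOpen_range_KtildeToK).isCompact
  obtain ⟨s, hs, hcov⟩ := hrange.elim_nhds_subcover (fun x => {y | x⁻¹ * y ∈ N}) fun x _ => by
    have h1 : Tendsto (fun y => x⁻¹ * y) (𝓝 x) (𝓝 1) := by
      have : Continuous fun y : R.K => x⁻¹ * y := by fun_prop
      exact this.tendsto' _ _ (by simp)
    exact h1 hN1
  choose! r hr using hs
  refine ⟨(s.isCompact_biUnion fun x _ => hC.image (continuous_const_mul (r x))).of_isClosed_subset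
    isClosed_univ fun a _ => ?_⟩
  obtain ⟨x, hx, hxa⟩ := Set.mem_iUnion₂.1 (hcov ⟨a, rfl⟩)
  refine Set.mem_iUnion₂.2 ⟨x, hx, (r x)⁻¹ * a, ?_, mul_inv_cancel_left _ _⟩
  have h1 : R.KtildeToK ((r x)⁻¹ * a) ∈ N := by
    rw [map_mul, map_inv, hr x hx]; exact hxa
  rcases hz _ (hNpos _ h1) with h | h
  · exact Or.inl ⟨_, h1, h.symm⟩
  · exact Or.inr ⟨_, ⟨_, h1, rfl⟩, h.symm⟩

theorem finite_quotient_range : Finite (R.K ⧸ R.KtildeToK.range) :=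
  Subgroup.quotient_finite_of_isOpen _ R.isOpen_range_KtildeToK

end ReductiveStructure

end

/-! ### The action of `K̃` on `X ⊗ S` and its differential -/

section

open Filter Topology

universe u v w

theorem HasWeakDerivAt.tmul {V W : Type*} [AddCommGroup V] [Module ℂ V] [AddCommGroup W]
    [Module ℂ W] [FiniteDimensional ℂ W] {f : ℝ → V} {g : ℝ → W} {f' : V} {g' : W} {t : ℝ}
    (hf : HasWeakDerivAt ℂ f f' t) (hg : HasWeakDerivAt ℂ g g' t) {x : V} {y : W} (hx : f t = x)
    (hy : g t = y) :
    HasWeakDerivAt ℂ (fun s => f s ⊗ₜ[ℂ] g s) (f' ⊗ₜ[ℂ] y + x ⊗ₜ[ℂ] g') t := by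
  have h := HasWeakDerivAt.bilin hg hf (TensorProduct.mk ℂ V W).flip
  rw [hx, hy, add_comm] at h
  exact h

theorem IsLocallyFiniteRep.tprod {H V W : Type*} [Group H] [TopologicalSpace H] [AddCommGroup V]
    [Module ℂ V] [AddCommGroup W] [Module ℂ W] [FiniteDimensional ℂ W] {ρ : Representation ℂ H V}
    (hρ : IsLocallyFiniteRep ρ) (σ : Representation ℂ H W) :
    IsLocallyFiniteRep (ρ.tprod σ) := fun y => by
  induction y with
  | zero => exact ⟨⊥, inferInstance, Submodule.zero_mem _, fun k y hy => by
      rw [(Submodule.mem_bot ℂ).1 hy, map_zero]; exact Submodule.zero_mem _⟩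
  | add a b ha hb =>
    obtain ⟨S, h1, h2, h3⟩ := ha
    obtain ⟨T, k1, k2, k3⟩ := hb
    refine ⟨S ⊔ T, inferInstance, Submodule.add_mem_sup h2 k2, fun k y hy => ?_⟩
    obtain ⟨y, hy', z, hz, rfl⟩ := Submodule.mem_sup.1 hy
    rw [map_add]
    exact Submodule.add_mem_sup (h3 k y hy') (k3 k z hz)
  | tmul x s =>
    obtain ⟨V', h1, h2, h3⟩ := hρ x
    refine ⟨LinearMap.range (V'.subtype.rTensor W), inferInstance,
      ⟨(⟨x, h2⟩ : V') ⊗ₜ[ℂ] s, rfl⟩, ?_⟩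
    rintro k _ ⟨z, rfl⟩
    induction z with
    | zero => rw [map_zero, map_zero]; exact Submodule.zero_mem _
    | add a b ha hb => rw [map_add, map_add]; exact Submodule.add_mem _ ha hb
    | tmul x s => exact ⟨(⟨_, h3 k x x.2⟩ : V') ⊗ₜ[ℂ] σ k s, rfl⟩

namespace ReductiveStructure

variable {E : Type u} [NormedAddCommGroup E] [NormedSpace ℝ E] {G : Type v}
  [TopologicalSpace G] [ChartedSpace E G] [Group G] [LieGroup 𝓘(ℝ, E) ∞ G]
  {R : ReductiveStructure E G} [FiniteDimensional ℝ E] (P : R.Polarization)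

instance : FiniteDimensional ℂ P.S := finite_exteriorAlgebra

theorem Polarization.weakContinuous_spinRep (s : P.S) :
    WeakContinuous ℂ fun a : R.Ktilde => P.spinRep a s := fun φ => by
  let L : R.Cl₀ →ₗ[ℝ] ℂ :=
    (φ.restrictScalars ℝ).comp (((LinearMap.applyₗ s).restrictScalars ℝ).comp
      ((P.spinAction.toLinearMap.restrictScalars ℝ).comp R.clToCl.toLinearMap))
  have hL : Continuous L := IsModuleTopology.continuous_of_linearMap L
  exact hL.comp R.continuous_spinPart

theorem Polarization.hasWeakDerivAt_spinRep {c : ℝ → R.Ktilde} {Z : LieAlg E G}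
    (hc : R.HasVelocity c Z) (s : P.S) : HasWeakDerivAt ℂ (fun t => P.spinRep (c t) s)
      (P.spinAction (R.clToCl (R.spinDeriv Z)) s) 0 := by
  have := R.finite_Cl₀
  let L : R.Cl₀ →ₗ[ℝ] P.S := ((LinearMap.applyₗ s).restrictScalars ℝ).comp
      ((P.spinAction.toLinearMap.restrictScalars ℝ).comp R.clToCl.toLinearMap)
  exact hc.spinPart.mapComplex L.toAddMonoidHom fun r v => (map_smul L r v).trans
    (Complex.coe_smul r (L v)).symm

/-- The tensor `∑ b_j ⊗ b_j*` does not depend on the basis. This permits computing with the Dirac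
operator in an orthonormal basis of `𝔭₀`. -/
theorem sum_dualBasis_eq_sum_orthoBasis (R : ReductiveStructure E G) {Y ι : Type*}
    [AddCommGroup Y] [Module ℝ Y] [Fintype ι] [DecidableEq ι]
    (F : R.p₀ →ₗ[ℝ] R.p₀ →ₗ[ℝ] Y) (b : Module.Basis ι ℝ R.p₀) :
    ∑ j, F (b j) (R.Bp₀.dualBasis R.Bp₀_nondegenerate b j) =
      ∑ i, F (R.orthoBasis i) (R.orthoBasis i) := by
  set b' := R.Bp₀.dualBasis R.Bp₀_nondegenerate b
  have h1 : ∀ u, ∑ j, R.Bp₀ u (b' j) • b j = u := fun u => by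
    have hc : ∀ j, R.Bp₀ u (b' j) = b.repr u j := fun j => by
      rw [R.Bp₀_comm, ← congrArg (R.Bp₀ (b' j)) (b.sum_repr u), map_sum]
      simp [b', LinearMap.BilinForm.apply_dualBasis_left]
    simp only [hc, b.sum_repr]
  calc ∑ j, F (b j) (b' j)
      = ∑ j, ∑ i, R.Bp₀ (R.orthoBasis i) (b' j) • F (b j) (R.orthoBasis i) := by
        refine Finset.sum_congr rfl fun j _ => ?_
        rw [← congrArg (F (b j)) (R.sum_Bp₀_orthoBasis (b' j)), map_sum]
        simp only [map_smul]
    _ = ∑ i, ∑ j, R.Bp₀ (R.orthoBasis i) (b' j) • F (b j) (R.orthoBasis i) := Finset.sum_comm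
    _ = _ := by
        refine Finset.sum_congr rfl fun i _ => ?_
        rw [← congrArg (fun u => F u (R.orthoBasis i)) (h1 (R.orthoBasis i))]
        rw [map_sum, LinearMap.sum_apply]
        simp only [map_smul, LinearMap.smul_apply]

theorem toG_lie [CompleteSpace E] (R : ReductiveStructure E G) (Z Z' : LieAlg E G) :
    R.toG ⁅Z, Z'⁆ = ⁅R.toG Z, R.toG Z'⁆ := by
  have h1 : ⁅(1 : ℂ) ⊗ₜ[ℝ] Z, (1 : ℂ) ⊗ₜ[ℝ] Z'⁆ = (1 : ℂ) ⊗ₜ[ℝ] ⁅Z, Z'⁆ := by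
    rw [LieAlgebra.ExtendScalars.bracket_tmul, mul_one]
  exact h1.symm

end ReductiveStructure

namespace GKModule

attribute [local instance 100] LieRing.ofAssociativeRing

variable {E : Type u} [NormedAddCommGroup E] [NormedSpace ℝ E] [CompleteSpace E]
    {G : Type v} [TopologicalSpace G] [ChartedSpace E G] [Group G] [LieGroup 𝓘(ℝ, E) ∞ G]
    {R : ReductiveStructure E G} {X : Type w} [AddCommGroup X] [Module ℂ X] (M : GKModule R X)
    (P : R.Polarization) [FiniteDimensional ℝ E]

theorem isContinuousRep_repXS : IsContinuousRep (M.repXS P) := fun y => by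
  induction y with
  | zero => intro φ; simp only [map_zero]; exact continuous_const
  | add a b ha hb => intro φ; simp only [map_add]; exact (ha φ).add (hb φ)
  | tmul x s =>
    have h1 : WeakContinuous ℂ fun a : R.Ktilde => M.π (R.KtildeToK a) x := fun φ =>
      (M.continuous_π x φ).comp R.continuous_KtildeToK
    exact (P.weakContinuous_spinRep s).bilin h1 (TensorProduct.mk ℂ X P.S).flip

theorem isLocallyFiniteRep_repXS : IsLocallyFiniteRep (M.repXS P) :=
  IsLocallyFiniteRep.tprod (ρ := (MonoidHom.comp M.π R.KtildeToK : Representation ℂ R.Ktilde X))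
    (fun x => by
      obtain ⟨V, h1, h2, h3⟩ := M.locallyFinite x
      exact ⟨V, h1, h2, fun k => h3 _⟩) P.spinRep

/-- The action of `Z ∈ 𝔤₀` on the first factor of `X ⊗ S`. -/
def actLeft : LieAlg E G →ₗ[ℝ] Module.End ℂ (X ⊗[ℂ] P.S) where
  toFun Z := (M.act (R.toG Z)).rTensor P.S
  map_add' Z Z' := by
    rw [← LinearMap.rTensor_add]
    exact congrArg (LinearMap.rTensor P.S)
      ((congrArg M.act (toComplexification_add Z Z')).trans (map_add M.act _ _))
  map_smul' r Z := by
    refine Eq.trans ?_ (Complex.coe_smul r ((M.act (R.toG Z)).rTensor P.S))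
    rw [← LinearMap.rTensor_smul]
    exact congrArg (LinearMap.rTensor P.S)
      ((congrArg M.act (toComplexification_smul r Z)).trans (map_smul M.act _ _))

/-- The action of `Cl(𝔭₀)` on the second factor of `X ⊗ S`. -/
def cliffRight (_M : GKModule R X) (P : R.Polarization) : R.Cl₀ →ₐ[ℝ] Module.End ℂ (X ⊗[ℂ] P.S) :=
  (((Module.End.lTensorAlgHom ℂ P.S X).comp P.spinAction).restrictScalars ℝ).comp R.clToCl

theorem actLeft_comm_cliffRight (Z : LieAlg E G) (a : R.Cl₀) :
    M.actLeft P Z * M.cliffRight P a = M.cliffRight P a * M.actLeft P Z :=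
  TensorProduct.ext' fun _ _ => rfl

theorem actLeft_lie (Z Z' : LieAlg E G) : M.actLeft P ⁅Z, Z'⁆ =
    M.actLeft P Z * M.actLeft P Z' - M.actLeft P Z' * M.actLeft P Z := by
  refine TensorProduct.ext' fun x s => ?_
  have h2 : M.act (R.toG ⁅Z, Z'⁆) x = M.act (R.toG Z) (M.act (R.toG Z') x) -
      M.act (R.toG Z') (M.act (R.toG Z) x) := by
    rw [R.toG_lie, LieHom.map_lie]; rfl
  refine (congrArg (fun y => y ⊗ₜ[ℂ] s) h2).trans ?_
  exact TensorProduct.sub_tmul _ _ _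

/-- The differential of the action of `K̃` on `X ⊗ S`. -/
def diagAct (Z : LieAlg E G) : Module.End ℂ (X ⊗[ℂ] P.S) :=
  M.actLeft P Z + M.cliffRight P (R.spinDeriv Z)

theorem hasWeakDerivAt_repXS_tmul {c : ℝ → R.Ktilde} {Z : LieAlg E G} (hc : R.HasVelocity c Z)
    (x : X) (s : P.S) : HasWeakDerivAt ℂ (fun t => M.repXS P (c t) (x ⊗ₜ s))
      (M.diagAct P Z (x ⊗ₜ s)) 0 := by
  have h1 : HasWeakDerivAt ℂ (fun t => M.π (R.KtildeToK (c t)) x) (M.act (R.toG Z) x) 0 :=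
    M.deriv_π _ _ hc.2.2 x
  have e1 : M.π (R.KtildeToK (c 0)) x = x := by
    rw [hc.1, map_one]; exact LinearMap.congr_fun (map_one M.π) x
  have e2 : P.spinRep (c 0) s = s := by
    rw [hc.1]; exact LinearMap.congr_fun (map_one P.spinRep) s
  exact HasWeakDerivAt.tmul h1 (P.hasWeakDerivAt_spinRep hc s) e1 e2

theorem hasWeakDerivAt_repXS {c : ℝ → R.Ktilde} {Z : LieAlg E G} (hc : R.HasVelocity c Z)
    (y : X ⊗[ℂ] P.S) :
    HasWeakDerivAt ℂ (fun t => M.repXS P (c t) y) (M.diagAct P Z y) 0 := by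
  induction y with
  | zero => simp only [map_zero]; exact hasWeakDerivAt_const 0
  | add a b ha hb => simp only [map_add]; exact ha.add hb
  | tmul x s => exact M.hasWeakDerivAt_repXS_tmul P hc x s

theorem diracOp_eq_sum_dualBasis : M.diracOp P = ∑ i,
    M.actLeft P (Module.finBasis ℝ R.p₀ i : LieAlg E G) *
    M.cliffRight P (CliffordAlgebra.ι R.Q₀
      (R.Bp₀.dualBasis R.Bp₀_nondegenerate (Module.finBasis ℝ R.p₀) i)) := by
  refine TensorProduct.ext' fun x s => (M.diracOp_tmul P x s).trans ?_
  rw [LinearMap.sum_apply]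
  refine Finset.sum_congr rfl fun i _ => ?_
  exact congrArg (fun y => M.actReal x (Module.finBasis ℝ R.p₀ i) ⊗ₜ[ℂ] y)
    (LinearMap.congr_fun (P.spinAction_clToCl_ι _) s).symm

theorem diracOp_eq : M.diracOp P = ∑ i, M.actLeft P (R.orthoBasis i : LieAlg E G) *
    M.cliffRight P (CliffordAlgebra.ι R.Q₀ (R.orthoBasis i)) :=
  (M.diracOp_eq_sum_dualBasis P).trans (R.sum_dualBasis_eq_sum_orthoBasis
    ((LinearMap.mul ℝ (Module.End ℂ (X ⊗[ℂ] P.S))).compl₁₂ ((M.actLeft P).comp R.p₀.subtype)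
      ((M.cliffRight P).toLinearMap.comp (CliffordAlgebra.ι R.Q₀))) (Module.finBasis ℝ R.p₀))

end GKModule

end

section

/-! ### Clifford contractions of curvature-like tensors -/

section Bianchi

variable {A : Type*} [Ring A] [Algebra ℝ A] {n : ℕ}

theorem sum_rotate {M : Type*} [AddCommMonoid M] (F : Fin n → Fin n → Fin n → M) :
    ∑ i, ∑ j, ∑ k, F j k i = ∑ i, ∑ j, ∑ k, F i j k := by
  rw [Finset.sum_comm]
  exact Finset.sum_congr rfl fun i _ => Finset.sum_comm

/-- Moving `c k` to the right past `c i` and `c j` changes its sign twice and leaves the two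
contraction terms. -/
theorem clifford_move {c : Fin n → A}
    (hc : ∀ i j, c i * c j + c j * c i = (if i = j then (-2 : ℝ) else 0) • (1 : A)) (i j k : Fin n) :
    c k * c i * c j = c i * c j * c k + ((if j = k then (2 : ℝ) else 0) • c i -
      (if i = k then (2 : ℝ) else 0) • c j) := by
  have e : c k * c i * c j = c i * c j * c k - c i * (c j * c k + c k * c j) +
      (c i * c k + c k * c i) * c j := by noncomm_ring
  rw [e, hc, hc, mul_smul_comm, smul_mul_assoc, mul_one, one_mul]
  split_ifs <;> module

/-- The Clifford contraction of a cubic expression satisfying the Bianchi identity. -/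
theorem sum_clifford_cubic {c : Fin n → A}
    (hc : ∀ i j, c i * c j + c j * c i = (if i = j then (-2 : ℝ) else 0) • (1 : A))
    {T : Fin n → Fin n → Fin n → ℝ} (h1 : ∀ i j k, T i j k = -T j i k)
    (h2 : ∀ i j k, T i j k + T j k i + T k i j = 0) :
    ∑ i, ∑ j, ∑ k, T i j k • (c i * c j * c k) = (2 : ℝ) • ∑ j, (∑ i, T i j i) • c j := by
  set t := ∑ i, ∑ j, ∑ k, T i j k • (c i * c j * c k) with ht
  set r := ∑ j, (∑ i, T i j i) • c j with hr
  -- The three cyclic rotations of the monomials add up to zero by the Bianchi identity. Reordering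
  -- the two rotated sums gives `t - 4 r` and `t - 2 r`, so `3 t = 6 r`.
  have e1 : t + ∑ i, ∑ j, ∑ k, T i j k • (c k * c i * c j) +
      ∑ i, ∑ j, ∑ k, T i j k • (c j * c k * c i) = 0 := by
    have a1 : ∑ i, ∑ j, ∑ k, T i j k • (c k * c i * c j) =
        ∑ i, ∑ j, ∑ k, T j k i • (c i * c j * c k) :=
      (sum_rotate fun i j k => T i j k • (c k * c i * c j)).symm
    have a2 : ∑ i, ∑ j, ∑ k, T i j k • (c j * c k * c i) =
        ∑ i, ∑ j, ∑ k, T k i j • (c i * c j * c k) :=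
      sum_rotate fun i j k => T k i j • (c i * c j * c k)
    rw [a1, a2, ht]
    simp only [← Finset.sum_add_distrib, ← add_smul, h2, zero_smul, Finset.sum_const_zero]
  have er : ∑ i, ∑ j, ∑ k, T i j k • ((if i = k then (2 : ℝ) else 0) • c j) = (2 : ℝ) • r := by
    rw [Finset.sum_comm, hr, Finset.smul_sum]
    refine Finset.sum_congr rfl fun j _ => ?_
    rw [Finset.sum_smul, Finset.smul_sum]
    refine Finset.sum_congr rfl fun i _ => ?_
    rw [Finset.sum_eq_single i]
    · rw [if_pos rfl, smul_comm]
    · intro k _ hk; rw [if_neg (Ne.symm hk), zero_smul, smul_zero]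
    · simp
  have er' : ∑ i, ∑ j, ∑ k, T i j k • ((if j = k then (2 : ℝ) else 0) • c i) = -(2 : ℝ) • r := by
    have : ∀ i j k, T i j k • ((if j = k then (2 : ℝ) else 0) • c i) =
        -(T j i k • ((if j = k then (2 : ℝ) else 0) • c i)) := fun i j k => by
      rw [h1 i j k, neg_smul]
    simp only [this, Finset.sum_neg_distrib]
    rw [Finset.sum_comm, er, neg_smul]
  have e2 : ∑ i, ∑ j, ∑ k, T i j k • (c k * c i * c j) = t - (4 : ℝ) • r := by
    rw [Finset.sum_congr rfl fun i _ => Finset.sum_congr rfl fun j _ =>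
      Finset.sum_congr rfl fun k _ => congrArg (T i j k • ·) (clifford_move hc i j k)]
    simp only [smul_add, smul_sub, Finset.sum_add_distrib, Finset.sum_sub_distrib]
    rw [er, er']
    module
  have e3 : ∑ i, ∑ j, ∑ k, T i j k • (c j * c k * c i) = t - (2 : ℝ) • r := by
    have a1 : ∀ i j k, T i j k • (c j * c k * c i) = T i j k • (c i * c j * c k) -
        T i j k • ((if i = k then (2 : ℝ) else 0) • c j) := fun i j k => by
      have := clifford_move hc j k i
      have e : c j * c k * c i = c i * c j * c k - ((if k = i then (2 : ℝ) else 0) • c j -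
        (if j = i then (2 : ℝ) else 0) • c k) := by rw [this]; abel
      rw [e, smul_sub, smul_sub]
      have e0 : T i j k • ((if j = i then (2 : ℝ) else 0) • c k) = 0 := by
        split_ifs with h
        · subst h
          have : T j j k = 0 := by have := h1 j j k; linarith
          rw [this, zero_smul]
        · rw [zero_smul, smul_zero]
      rw [e0, sub_zero]
      congr 3
      by_cases h : i = k
      · rw [if_pos h, if_pos h.symm]
      · rw [if_neg h, if_neg (Ne.symm h)]
    rw [Finset.sum_congr rfl fun i _ => Finset.sum_congr rfl fun j _ =>
      Finset.sum_congr rfl fun k _ => a1 i j k]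
    simp only [Finset.sum_sub_distrib]
    rw [er]
  rw [e2, e3] at e1
  have e4 : (3 : ℝ) • t = (6 : ℝ) • r := by
    rw [← sub_eq_zero, ← e1]; module
  have e5 := congrArg (fun x => (3⁻¹ : ℝ) • x) e4
  simp only [smul_smul] at e5
  norm_num at e5
  exact e5

/-- The Clifford contraction of a curvature-like tensor is a scalar. -/
theorem sum_clifford_quartic {c : Fin n → A}
    (hc : ∀ i j, c i * c j + c j * c i = (if i = j then (-2 : ℝ) else 0) • (1 : A))
    {T : Fin n → Fin n → Fin n → Fin n → ℝ} (h1 : ∀ i j k l, T i j k l = -T j i k l)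
    (h2 : ∀ i j k l, T i j k l + T j k i l + T k i j l = 0)
    (h3 : ∀ j l, ∑ i, T i j i l = ∑ i, T i l i j) :
    ∃ r : ℝ, ∑ i, ∑ j, ∑ k, ∑ l, T i j k l • (c i * c j * (c k * c l)) = algebraMap ℝ A r := by
  set ρ : Fin n → Fin n → ℝ := fun j l => ∑ i, T i j i l with hρ
  -- The cubic lemma, applied for each fixed last index, leaves only the Ricci contraction `ρ`.
  have e1 : ∑ i, ∑ j, ∑ k, ∑ l, T i j k l • (c i * c j * (c k * c l)) =
      (2 : ℝ) • ∑ l, ∑ j, ρ j l • (c j * c l) := by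
    calc ∑ i, ∑ j, ∑ k, ∑ l, T i j k l • (c i * c j * (c k * c l))
        = ∑ l, (∑ i, ∑ j, ∑ k, T i j k l • (c i * c j * c k)) * c l := by
          simp only [Finset.sum_mul, smul_mul_assoc, mul_assoc]
          symm
          rw [Finset.sum_comm]
          refine Finset.sum_congr rfl fun i _ => ?_
          rw [Finset.sum_comm]
          refine Finset.sum_congr rfl fun j _ => ?_
          rw [Finset.sum_comm]
      _ = _ := by
          rw [Finset.smul_sum]
          refine Finset.sum_congr rfl fun l _ => ?_
          rw [sum_clifford_cubic hc (fun i j k => h1 i j k l) (fun i j k => h2 i j k l),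
            smul_mul_assoc, Finset.sum_mul]
          simp only [smul_mul_assoc, hρ]
  -- As `ρ` is symmetric, the factor `2` symmetrizes the product into an anticommutator, which is a
  -- scalar.
  have e2 : (2 : ℝ) • ∑ l, ∑ j, ρ j l • (c j * c l) = ∑ l, ∑ j, ρ j l • (c j * c l + c l * c j) := by
    simp only [smul_add, Finset.sum_add_distrib]
    rw [two_smul]
    congr 1
    rw [Finset.sum_comm]
    refine Finset.sum_congr rfl fun l _ => Finset.sum_congr rfl fun j _ => ?_
    rw [hρ]
    beta_reduce
    rw [h3]
  refine ⟨∑ l, ∑ j, ρ j l * (if j = l then (-2 : ℝ) else 0), ?_⟩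
  rw [e1, e2, Algebra.algebraMap_eq_smul_one]
  simp only [hc, smul_smul, Finset.sum_smul]

end Bianchi

/-! ### Parthasarathy's formula for the square of the Dirac operator -/

namespace ReductiveStructure

open Filter Topology

universe u v

variable {E : Type u} [NormedAddCommGroup E] [NormedSpace ℝ E] {G : Type v}
  [TopologicalSpace G] [ChartedSpace E G] [Group G] [LieGroup 𝓘(ℝ, E) ∞ G]
  (R : ReductiveStructure E G) [FiniteDimensional ℝ E]

/-- The Lie algebra `𝔨₀` of `K`. -/
def k₀ : Submodule ℝ (LieAlg E G) := LinearMap.ker (diffAtOne R.θ - LinearMap.id)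

theorem mem_k₀ {Z : LieAlg E G} : Z ∈ R.k₀ ↔ diffAtOne R.θ Z = Z := by
  rw [k₀, LinearMap.mem_ker, LinearMap.sub_apply, LinearMap.id_apply, sub_eq_zero]

theorem mem_p₀ {Z : LieAlg E G} : Z ∈ R.p₀ ↔ diffAtOne R.θ Z = -Z := Iff.rfl

theorem B_k₀_p₀ {Z Y : LieAlg E G} (hZ : Z ∈ R.k₀) (hY : Y ∈ R.p₀) : R.B Z Y = 0 := by
  have h := R.B_θ Z Y
  rw [R.mem_k₀.1 hZ, R.mem_p₀.1 hY, map_neg] at h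
  linarith

theorem lie_mem_k₀ {v w : LieAlg E G} (hv : v ∈ R.p₀) (hw : w ∈ R.p₀) : ⁅v, w⁆ ∈ R.k₀ := by
  rw [mem_k₀, dθ_lie, R.mem_p₀.1 hv, R.mem_p₀.1 hw, neg_lie, lie_neg, neg_neg]

theorem exists_orthonormal_k₀ : ∃ b : Module.Basis (Fin (Module.finrank ℝ R.k₀)) ℝ R.k₀,
    ∀ i j, R.B (b i : LieAlg E G) (b j) = if i = j then -1 else 0 := by
  obtain ⟨b, hb⟩ := exists_orthonormal_basis (B := -(R.B.restrict R.k₀))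
    (fun v w => by
      simp only [LinearMap.neg_apply, LinearMap.BilinForm.restrict_apply, LinearMap.domRestrict_apply,
        R.B_symm (v : LieAlg E G)])
    (fun v hv => by
      have := R.B_neg v (R.mem_k₀.1 v.2) fun h => hv (Subtype.ext h)
      simpa using this)
  refine ⟨b, fun i j => ?_⟩
  have h := hb i j
  have h' : -R.B (b i : LieAlg E G) (b j) = if i = j then 1 else 0 := h
  rw [← neg_neg (R.B (b i : LieAlg E G) (b j)), h']
  split_ifs <;> simp

/-- A basis of `𝔨₀` that is orthonormal for `-B`. -/
def kBasis : Module.Basis (Fin (Module.finrank ℝ R.k₀)) ℝ R.k₀ := R.exists_orthonormal_k₀.choose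

theorem B_kBasis (i j) : R.B (R.kBasis i : LieAlg E G) (R.kBasis j) = if i = j then -1 else 0 :=
  R.exists_orthonormal_k₀.choose_spec i j

/-- The minus sign reflects that the basis is orthonormal for `-B`; the dual basis for `B` is its
negative. -/
theorem eq_sum_kBasis {Z : LieAlg E G} (hZ : Z ∈ R.k₀) :
    Z = -∑ b, R.B (R.kBasis b) Z • (R.kBasis b : LieAlg E G) := by
  have h : ∀ b, R.B (R.kBasis b) Z = -R.kBasis.repr ⟨Z, hZ⟩ b := fun b => by
    have h1 : Z = ∑ j, R.kBasis.repr ⟨Z, hZ⟩ j • (R.kBasis j : LieAlg E G) := by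
      have := congrArg Subtype.val (R.kBasis.sum_repr ⟨Z, hZ⟩)
      simp only [Submodule.coe_sum, Submodule.coe_smul] at this
      exact this.symm
    rw [congrArg (R.B (R.kBasis b)) h1, map_sum]
    simp only [map_smul, B_kBasis, smul_eq_mul, mul_ite, mul_neg, mul_one, mul_zero,
      Finset.sum_ite_eq, Finset.mem_univ, if_true]
  simp only [h, neg_smul, Finset.sum_neg_distrib, neg_neg]
  have := congrArg Subtype.val (R.kBasis.sum_repr ⟨Z, hZ⟩)
  simp only [Submodule.coe_sum, Submodule.coe_smul] at this
  exact this.symm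

/-- The components of `Z` in `𝔨₀` and `𝔭₀` are `(Z ± dθ Z)/2`, orthogonal for `B`. In this expansion
`B` has signs `+1` on `𝔭₀` and `-1` on `𝔨₀`, the signs of the Casimir element. -/
theorem eq_sum_basis (Z : LieAlg E G) :
    Z = ∑ i, R.B (R.orthoBasis i) Z • (R.orthoBasis i : LieAlg E G) -
      ∑ b, R.B (R.kBasis b) Z • (R.kBasis b : LieAlg E G) := by
  have hinv : diffAtOne R.θ (diffAtOne R.θ Z) = Z := by
    have hθ : MDifferentiableAt 𝓘(ℝ, E) 𝓘(ℝ, E) R.θ 1 := R.contMDiff_θ.mdifferentiableAt (by simp)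
    rw [← diffAtOne_comp hθ hθ (map_one _)]
    simp only [R.θ_θ]
    exact congrArg (fun L => (L Z : E)) (mfderiv_id (I := 𝓘(ℝ, E)) (x := (1 : G)))
  set Zk := (2⁻¹ : ℝ) • (Z + diffAtOne R.θ Z) with hk
  set Zp := (2⁻¹ : ℝ) • (Z - diffAtOne R.θ Z) with hp
  have hZ : Z = Zp + Zk := by rw [hk, hp]; module
  have hkm : Zk ∈ R.k₀ := by rw [mem_k₀, hk, map_smul, map_add, hinv, add_comm]
  have hpm : Zp ∈ R.p₀ := by rw [mem_p₀, hp, map_smul, map_sub, hinv, ← smul_neg, neg_sub]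
  have h1 : ∀ i, R.B (R.orthoBasis i) Z = R.Bp₀ (R.orthoBasis i) ⟨Zp, hpm⟩ := fun i => by
    rw [hZ, map_add, R.B_symm _ Zk, R.B_k₀_p₀ hkm (R.orthoBasis i).2, add_zero]; rfl
  have h2 : ∀ b, R.B (R.kBasis b) Z = R.B (R.kBasis b) Zk := fun b => by
    rw [hZ, map_add, R.B_k₀_p₀ (R.kBasis b).2 hpm, zero_add]
  have h3 := congrArg Subtype.val (R.sum_Bp₀_orthoBasis ⟨Zp, hpm⟩)
  simp only [Submodule.coe_sum, Submodule.coe_smul] at h3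
  simp only [h1, h2]
  rw [h3, sub_eq_add_neg, ← R.eq_sum_kBasis hkm]
  exact hZ

theorem B_lie_kBasis (b i j) : R.B ⁅(R.kBasis b : LieAlg E G), (R.orthoBasis i : LieAlg E G)⁆
    (R.orthoBasis j) = R.B (R.kBasis b) ⁅(R.orthoBasis i : LieAlg E G), R.orthoBasis j⁆ :=
  R.B_lie _ _ _

theorem sum_B_kBasis {Z Z' : LieAlg E G} (hZ : Z ∈ R.k₀) :
    ∑ b, R.B (R.kBasis b) Z * R.B (R.kBasis b) Z' = -R.B Z Z' := by
  conv_rhs => rw [R.eq_sum_kBasis hZ]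
  simp only [map_neg, map_sum, LinearMap.neg_apply, LinearMap.sum_apply, map_smul,
    LinearMap.smul_apply, smul_eq_mul, neg_neg]

theorem ι_orthoBasis_anticomm (i j) :
    CliffordAlgebra.ι R.Q₀ (R.orthoBasis i) * CliffordAlgebra.ι R.Q₀ (R.orthoBasis j) +
      CliffordAlgebra.ι R.Q₀ (R.orthoBasis j) * CliffordAlgebra.ι R.Q₀ (R.orthoBasis i) =
    (if i = j then (-2 : ℝ) else 0) • (1 : R.Cl₀) := by
  rw [clifford_relation R.Q₀_apply R.Bp₀_comm, Bp₀_orthoBasis, Algebra.algebraMap_eq_smul_one]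
  split_ifs <;> simp

/-- The image of the Casimir element of `𝔨₀` in the Clifford algebra is a scalar. -/
theorem exists_sum_spinDeriv_sq :
    ∃ r : ℝ, ∑ b, R.spinDeriv (R.kBasis b) * R.spinDeriv (R.kBasis b) =
      algebraMap ℝ R.Cl₀ r := by
  set e : Fin (Module.finrank ℝ R.p₀) → LieAlg E G := fun i => R.orthoBasis i with he
  have hem : ∀ i, e i ∈ R.p₀ := fun i => (R.orthoBasis i).2
  -- Up to convention this is the curvature tensor of `G/K`; the Bianchi identity comes from the
  -- Jacobi identity and the invariance of `B`.
  let T : Fin _ → Fin _ → Fin _ → Fin _ → ℝ := fun i j k l => -R.B ⁅e i, e j⁆ ⁅e k, e l⁆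
  obtain ⟨r, hr⟩ := sum_clifford_quartic (T := T) R.ι_orthoBasis_anticomm
    (fun i j k l => by
      simp only [T]
      rw [← lie_skew (e i) (e j), map_neg, LinearMap.neg_apply])
    (fun i j k l => by
      have h : ∀ i j k, T i j k l = -R.B ⁅⁅e i, e j⁆, e k⁆ (e l) := fun i j k => by
        simp only [T, R.B_lie]
      rw [h, h, h, ← neg_add, ← neg_add, neg_eq_zero, ← LinearMap.add_apply, ← LinearMap.add_apply,
        ← map_add, ← map_add]
      have := lie_jacobi (e i) (e j) (e k)
      have h0 : ⁅⁅e i, e j⁆, e k⁆ + ⁅⁅e j, e k⁆, e i⁆ + ⁅⁅e k, e i⁆, e j⁆ = 0 := by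
        rw [← lie_skew ⁅e i, e j⁆ (e k), ← lie_skew ⁅e j, e k⁆ (e i), ← lie_skew ⁅e k, e i⁆ (e j),
          ← neg_add, ← neg_add, neg_eq_zero, ← this]
        abel
      rw [h0, map_zero, LinearMap.zero_apply])
    (fun j l => Finset.sum_congr rfl fun i _ => by simp only [T, R.B_symm ⁅e i, e j⁆])
  refine ⟨16⁻¹ * r, ?_⟩
  rw [map_mul, ← hr, Algebra.algebraMap_eq_smul_one, smul_mul_assoc, one_mul]
  -- Parseval's identity in `𝔨₀`, which contains `[𝔭₀, 𝔭₀]`, recognizes the sum of squares as the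
  -- Clifford contraction of `T`; the constant `1/16` is the square of the `1/4` in `spinDeriv`.
  have h1 : ∀ i j k l, T i j k l = ∑ b, R.B (R.kBasis b) ⁅e i, e j⁆ * R.B (R.kBasis b) ⁅e k, e l⁆ :=
    fun i j k l => (R.sum_B_kBasis (R.lie_mem_k₀ (hem i) (hem j))).symm
  simp only [spinDeriv, B_lie_kBasis, smul_mul_smul_comm, h1, Finset.sum_mul_sum, Finset.sum_smul]
  rw [← Finset.smul_sum]
  congr 1
  · norm_num
  · rw [Finset.sum_comm]
    refine Finset.sum_congr rfl fun i _ => ?_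
    simp only [Finset.sum_comm (s := (Finset.univ : Finset (Fin (Module.finrank ℝ R.k₀))))]
    rw [Finset.sum_comm]

variable {A : Type*} [Ring A] [Algebra ℝ A] (a : LieAlg E G →ₗ[ℝ] A) (s : R.Cl₀ →ₐ[ℝ] A)

/-- The square of the Dirac operator. -/
theorem exists_dirac_sq (hs : ∀ Z x, a Z * s x = s x * a Z)
    (hl : ∀ Z Z', a ⁅Z, Z'⁆ = a Z * a Z' - a Z' * a Z) : ∃ r : ℝ,
    (∑ i, a (R.orthoBasis i) * s (CliffordAlgebra.ι R.Q₀ (R.orthoBasis i))) *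
      (∑ i, a (R.orthoBasis i) * s (CliffordAlgebra.ι R.Q₀ (R.orthoBasis i))) =
    algebraMap ℝ A r -
      (∑ i, a (R.orthoBasis i) * a (R.orthoBasis i) - ∑ b, a (R.kBasis b) * a (R.kBasis b)) -
      ∑ b, (a (R.kBasis b) + s (R.spinDeriv (R.kBasis b))) *
        (a (R.kBasis b) + s (R.spinDeriv (R.kBasis b))) := by
  obtain ⟨r, hr⟩ := R.exists_sum_spinDeriv_sq
  refine ⟨r, ?_⟩
  set e : Fin (Module.finrank ℝ R.p₀) → LieAlg E G := fun i => R.orthoBasis i with he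
  set c : Fin (Module.finrank ℝ R.p₀) → A :=
    fun i => s (CliffordAlgebra.ι R.Q₀ (R.orthoBasis i)) with hc
  have hem : ∀ i, e i ∈ R.p₀ := fun i => (R.orthoBasis i).2
  have hcc : ∀ i j, c i * c j + c j * c i = (if i = j then (-2 : ℝ) else 0) • (1 : A) := fun i j => by
    rw [hc]; beta_reduce
    have := congrArg s (R.ι_orthoBasis_anticomm i j)
    simpa only [map_add, map_mul, map_smul, map_one] using this
  have hac : ∀ i j, a (e i) * c j = c j * a (e i) := fun i j => hs _ _
  change (∑ i, a (e i) * c i) * (∑ i, a (e i) * c i) = _ - (∑ i, a (e i) * a (e i) - _) - _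
  have hD : (∑ i, a (e i) * c i) * (∑ i, a (e i) * c i) =
      ∑ i, ∑ j, a (e i) * a (e j) * (c i * c j) := by
    rw [Finset.sum_mul_sum]
    refine Finset.sum_congr rfl fun i _ => Finset.sum_congr rfl fun j _ => ?_
    rw [mul_assoc, ← mul_assoc (c i), ← hac, mul_assoc, ← mul_assoc, mul_assoc]
  -- Adding the double sum for `D²` to itself with `i` and `j` exchanged turns the Clifford relation
  -- into commutators `a [e_i, e_j]` plus diagonal terms.
  have h2 : (2 : ℝ) • ((∑ i, a (e i) * c i) * (∑ i, a (e i) * c i)) =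
      ∑ i, ∑ j, a ⁅e i, e j⁆ * (c i * c j) - (2 : ℝ) • ∑ i, a (e i) * a (e i) := by
    have h3 : ∀ i j, a (e i) * a (e j) * (c i * c j) + a (e j) * a (e i) * (c j * c i) =
        a ⁅e i, e j⁆ * (c i * c j) +
          (if i = j then (-2 : ℝ) else 0) • (a (e j) * a (e i)) := fun i j => by
      have h4 : c j * c i = (if i = j then (-2 : ℝ) else 0) • (1 : A) - c i * c j := by
        rw [← hcc i j]; abel
      rw [h4, hl, mul_sub, mul_smul_comm, mul_one, sub_mul]
      abel
    rw [two_smul, hD]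
    nth_rewrite 2 [Finset.sum_comm]
    simp only [← Finset.sum_add_distrib, h3]
    simp only [Finset.sum_add_distrib, ite_smul, zero_smul, Finset.sum_ite_eq, Finset.mem_univ,
      if_true]
    rw [← Finset.smul_sum, neg_smul, ← sub_eq_add_neg]
  -- The brackets lie in `𝔨₀`; expanding them in its basis collects the Clifford elements into
  -- `spinDeriv`. These mixed terms are then absorbed by completing the square in the diagonal
  -- action of `𝔨₀`.
  have h5 : ∑ i, ∑ j, a ⁅e i, e j⁆ * (c i * c j) =
      -((4 : ℝ) • ∑ b, a (R.kBasis b) * s (R.spinDeriv (R.kBasis b))) := by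
    have h6 : ∀ i j, a ⁅e i, e j⁆ = -∑ b, R.B (R.kBasis b) ⁅e i, e j⁆ • a (R.kBasis b) := fun i j => by
      conv_lhs => rw [R.eq_sum_kBasis (R.lie_mem_k₀ (hem i) (hem j))]
      rw [map_neg, map_sum]
      simp only [map_smul]
    have h7 : ∀ b, (4 : ℝ) • (a (R.kBasis b) * s (R.spinDeriv (R.kBasis b))) =
        ∑ i, ∑ j, R.B (R.kBasis b) ⁅e i, e j⁆ • (a (R.kBasis b) * (c i * c j)) := fun b => by
      simp only [spinDeriv, B_lie_kBasis, map_smul, map_sum, map_mul, mul_smul_comm, smul_smul,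
        Finset.mul_sum]
      norm_num
      rfl
    simp only [h6, neg_mul, Finset.sum_mul, smul_mul_assoc, Finset.sum_neg_distrib, Finset.smul_sum,
      h7]
    congr 1
    symm
    rw [Finset.sum_comm]
    refine Finset.sum_congr rfl fun i _ => ?_
    rw [Finset.sum_comm]
  have h8 : ∑ b, s (R.spinDeriv (R.kBasis b)) * s (R.spinDeriv (R.kBasis b)) =
      algebraMap ℝ A r := by
    have := congrArg s hr
    simpa only [map_sum, map_mul, AlgHom.commutes] using this
  have h9 : ∑ b, (a (R.kBasis b) + s (R.spinDeriv (R.kBasis b))) *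
        (a (R.kBasis b) + s (R.spinDeriv (R.kBasis b))) =
      ∑ b, a (R.kBasis b) * a (R.kBasis b) +
        (2 : ℝ) • ∑ b, a (R.kBasis b) * s (R.spinDeriv (R.kBasis b)) + algebraMap ℝ A r := by
    rw [← h8, Finset.smul_sum, ← Finset.sum_add_distrib, ← Finset.sum_add_distrib]
    refine Finset.sum_congr rfl fun b _ => ?_
    rw [add_mul, mul_add, mul_add, ← hs, two_smul]
    abel
  have h10 := congrArg (fun x => (2⁻¹ : ℝ) • x) h2
  simp only [smul_smul, h5] at h10
  norm_num at h10
  rw [h10, h9]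
  module

end ReductiveStructure

end

/-! ### The Casimir element and the infinitesimal character -/

section

attribute [local instance 100] LieRing.ofAssociativeRing

/-- The Casimir element of an invariant form commutes with the Lie algebra. -/
theorem mul_sum_sq_comm {ι L A : Type*} [Fintype ι] [LieRing L] [LieAlgebra ℝ L] [Ring A] [Algebra ℝ A]
    {B : LinearMap.BilinForm ℝ L} (hs : ∀ x y, B x y = B y x)
    (hB : ∀ x y z, B ⁅x, y⁆ z = B x ⁅y, z⁆) {f : ι → L} {ε : ι → ℝ}
    (hf : ∀ z, z = ∑ k, (ε k * B (f k) z) • f k) (a : L →ₗ[ℝ] A)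
    (ha : ∀ x y, a ⁅x, y⁆ = a x * a y - a y * a x) (z : L) :
    a z * (∑ k, ε k • (a (f k) * a (f k))) = (∑ k, ε k • (a (f k) * a (f k))) * a z := by
  rw [← sub_eq_zero]
  have h1 : ∀ k, a ⁅z, f k⁆ = ∑ l, (ε l * B (f l) ⁅z, f k⁆) • a (f l) := fun k => by
    conv_lhs => rw [hf ⁅z, f k⁆, map_sum]
    simp only [map_smul]
  -- Invariance of `B` makes the structure constants skew, so the two double sums below cancel after
  -- exchanging the indices.
  have h2 : ∀ k l, B (f l) ⁅z, f k⁆ = -B (f k) ⁅z, f l⁆ := fun k l => by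
    rw [← hB, ← lie_skew, map_neg, LinearMap.neg_apply, hs]
  have h3 : a z * (∑ k, ε k • (a (f k) * a (f k))) - (∑ k, ε k • (a (f k) * a (f k))) * a z =
      ∑ k, ε k • (a ⁅z, f k⁆ * a (f k)) + ∑ k, ε k • (a (f k) * a ⁅z, f k⁆) := by
    rw [Finset.mul_sum, Finset.sum_mul, ← Finset.sum_sub_distrib, ← Finset.sum_add_distrib]
    refine Finset.sum_congr rfl fun k _ => ?_
    rw [ha, mul_smul_comm, smul_mul_assoc, ← smul_sub, ← smul_add]
    congr 1
    noncomm_ring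
  rw [h3]
  simp only [h1, Finset.sum_mul, Finset.mul_sum, Finset.smul_sum, smul_mul_assoc, mul_smul_comm,
    smul_smul]
  nth_rewrite 2 [Finset.sum_comm]
  rw [← Finset.sum_add_distrib]
  refine Finset.sum_eq_zero fun k _ => ?_
  rw [← Finset.sum_add_distrib]
  refine Finset.sum_eq_zero fun l _ => ?_
  rw [h2 k l, ← add_smul]
  have : ε k * (ε l * -B (f k) ⁅z, f l⁆) + ε l * (ε k * B (f k) ⁅z, f l⁆) = 0 := by ring
  rw [this, zero_smul]

/-- The centralizer of `c` is a subalgebra containing the generators. By the universal property the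
identity factors through it, so it is everything. -/
theorem mem_center_universalEnvelopingAlgebra {L : Type*} [LieRing L] [LieAlgebra ℂ L]
    {c : UniversalEnvelopingAlgebra ℂ L}
    (hc : ∀ x, c * UniversalEnvelopingAlgebra.ι ℂ x = UniversalEnvelopingAlgebra.ι ℂ x * c) :
    c ∈ Subalgebra.center ℂ (UniversalEnvelopingAlgebra ℂ L) := by
  let C := Subalgebra.centralizer ℂ ({c} : Set (UniversalEnvelopingAlgebra ℂ L))
  have hm : ∀ x, UniversalEnvelopingAlgebra.ι ℂ x ∈ C := fun x => by
    rw [Subalgebra.mem_centralizer_iff]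
    rintro _ rfl
    exact hc x
  let j : L →ₗ⁅ℂ⁆ C :=
    { toFun := fun x => ⟨UniversalEnvelopingAlgebra.ι ℂ x, hm x⟩
      map_add' := fun x y => Subtype.ext (map_add _ x y)
      map_smul' := fun r x => Subtype.ext (map_smul _ r x)
      map_lie' := fun {x y} => Subtype.ext (LieHom.map_lie _ x y) }
  have h : C.val.comp (UniversalEnvelopingAlgebra.lift ℂ j) = AlgHom.id ℂ _ :=
    UniversalEnvelopingAlgebra.hom_ext ℂ (LieHom.ext fun x => by
      change C.val (UniversalEnvelopingAlgebra.lift ℂ j (UniversalEnvelopingAlgebra.ι ℂ x)) = _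
      rw [UniversalEnvelopingAlgebra.lift_ι_apply]
      rfl)
  rw [Subalgebra.mem_center_iff]
  intro b
  have hb : b ∈ C := by
    have := AlgHom.congr_fun h b
    rw [← show C.val.comp (UniversalEnvelopingAlgebra.lift ℂ j) b = b from this]
    exact (UniversalEnvelopingAlgebra.lift ℂ j b).2
  exact ((Subalgebra.mem_centralizer_iff ℂ).1 hb c rfl).symm

theorem sum_sq_rTensor {ι κ X : Type*} [Fintype ι] [Fintype κ] [AddCommGroup X] [Module ℂ X]
    (S : Type*) [AddCommGroup S] [Module ℂ S] {a : ι → Module.End ℂ X} {b : κ → Module.End ℂ X}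
    {c : ℂ} (h : ∀ x, (∑ i, a i * a i - ∑ j, b j * b j) x = c • x) :
    ∑ i, (a i).rTensor S * (a i).rTensor S - ∑ j, (b j).rTensor S * (b j).rTensor S =
      algebraMap ℂ (Module.End ℂ (X ⊗[ℂ] S)) c := by
  refine TensorProduct.ext' fun x s => ?_
  have h1 := congrArg (fun y => y ⊗ₜ[ℂ] s) (h x)
  simp only [LinearMap.sub_apply, LinearMap.sum_apply, TensorProduct.sub_tmul,
    TensorProduct.sum_tmul, ← TensorProduct.smul_tmul'] at h1
  simp only [LinearMap.sub_apply, LinearMap.sum_apply]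
  exact h1

theorem algebraMap_sub_eq {V : Type*} [AddCommGroup V] [Module ℂ V] (r : ℝ) {c : ℂ}
    {T : Module.End ℂ V} (hT : T = algebraMap ℂ _ c) :
    algebraMap ℝ (Module.End ℂ V) r - T = algebraMap ℂ (Module.End ℂ V) (r - c) := by
  rw [hT, map_sub]
  rfl

namespace ReductiveStructure

universe u v

variable {E : Type u} [NormedAddCommGroup E] [NormedSpace ℝ E] [CompleteSpace E]
    {G : Type v} [TopologicalSpace G] [ChartedSpace E G] [Group G] [LieGroup 𝓘(ℝ, E) ∞ G]
    (R : ReductiveStructure E G) [FiniteDimensional ℝ E]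

/-- The inclusion of `𝔤₀` in `U(𝔤)`. -/
def toU :
    LieAlg E G →ₗ[ℝ] R.U where
  toFun Z := UniversalEnvelopingAlgebra.ι ℂ (R.toG Z)
  map_add' Z Z' := (congrArg _ (toComplexification_add Z Z')).trans (map_add _ _ _)
  map_smul' r Z := (congrArg _ (toComplexification_smul r Z)).trans ((map_smul _ _ _).trans
    (Complex.coe_smul r _))

/-- The Casimir element of `U(𝔤)`. -/
def casimir : R.U :=
  ∑ i, R.toU (R.orthoBasis i) * R.toU (R.orthoBasis i) -
    ∑ b, R.toU (R.kBasis b) * R.toU (R.kBasis b)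

theorem casimir_mem_center :
    R.casimir ∈ Subalgebra.center ℂ R.U := by
  have h1 : ∀ Z, R.casimir * R.toU Z = R.toU Z * R.casimir := fun Z => by
    have key := mul_sum_sq_comm R.B_symm R.B_lie
      (f := Sum.elim (fun i => (R.orthoBasis i : LieAlg E G)) fun b => R.kBasis b)
      (ε := Sum.elim (fun _ => 1) fun _ => -1) (fun z => by
        rw [Fintype.sum_sum_type]
        simp only [Sum.elim_inl, Sum.elim_inr, one_mul, neg_one_mul, neg_smul,
          Finset.sum_neg_distrib, ← sub_eq_add_neg]
        exact R.eq_sum_basis z) R.toU (fun x y => by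
        refine (congrArg (UniversalEnvelopingAlgebra.ι ℂ) (R.toG_lie x y)).trans ?_
        rw [LieHom.map_lie]; rfl) Z
    simp only [Fintype.sum_sum_type, Sum.elim_inl, Sum.elim_inr, one_smul, neg_smul,
          Finset.sum_neg_distrib, ← sub_eq_add_neg] at key
    exact key.symm
  refine mem_center_universalEnvelopingAlgebra fun x => ?_
  change ℂ ⊗[ℝ] LieAlg E G at x
  induction x with
  | zero => 
    change _ * UniversalEnvelopingAlgebra.ι ℂ (0 : R.𝔤) = UniversalEnvelopingAlgebra.ι ℂ (0 : R.𝔤) * _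
    rw [map_zero, mul_zero, zero_mul]
  | add a b ha hb =>
    have e := map_add (UniversalEnvelopingAlgebra.ι ℂ (L := R.𝔤)) a b
    exact (congrArg (R.casimir * ·) e).trans ((mul_add _ _ _).trans
      ((congrArg₂ (· + ·) ha hb).trans ((add_mul _ _ _).symm.trans (congrArg (· * R.casimir) e).symm)))
  | tmul z Z =>
    have e : UniversalEnvelopingAlgebra.ι ℂ (z ⊗ₜ[ℝ] Z : R.𝔤) = z • R.toU Z := by
      have : (z ⊗ₜ[ℝ] Z : ℂ ⊗[ℝ] LieAlg E G) = z • ((1 : ℂ) ⊗ₜ[ℝ] Z) := by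
        rw [TensorProduct.smul_tmul', smul_eq_mul, mul_one]
      exact (congrArg (UniversalEnvelopingAlgebra.ι ℂ (L := R.𝔤)) this).trans (map_smul _ _ _)
    refine (congrArg (R.casimir * ·) e).trans (Eq.trans ?_ (congrArg (· * R.casimir) e).symm)
    rw [mul_smul_comm, smul_mul_assoc, h1]

end ReductiveStructure

namespace GKModule

universe u v w

variable {E : Type u} [NormedAddCommGroup E] [NormedSpace ℝ E] [CompleteSpace E]
    {G : Type v} [TopologicalSpace G] [ChartedSpace E G] [Group G] [LieGroup 𝓘(ℝ, E) ∞ G]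
    {R : ReductiveStructure E G} {X : Type w} [AddCommGroup X] [Module ℂ X] (M : GKModule R X)
    (P : R.Polarization) [FiniteDimensional ℝ E]

theorem actU_toU (Z : LieAlg E G) : M.actU (R.toU Z) = M.act (R.toG Z) :=
  UniversalEnvelopingAlgebra.lift_ι_apply ℂ M.act _

/-- The infinitesimal character enters the proof through its value on the Casimir element, which is
central by invariance of `B`. -/
theorem exists_casimir_scalar (hinf : M.HasInfinitesimalCharacter) : ∃ c : ℂ,
    ∑ i, M.actLeft P (R.orthoBasis i : LieAlg E G) * M.actLeft P (R.orthoBasis i : LieAlg E G) -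
      ∑ b, M.actLeft P (R.kBasis b : LieAlg E G) * M.actLeft P (R.kBasis b : LieAlg E G) =
    algebraMap ℂ _ c := by
  obtain ⟨χ, hχ⟩ := hinf
  refine ⟨χ ⟨_, R.casimir_mem_center⟩, ?_⟩
  have h1 := hχ ⟨_, R.casimir_mem_center⟩
  have h2 : M.actU R.casimir =
      ∑ i, M.act (R.toG (R.orthoBasis i : LieAlg E G)) * M.act (R.toG (R.orthoBasis i : LieAlg E G)) -
      ∑ b, M.act (R.toG (R.kBasis b : LieAlg E G)) * M.act (R.toG (R.kBasis b : LieAlg E G)) := by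
    rw [ReductiveStructure.casimir, map_sub, map_sum, map_sum]
    simp only [map_mul, actU_toU]
  exact sum_sq_rTensor P.S fun x => by rw [← h2]; exact h1 x

/-- The square of the Dirac operator on a module with infinitesimal character. -/
theorem exists_diracOp_sq (hinf : M.HasInfinitesimalCharacter) : ∃ c : ℂ,
    M.diracOp P * M.diracOp P = algebraMap ℂ _ c -
      ∑ b, M.diagAct P (R.kBasis b : LieAlg E G) * M.diagAct P (R.kBasis b : LieAlg E G) := by
  obtain ⟨r, hr⟩ := R.exists_dirac_sq (M.actLeft P) (M.cliffRight P) (M.actLeft_comm_cliffRight P)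
    (M.actLeft_lie P)
  obtain ⟨c, hc⟩ := M.exists_casimir_scalar P hinf
  refine ⟨r - c, ?_⟩
  refine (congrArg (fun D => D * D) (M.diracOp_eq P)).trans (hr.trans ?_)
  exact congrArg (fun T => T - _) (algebraMap_sub_eq r hc)

end GKModule

end

section

open Filter Topology

universe u v w

/-! ### Schur's lemma and the scalar action of `T²` -/

section Schur

variable {H W V : Type*} [Group H] [AddCommGroup W] [Module ℂ W] [AddCommGroup V] [Module ℂ V]
  {σ : Representation ℂ H W} {ρ : Representation ℂ H V}

theorem nontrivial_of_isIrreducible (hσ : σ.IsIrreducible) : Nontrivial W := by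
  obtain ⟨A, B, hAB⟩ := hσ.exists_pair_ne
  by_contra hc
  rw [not_nontrivial_iff_subsingleton] at hc
  exact hAB (Subrepresentation.toSubmodule_injective (Subsingleton.elim _ _))

/-- Schur's lemma. -/
theorem exists_scalar_of_comm [FiniteDimensional ℂ W] (hσ : σ.IsIrreducible) {C : Module.End ℂ W}
    (hC : ∀ h x, C (σ h x) = σ h (C x)) : ∃ c : ℂ, ∀ x, C x = c • x := by
  have := nontrivial_of_isIrreducible hσ
  obtain ⟨c, hc⟩ := Module.End.exists_eigenvalue C
  refine ⟨c, fun x => ?_⟩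
  rcases eq_bot_or_eq_top_of_isIrreducible hσ (C.eigenspace c) (fun h y hy => by
    rw [Module.End.mem_eigenspace_iff] at *
    rw [hC, hy, map_smul]) with h | h
  · exact absurd h hc
  · exact Module.End.mem_eigenspace_iff.1 (h ▸ Submodule.mem_top)

/-- An intertwiner from an irreducible representation is zero or injective. -/
theorem eq_zero_or_injective (hσ : σ.IsIrreducible)
    (f : Representation.IntertwiningMap σ ρ) : (∀ x, f x = 0) ∨ Function.Injective f := by
  rcases eq_bot_or_eq_top_of_isIrreducible hσ (LinearMap.ker f.toLinearMap)
    (fun h y hy => by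
      have hy' : f y = 0 := hy
      have : f (σ h y) = 0 := by rw [intertwiningMap_apply, hy', map_zero]
      exact this) with h | h
  · exact Or.inr (LinearMap.ker_eq_bot.1 h)
  · exact Or.inl fun x => LinearMap.mem_ker.1 (h ▸ Submodule.mem_top : x ∈ LinearMap.ker f.toLinearMap)

end Schur

namespace ReductiveStructure

variable {E : Type u} [NormedAddCommGroup E] [NormedSpace ℝ E] {G : Type v}
  [TopologicalSpace G] [ChartedSpace E G] [Group G] [LieGroup 𝓘(ℝ, E) ∞ G]
  (R : ReductiveStructure E G) [FiniteDimensional ℝ E]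

/-- `spinDeriv` as a linear map. -/
def spinDerivₗ : LieAlg E G →ₗ[ℝ] R.Cl₀ where
  toFun := R.spinDeriv
  map_add' Z Z' := by
    simp only [spinDeriv, add_lie, map_add, LinearMap.add_apply, add_smul, Finset.sum_add_distrib,
      smul_add]
  map_smul' r Z := by
    simp only [spinDeriv, smul_lie, map_smul, LinearMap.smul_apply, smul_eq_mul, RingHom.id_apply,
      Finset.smul_sum, smul_smul, mul_left_comm]

/-- The linear map `d` computes the derivatives at `0` of the representation `ρ` of `K̃` along
differentiable curves. -/
def IsDifferential {V : Type*} [AddCommGroup V] [Module ℂ V] (ρ : Representation ℂ R.Ktilde V)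
    (d : LieAlg E G →ₗ[ℝ] Module.End ℂ V) : Prop :=
  ∀ (c : ℝ → R.Ktilde) (Z : LieAlg E G), R.HasVelocity c Z → ∀ y,
    HasWeakDerivAt ℂ (fun t => ρ (c t) y) (d Z y) 0

variable {R} {V W : Type*} [AddCommGroup V] [Module ℂ V] [AddCommGroup W] [Module ℂ W]
  {ρ : Representation ℂ R.Ktilde V} {σ : Representation ℂ R.Ktilde W}
  {d : LieAlg E G →ₗ[ℝ] Module.End ℂ V} {a : LieAlg E G →ₗ[ℝ] Module.End ℂ W}

/-- The relation `f (σ (c t) x) = ρ (c t) (f x)` is differentiated along a curve with velocity `Z`;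
such a curve exists because `Z` lies in `𝔨₀`. -/
theorem IsDifferential.apply_comm (ha : R.IsDifferential σ a) (hd : R.IsDifferential ρ d)
    (f : Representation.IntertwiningMap σ ρ) {Z : LieAlg E G} (hZ : Z ∈ R.k₀) (x : W) :
    f (a Z x) = d Z (f x) := by
  obtain ⟨c, hc⟩ := R.exists_hasVelocity (R.mem_k₀.1 hZ)
  refine HasWeakDerivAt.unique (𝕜 := ℂ) ((ha c Z hc x).map f.toLinearMap) ?_
  refine (hd c Z hc (f x)).congr (Eventually.of_forall fun t => ?_)
  exact intertwiningMap_apply f (c t) x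

/-- The differential is transported through a linear left inverse of `f`. Off `𝔨₀` no curve has the
given velocity, so the values there carry no condition. -/
theorem IsDifferential.exists_of_injective (hd : R.IsDifferential ρ d)
    (f : Representation.IntertwiningMap σ ρ) (hf : Function.Injective f) :
    ∃ a : LieAlg E G →ₗ[ℝ] Module.End ℂ W, R.IsDifferential σ a := by
  obtain ⟨p, hp⟩ := f.toLinearMap.exists_leftInverse_of_injective (LinearMap.ker_eq_bot.2 hf)
  refine ⟨{ toFun := fun Z => p ∘ₗ d Z ∘ₗ f.toLinearMap
            map_add' := fun Z Z' => by
              rw [map_add, LinearMap.add_comp, LinearMap.comp_add]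
            map_smul' := fun r Z => by
              rw [map_smul]
              exact LinearMap.ext fun x => p.map_smul_of_tower r _ }, fun c Z hc x => ?_⟩
  refine ((hd c Z hc (f x)).map p).congr (Eventually.of_forall fun t => ?_)
  have h1 : p (f (σ (c t) x)) = σ (c t) x := LinearMap.congr_fun hp _
  exact h1.symm.trans (congrArg p (intertwiningMap_apply f (c t) x))

variable (R) in
/-- The square of `T` is a scalar minus the Casimir element of `𝔨₀`. -/
def IsCasimirSqrt (d : LieAlg E G →ₗ[ℝ] Module.End ℂ V) (c : ℂ) (T : Module.End ℂ V) : Prop :=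
  T * T = algebraMap ℂ _ c - ∑ b, d (R.kBasis b) * d (R.kBasis b)

variable {T : Module.End ℂ V} {c : ℂ}

/-- The square of `T` on the image of an intertwiner. -/
theorem IsCasimirSqrt.sq_apply (hT : R.IsCasimirSqrt d c T) (hd : R.IsDifferential ρ d)
    (ha : R.IsDifferential σ a) (f : Representation.IntertwiningMap σ ρ) (x : W) :
    T (T (f x)) = f (c • x - ∑ b, a (R.kBasis b) (a (R.kBasis b) x)) := by
  have h1 : ∀ b x, f (a (R.kBasis b) x) = d (R.kBasis b) (f x) := fun b x =>
    ha.apply_comm hd f (R.kBasis b).2 x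
  have h2 := LinearMap.congr_fun hT (f x)
  rw [map_sub, map_smul, map_sum]
  simp only [h1]
  refine h2.trans ?_
  rw [LinearMap.sub_apply, LinearMap.sum_apply]
  rfl

/-- `T²` acts by a scalar on each isotypic component. -/
theorem IsCasimirSqrt.exists_scalar (hT : R.IsCasimirSqrt d c T) (hd : R.IsDifferential ρ d)
    (hρT : ∀ h y, ρ h (T y) = T (ρ h y)) [FiniteDimensional ℂ W] (hσ : σ.IsIrreducible) :
    ∃ s : ℂ, ∀ (f : Representation.IntertwiningMap σ ρ) x, T (T (f x)) = s • f x := by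
  by_cases h : ∃ f : Representation.IntertwiningMap σ ρ, Function.Injective f
  · obtain ⟨f₁, hf₁⟩ := h
    obtain ⟨a, ha⟩ := hd.exists_of_injective f₁ hf₁
    obtain ⟨C, hC₀⟩ : ∃ C : Module.End ℂ W,
        ∀ x, C x = c • x - ∑ b, a (R.kBasis b) (a (R.kBasis b) x) :=
      ⟨c • LinearMap.id - ∑ b, a (R.kBasis b) * a (R.kBasis b), fun x => by
        rw [LinearMap.sub_apply, LinearMap.sum_apply]; rfl⟩
    have hC : ∀ (f : Representation.IntertwiningMap σ ρ) x, T (T (f x)) = f (C x) := fun f x => by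
      rw [hT.sq_apply hd ha f x, hC₀]
    -- `C` commutes with `σ` because `T²` commutes with `ρ` and `f₁` is injective; the Casimir
    -- element of `𝔨₀` need not be shown to be invariant.
    obtain ⟨s, hs⟩ := exists_scalar_of_comm hσ (C := C) fun h x => hf₁ (by
      have h1 := hC f₁ (σ h x)
      have h2 := congrArg (ρ h) (hC f₁ x)
      rw [hρT, hρT] at h2
      rw [intertwiningMap_apply] at h1
      exact h1.symm.trans (h2.trans (intertwiningMap_apply f₁ h (C x)).symm))
    exact ⟨s, fun f x => by rw [hC, hs, map_smul]⟩
  · refine ⟨0, fun f x => ?_⟩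
    rcases eq_zero_or_injective hσ f with h0 | h0
    · rw [h0, map_zero, map_zero, smul_zero]
    · exact absurd ⟨f, h0⟩ h

end ReductiveStructure

namespace GKModule

attribute [local instance 100] LieRing.ofAssociativeRing

variable {E : Type u} [NormedAddCommGroup E] [NormedSpace ℝ E] [CompleteSpace E]
    {G : Type v} [TopologicalSpace G] [ChartedSpace E G] [Group G] [LieGroup 𝓘(ℝ, E) ∞ G]
    {R : ReductiveStructure E G} {X : Type w} [AddCommGroup X] [Module ℂ X] (M : GKModule R X)
    (P : R.Polarization) [FiniteDimensional ℝ E]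

/-- The differential of the action of `K̃` on `X ⊗ S`, as a linear map. -/
def diagActₗ : LieAlg E G →ₗ[ℝ] Module.End ℂ (X ⊗[ℂ] P.S) :=
  M.actLeft P + (M.cliffRight P).toLinearMap.comp R.spinDerivₗ

theorem isDifferential_diagActₗ : R.IsDifferential (M.repXS P) (M.diagActₗ P) :=
  fun _ _ hc y => M.hasWeakDerivAt_repXS P hc y

/-- `D²` differs from the Casimir element of `𝔨₀` by a scalar. -/
theorem exists_isCasimirSqrt_diracOp (hinf : M.HasInfinitesimalCharacter) : ∃ c : ℂ,
    R.IsCasimirSqrt (M.diagActₗ P) c (M.diracOp P) :=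
  M.exists_diracOp_sq P hinf

end GKModule

end

section

open Filter Topology

/-! ### Induction from `K̃` to `K` and finite multiplicities -/

section Induction

variable {H K F X : Type*} [Group H] [TopologicalSpace H] [Group K] [TopologicalSpace K]
  [AddCommGroup F] [Module ℂ F] [AddCommGroup X] [Module ℂ X] (p : H →* K)

/-- The space of the representation of `K` induced from the representation `τ` of `H` by
`p : H → K`. -/
def inducedSpace (τ : Representation ℂ H F) : Submodule ℂ (K → F) where
  carrier := {φ | ∀ k h, φ (k * p h) = τ h⁻¹ (φ k)}
  add_mem' hφ hψ k h := by rw [Pi.add_apply, hφ k h, hψ k h, Pi.add_apply, map_add]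
  zero_mem' k h := by rw [Pi.zero_apply, Pi.zero_apply, map_zero]
  smul_mem' c φ hφ k h := by rw [Pi.smul_apply, hφ k h, Pi.smul_apply, map_smul]

variable {τ : Representation ℂ H F}

/-- The representation of `K` induced from the representation `τ` of `H` by `p : H → K`. -/
def inducedRep (τ : Representation ℂ H F) : Representation ℂ K (inducedSpace p τ) where
  toFun k :=
    { toFun := fun φ => ⟨fun x => φ.1 (k⁻¹ * x), fun x h =>
        (congrArg φ.1 (mul_assoc _ _ _).symm).trans (φ.2 _ _)⟩
      map_add' := fun _ _ => rfl
      map_smul' := fun _ _ => rfl }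
  map_one' := LinearMap.ext fun φ => Subtype.ext (funext fun x => by
    change φ.1 (1⁻¹ * x) = φ.1 x
    rw [inv_one, one_mul])
  map_mul' k l := LinearMap.ext fun φ => Subtype.ext (funext fun x => by
    change φ.1 ((k * l)⁻¹ * x) = φ.1 (l⁻¹ * (k⁻¹ * x))
    rw [mul_inv_rev, mul_assoc])

/-- Evaluation of functions of the induced representation at coset representatives. -/
def inducedEval (τ : Representation ℂ H F) : inducedSpace p τ →ₗ[ℂ] (K ⧸ p.range → F) where
  toFun φ q := φ.1 q.out
  map_add' _ _ := rfl
  map_smul' _ _ := rfl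

theorem inducedSpace_ext {φ ψ : inducedSpace p τ} (k : K)
    (hk : φ.1 (k : K ⧸ p.range).out = ψ.1 (k : K ⧸ p.range).out) : φ.1 k = ψ.1 k := by
  obtain ⟨h, hh⟩ : ((k : K ⧸ p.range).out)⁻¹ * k ∈ p.range :=
    QuotientGroup.eq.1 (Quotient.out_eq' (k : K ⧸ p.range))
  have hk' : k = (k : K ⧸ p.range).out * p h := by rw [hh, mul_inv_cancel_left]
  rw [hk', φ.2, ψ.2, hk]

theorem inducedEval_injective : Function.Injective (inducedEval p τ) := fun _ _ h =>
  Subtype.ext (funext fun k => inducedSpace_ext p k (congrFun h k))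

variable [FiniteDimensional ℂ F] [Finite (K ⧸ p.range)]

instance : FiniteDimensional ℂ (inducedSpace p τ) :=
  FiniteDimensional.of_injective _ (inducedEval_injective p)

/-- On a coset of the image, `φ` pulls back to the continuous function `h ↦ τ h⁻¹ (φ k₀)` on `H`. It
descends because a continuous surjection from a compact space to a Hausdorff space is a quotient
map, and the cosets are open. -/
theorem weakContinuous_of_mem_inducedSpace [IsTopologicalGroup H] [IsTopologicalGroup K]
    [CompactSpace H] [T2Space K] (hp : Continuous p) (ho : IsOpen (p.range : Set K))
    (hτ : IsContinuousRep τ) (φ : inducedSpace p τ) : WeakContinuous ℂ φ.1 := fun ψ => by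
  have h1 : Topology.IsQuotientMap p.rangeRestrict :=
    Topology.IsQuotientMap.of_surjective_continuous p.rangeRestrict_surjective
      (hp.subtype_mk _)
  have h2 : ∀ k₀, Continuous fun n : p.range => ψ (φ.1 (k₀ * n)) := fun k₀ => by
    rw [h1.continuous_iff]
    have e : ((fun n : p.range => ψ (φ.1 (k₀ * n))) ∘ p.rangeRestrict) =
        fun h => ψ (τ h⁻¹ (φ.1 k₀)) := funext fun h => congrArg ψ (φ.2 k₀ h)
    rw [e]
    exact (hτ _ ψ).comp continuous_inv
  refine continuous_iff_continuousAt.2 fun k₀ => ?_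
  have h3 : ContinuousAt (fun k : K => ψ (φ.1 (k₀ * k))) 1 := by
    have h4 : ContinuousOn (fun k : K => ψ (φ.1 (k₀ * k))) (p.range : Set K) :=
      continuousOn_iff_continuous_domRestrict.2 (h2 k₀)
    exact h4.continuousAt (ho.mem_nhds (one_mem _))
  have h5 : Tendsto (fun k => k₀⁻¹ * k) (𝓝 k₀) (𝓝 1) := by
    have : Continuous fun k : K => k₀⁻¹ * k := continuous_const.mul continuous_id
    simpa using this.tendsto k₀
  have h6 := h3.tendsto.comp h5
  simp only [mul_one] at h6
  refine h6.congr fun k => ?_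
  simp only [Function.comp_apply, mul_inv_cancel_left]

theorem isContinuousRep_inducedRep [IsTopologicalGroup H] [IsTopologicalGroup K]
    [CompactSpace H] [T2Space K] (hp : Continuous p) (ho : IsOpen (p.range : Set K))
    (hτ : IsContinuousRep τ) : IsContinuousRep (inducedRep p τ) := fun φ L => by
  classical
  have := Fintype.ofFinite (K ⧸ p.range)
  obtain ⟨r, hr⟩ := (inducedEval p τ).exists_leftInverse_of_injective
    (LinearMap.ker_eq_bot.2 (inducedEval_injective p))
  have h1 : ∀ k, L (inducedRep p τ k φ) =
      ∑ q : K ⧸ p.range, (L ∘ₗ r ∘ₗ LinearMap.single ℂ (fun _ => F) q) (φ.1 (k⁻¹ * q.out)) := fun k => by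
    have h2 : r (inducedEval p τ (inducedRep p τ k φ)) = inducedRep p τ k φ :=
      LinearMap.congr_fun hr _
    conv_lhs => rw [← h2, ← LinearMap.sum_single_apply (fun _ => F)
      (inducedEval p τ (inducedRep p τ k φ)), map_sum, map_sum]
    rfl
  simp only [h1]
  exact continuous_finsetSum _ fun q _ =>
    (weakContinuous_of_mem_inducedSpace p hp ho hτ φ _).comp
      (continuous_inv.mul continuous_const)

/-- The intertwiner from the induced representation that corresponds to an intertwiner from the
given one. -/
def inducedIntertwiner (π : Representation ℂ K X) (f : Representation.IntertwiningMap τ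
    (MonoidHom.comp π p : Representation ℂ H X)) :
    Representation.IntertwiningMap (inducedRep p τ) π := by
  classical
  exact
  letI := Fintype.ofFinite (K ⧸ p.range)
  { toFun := fun φ => ∑ q : K ⧸ p.range, π q.out (f (φ.1 q.out))
    map_add' := fun φ ψ => by
      rw [← Finset.sum_add_distrib]
      refine Finset.sum_congr rfl fun q _ => ?_
      rw [← map_add, ← map_add]; rfl
    map_smul' := fun c φ => by
      rw [RingHom.id_apply, Finset.smul_sum]
      refine Finset.sum_congr rfl fun q _ => ?_
      rw [← map_smul, ← map_smul]; rfl
    isIntertwining' := fun k => LinearMap.ext fun φ => by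
      -- The term `π k (f (φ k))` depends only on the coset of `k`, so left translation merely
      -- permutes the summands.
      have hw : ∀ (φ : inducedSpace p τ) (k : K),
          π (k : K ⧸ p.range).out (f (φ.1 (k : K ⧸ p.range).out)) = π k (f (φ.1 k)) := fun φ k => by
        obtain ⟨h, hh⟩ : ((k : K ⧸ p.range).out)⁻¹ * k ∈ p.range :=
          QuotientGroup.eq.1 (Quotient.out_eq' (k : K ⧸ p.range))
        have hk' : k = (k : K ⧸ p.range).out * p h := by rw [hh, mul_inv_cancel_left]
        conv_rhs => rw [hk', φ.2, intertwiningMap_apply]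
        change _ = π (_ * p h) (π (p h⁻¹) _)
        rw [← Module.End.mul_apply, ← map_mul, mul_assoc, ← map_mul, mul_inv_cancel, map_one,
          mul_one]
      change ∑ q : K ⧸ p.range, π q.out (f (φ.1 (k⁻¹ * q.out))) =
        π k (∑ q : K ⧸ p.range, π q.out (f (φ.1 q.out)))
      rw [map_sum]
      refine (Fintype.sum_equiv (MulAction.toPerm k) _ _ fun q => ?_).symm
      have h1 := hw ((inducedRep p τ) k φ) (k * q.out)
      have h2 : ((k * q.out : K) : K ⧸ p.range) = k • q := by
        conv_rhs => rw [← Quotient.out_eq' q]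
        rfl
      rw [h2] at h1
      refine Eq.trans ?_ h1.symm
      change _ = π (k * q.out) (f (φ.1 (k⁻¹ * (k * q.out))))
      rw [inv_mul_cancel_left, map_mul]
      rfl }

theorem inducedIntertwiner_apply [Fintype (K ⧸ p.range)] (π : Representation ℂ K X)
    (f : Representation.IntertwiningMap τ (MonoidHom.comp π p : Representation ℂ H X))
    (φ : inducedSpace p τ) :
    inducedIntertwiner p π f φ = ∑ q : K ⧸ p.range, π q.out (f (φ.1 q.out)) := by
  obtain rfl : ‹Fintype (K ⧸ p.range)› = Fintype.ofFinite _ := Subsingleton.elim _ _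
  rfl

/-- Half of Frobenius reciprocity: inducing intertwiners is injective, since `f v` is recovered from
the function supported on the image of `p` with value `τ h⁻¹ v` at `p h`. The hypothesis on the
kernel of `p` makes that function well defined. -/
theorem finite_intertwiningMap_comp_of_ker [IsTopologicalGroup H] [IsTopologicalGroup K]
    [CompactSpace H] [T2Space K] (hp : Continuous p) (ho : IsOpen (p.range : Set K))
    (hτ : IsContinuousRep τ) (hker : ∀ h, p h = 1 → ∀ v, τ h v = v) {π : Representation ℂ K X}
    (hπ : HasFiniteMultiplicities π) : Module.Finite ℂ (Representation.IntertwiningMap τ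
      (MonoidHom.comp π p : Representation ℂ H X)) := by
  classical
  have := Fintype.ofFinite (K ⧸ p.range)
  have hI := finite_intertwiningMap_of_finite hπ _ (inducedRep p τ)
    (isContinuousRep_inducedRep p hp ho hτ) rfl
  let Φ : Representation.IntertwiningMap τ (MonoidHom.comp π p : Representation ℂ H X) →ₗ[ℂ]
      Representation.IntertwiningMap (inducedRep p τ) π :=
    { toFun := inducedIntertwiner p π
      map_add' := fun f g => Representation.IntertwiningMap.ext (LinearMap.ext fun φ => by
        change inducedIntertwiner p π (f + g) φ =
          inducedIntertwiner p π f φ + inducedIntertwiner p π g φ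
        rw [inducedIntertwiner_apply, inducedIntertwiner_apply, inducedIntertwiner_apply,
          ← Finset.sum_add_distrib]
        refine Finset.sum_congr rfl fun q _ => ?_
        rw [← map_add]; rfl)
      map_smul' := fun c f => Representation.IntertwiningMap.ext (LinearMap.ext fun φ => by
        change inducedIntertwiner p π (c • f) φ = c • inducedIntertwiner p π f φ
        rw [inducedIntertwiner_apply, inducedIntertwiner_apply, Finset.smul_sum]
        refine Finset.sum_congr rfl fun q _ => ?_
        rw [← map_smul]; rfl) }
  refine FiniteDimensional.of_injective Φ ((injective_iff_map_eq_zero _).2 fun f hf => ?_)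
  refine Representation.IntertwiningMap.ext (LinearMap.ext fun v => ?_)
  have hτp : ∀ h h', p h = p h' → τ h⁻¹ v = τ h'⁻¹ v := fun h h' hh => by
    have h1 := hker (h * h'⁻¹) (by rw [map_mul, map_inv, hh, mul_inv_cancel]) (τ h'⁻¹ v)
    have h2 : τ h⁻¹ (τ (h * h'⁻¹) (τ h'⁻¹ v)) = τ h⁻¹ (τ h'⁻¹ v) := congrArg _ h1
    have h3 := hker (h⁻¹ * h') (by rw [map_mul, map_inv, hh, inv_mul_cancel]) (τ h'⁻¹ v)
    rw [← h3, ← Module.End.mul_apply, ← map_mul, mul_assoc, mul_inv_cancel, mul_one]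
  let φ₀ : K → F := fun k => if hk : ∃ h, p h = k then τ hk.choose⁻¹ v else 0
  have hφ₀ : ∀ h, φ₀ (p h) = τ h⁻¹ v := fun h => by
    have hk : ∃ h', p h' = p h := ⟨h, rfl⟩
    simp only [φ₀, dif_pos hk]
    exact hτp _ _ hk.choose_spec
  have hφ₁ : ∀ k, k ∉ p.range → φ₀ k = 0 := fun k hk => dif_neg hk
  let φ : inducedSpace p τ := ⟨φ₀, fun k h => by
    by_cases hk : k ∈ p.range
    · obtain ⟨h', rfl⟩ := hk
      rw [← map_mul, hφ₀, hφ₀, mul_inv_rev, map_mul]; rfl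
    · rw [hφ₁ k hk, map_zero, hφ₁]
      intro hk'
      exact hk ((Subgroup.mul_mem_cancel_right _ (⟨h, rfl⟩ : p h ∈ p.range)).1 hk')⟩
  have h1 : inducedIntertwiner p π f φ = 0 :=
    congrArg (fun g : Representation.IntertwiningMap (inducedRep p τ) π => g φ) hf
  rw [inducedIntertwiner_apply, Finset.sum_eq_single ((1 : K) : K ⧸ p.range)] at h1
  · obtain ⟨h, hh⟩ : ((1 : K) : K ⧸ p.range).out ∈ p.range := by
      have := QuotientGroup.eq.1 (Quotient.out_eq' ((1 : K) : K ⧸ p.range))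
      rw [mul_one] at this
      exact inv_mem_iff.1 this
    have h2 : φ.1 ((1 : K) : K ⧸ p.range).out = τ h⁻¹ v := by rw [← hh]; exact hφ₀ h
    rw [h2, intertwiningMap_apply, ← hh] at h1
    change π (p h) (π (p h⁻¹) (f v)) = 0 at h1
    rw [← Module.End.mul_apply, ← map_mul, ← map_mul, mul_inv_cancel, map_one, map_one] at h1
    exact h1
  · intro q _ hq
    have : q.out ∉ p.range := fun h => hq (by
      conv_lhs => rw [← Quotient.out_eq' q]
      exact (QuotientGroup.eq.2 (by rw [inv_one, one_mul]; exact h)).symm)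
    change π q.out (f (φ₀ q.out)) = 0
    rw [hφ₁ _ this, map_zero, map_zero]
  · exact fun h => absurd (Finset.mem_univ _) h

/-- All intertwiners factor through the quotient by their common kernel `J`. On this quotient the
kernel of `p` acts trivially, because `f (τ h v) = π (p h) (f v)`. -/
theorem finite_intertwiningMap_comp [IsTopologicalGroup H] [IsTopologicalGroup K]
    [CompactSpace H] [T2Space K] (hp : Continuous p) (ho : IsOpen (p.range : Set K))
    (hτ : IsContinuousRep τ) {π : Representation ℂ K X}
    (hπ : HasFiniteMultiplicities π) : Module.Finite ℂ (Representation.IntertwiningMap τ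
      (MonoidHom.comp π p : Representation ℂ H X)) := by
  let π' : Representation ℂ H X := MonoidHom.comp π p
  let J : Submodule ℂ F :=
    ⨅ f : Representation.IntertwiningMap τ π', LinearMap.ker f.toLinearMap
  have hJ : ∀ v, v ∈ J ↔ ∀ f : Representation.IntertwiningMap τ π', f v = 0 := fun v => by
    rw [Submodule.mem_iInf]; rfl
  have hJτ : ∀ h, ∀ v ∈ J, τ h v ∈ J := fun h v hv => by
    rw [hJ] at *
    intro f
    rw [intertwiningMap_apply, hv, map_zero]
  have hq := finite_intertwiningMap_comp_of_ker p (τ := τ.quotient J hJτ) hp ho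
    (hτ.of_surjective J.mkQ (fun _ _ => rfl) J.mkQ_surjective) (fun h hh v => by
      obtain ⟨v, rfl⟩ := J.mkQ_surjective v
      change J.mkQ (τ h v) = J.mkQ v
      rw [← sub_eq_zero, ← map_sub, Submodule.mkQ_apply, Submodule.Quotient.mk_eq_zero, hJ]
      intro f
      rw [map_sub, intertwiningMap_apply, sub_eq_zero]
      change π (p h) (f v) = f v
      rw [hh, map_one]; rfl) hπ
  refine FiniteDimensional.of_injective
    ({ toFun := fun f => ⟨J.liftQ f.toLinearMap fun v hv => (hJ v).1 hv f, fun h => by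
          ext v
          exact intertwiningMap_apply f h v⟩
       map_add' := fun _ _ => Representation.IntertwiningMap.ext (by ext; rfl)
       map_smul' := fun _ _ => Representation.IntertwiningMap.ext (by ext; rfl) } :
      Representation.IntertwiningMap τ π' →ₗ[ℂ]
        Representation.IntertwiningMap (τ.quotient J hJτ) π') fun f g h =>
    Representation.IntertwiningMap.ext (LinearMap.ext fun v =>
      congrArg (fun t : Representation.IntertwiningMap (τ.quotient J hJτ) π' => t (J.mkQ v)) h)

end Induction

/-! ### Tensor products and multiplicities in `X ⊗ S` -/

section Tensor

variable {H V W S X : Type*} [Group H] [TopologicalSpace H] [AddCommGroup V] [Module ℂ V]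
  [AddCommGroup W] [Module ℂ W] [AddCommGroup S] [Module ℂ S] [FiniteDimensional ℂ S]
  [AddCommGroup X] [Module ℂ X]

theorem IsContinuousRep.tprod [FiniteDimensional ℂ W] {ρ : Representation ℂ H V}
    {σ : Representation ℂ H W} (hρ : IsContinuousRep ρ) (hσ : IsContinuousRep σ) :
    IsContinuousRep (ρ.tprod σ) := fun y => by
  induction y with
  | zero => intro φ; simp only [map_zero]; exact continuous_const
  | add a b ha hb => intro φ; simp only [map_add]; exact (ha φ).add (hb φ)
  | tmul x s => exact WeakContinuous.bilin (hσ s) (hρ x) (TensorProduct.mk ℂ V W).flip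

theorem IsContinuousRep.dual [IsTopologicalGroup H] {σ : Representation ℂ H S}
    (hσ : IsContinuousRep σ) : IsContinuousRep σ.dual := fun φ => by
  refine WeakContinuous.hom (f := fun h => σ.dual h φ) fun v ψ => ?_
  exact (hσ v (ψ ∘ₗ φ)).comp continuous_inv

/-- The intertwiner `σ ⊗ s* → ρ` defined by an intertwiner `σ → ρ ⊗ s`. -/
def contractIntertwiner {ρ : Representation ℂ H X} {s : Representation ℂ H S}
    {σ : Representation ℂ H W} (f : Representation.IntertwiningMap σ (ρ.tprod s)) :
    Representation.IntertwiningMap (σ.tprod s.dual) ρ where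
  toLinearMap := TensorProduct.lift (LinearMap.mk₂ ℂ
    (fun w φ => TensorProduct.rid ℂ X (φ.lTensor X (f w)))
    (fun w w' φ => by simp only [map_add]) (fun c w φ => by simp only [map_smul])
    (fun w φ φ' => by simp only [LinearMap.lTensor_add, LinearMap.add_apply, map_add])
    (fun c w φ => by simp only [LinearMap.lTensor_smul, LinearMap.smul_apply, map_smul]))
  isIntertwining' h := TensorProduct.ext' fun w φ => by
    change TensorProduct.rid ℂ X ((s.dual h φ).lTensor X (f (σ h w))) =
      ρ h (TensorProduct.rid ℂ X (φ.lTensor X (f w)))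
    rw [intertwiningMap_apply]
    induction f w with
    | zero => simp only [map_zero]
    | add a b ha hb => simp only [map_add, ha, hb]
    | tmul x y =>
      change TensorProduct.rid ℂ X (ρ h x ⊗ₜ[ℂ] φ (s h⁻¹ (s h y))) =
        ρ h (TensorProduct.rid ℂ X (x ⊗ₜ φ y))
      rw [← Module.End.mul_apply (s h⁻¹), ← map_mul, inv_mul_cancel, map_one, Module.End.one_apply,
        TensorProduct.rid_tmul, TensorProduct.rid_tmul, map_smul]

omit [TopologicalSpace H] [AddCommGroup W] [Module ℂ W] [Group H] [AddCommGroup V] [Module ℂ V] in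
theorem eq_zero_of_contract {y : X ⊗[ℂ] S}
    (hy : ∀ φ : Module.Dual ℂ S, TensorProduct.rid ℂ X (φ.lTensor X y) = 0) : y = 0 := by
  let b := Module.finBasis ℂ S
  have h : ∀ y : X ⊗[ℂ] S,
      y = ∑ i, (TensorProduct.rid ℂ X ((b.coord i).lTensor X y)) ⊗ₜ[ℂ] b i := fun y => by
    induction y with
    | zero => simp only [map_zero, TensorProduct.zero_tmul, Finset.sum_const_zero]
    | add a c ha hc =>
      simp only [map_add, TensorProduct.add_tmul, Finset.sum_add_distrib]
      rw [← ha, ← hc]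
    | tmul x s =>
      simp only [LinearMap.lTensor_tmul, TensorProduct.rid_tmul, TensorProduct.smul_tmul,
        Module.Basis.coord_apply]
      rw [← TensorProduct.tmul_sum, b.sum_repr]
  rw [h y]
  exact Finset.sum_eq_zero fun i _ => by rw [hy, TensorProduct.zero_tmul]

/-- Hom-tensor adjunction, of which only injectivity is needed: an element of `X ⊗ S` killed by
contraction with every form on `S` is zero. -/
theorem finite_intertwiningMap_tprod {ρ : Representation ℂ H X} {s : Representation ℂ H S}
    {σ : Representation ℂ H W}
    [Module.Finite ℂ (Representation.IntertwiningMap (σ.tprod s.dual) ρ)] :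
    Module.Finite ℂ (Representation.IntertwiningMap σ (ρ.tprod s)) := by
  refine FiniteDimensional.of_injective
    ({ toFun := contractIntertwiner
       map_add' := fun f g => Representation.IntertwiningMap.ext (TensorProduct.ext' fun w φ => by
         change TensorProduct.rid ℂ X (φ.lTensor X (f w + g w)) =
           TensorProduct.rid ℂ X (φ.lTensor X (f w)) + TensorProduct.rid ℂ X (φ.lTensor X (g w))
         rw [map_add, map_add])
       map_smul' := fun c f => Representation.IntertwiningMap.ext (TensorProduct.ext' fun w φ => by
         change TensorProduct.rid ℂ X (φ.lTensor X (c • f w)) =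
           c • TensorProduct.rid ℂ X (φ.lTensor X (f w))
         rw [map_smul, map_smul]) } :
      Representation.IntertwiningMap σ (ρ.tprod s) →ₗ[ℂ]
        Representation.IntertwiningMap (σ.tprod s.dual) ρ)
    ((injective_iff_map_eq_zero _).2 fun f hf => ?_)
  refine Representation.IntertwiningMap.ext (LinearMap.ext fun w => ?_)
  exact eq_zero_of_contract fun φ =>
    congrArg (fun t : Representation.IntertwiningMap (σ.tprod s.dual) ρ => t (w ⊗ₜ φ)) hf

theorem finite_intertwiningMap_restrictRep {ρ : Representation ℂ H V} {σ : Representation ℂ H W}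
    {A : Submodule ℂ V} (hA : ∀ h, ∀ y ∈ A, ρ h y ∈ A)
    [Module.Finite ℂ (Representation.IntertwiningMap σ ρ)] :
    Module.Finite ℂ (Representation.IntertwiningMap σ (restrictRep ρ A hA)) :=
  FiniteDimensional.of_injective
    ({ toFun := fun f => ⟨A.subtype ∘ₗ f.toLinearMap, fun h => LinearMap.ext fun v =>
         congrArg Subtype.val (intertwiningMap_apply f h v)⟩
       map_add' := fun _ _ => rfl
       map_smul' := fun _ _ => rfl } :
      Representation.IntertwiningMap σ (restrictRep ρ A hA) →ₗ[ℂ]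
        Representation.IntertwiningMap σ ρ) fun _ _ h =>
    Representation.IntertwiningMap.ext (LinearMap.ext fun v => Subtype.ext
      (congrArg (fun t : Representation.IntertwiningMap σ ρ => t v) h))

end Tensor

namespace GKModule

universe u v w

attribute [local instance 100] LieRing.ofAssociativeRing

variable {E : Type u} [NormedAddCommGroup E] [NormedSpace ℝ E] [CompleteSpace E]
    {G : Type v} [TopologicalSpace G] [ChartedSpace E G] [Group G] [LieGroup 𝓘(ℝ, E) ∞ G]
    {R : ReductiveStructure E G} {X : Type w} [AddCommGroup X] [Module ℂ X] (M : GKModule R X)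
    (P : R.Polarization) [FiniteDimensional ℝ E] [T2Space G]

theorem isContinuousRep_spinRep : IsContinuousRep P.spinRep := P.weakContinuous_spinRep

theorem finite_intertwiningMap_repXS (hadm : M.IsAdmissible) {W : Type*} [AddCommGroup W]
    [Module ℂ W] [FiniteDimensional ℂ W] {σ : Representation ℂ R.Ktilde W}
    (hσ : IsContinuousRep σ) :
    Module.Finite ℂ (Representation.IntertwiningMap σ (M.repXS P)) := by
  have := R.finite_quotient_range
  have := finite_intertwiningMap_comp R.KtildeToK R.continuous_KtildeToK R.isOpen_range_KtildeToK
    (hσ.tprod (isContinuousRep_spinRep P).dual) hadm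
  exact finite_intertwiningMap_tprod

theorem hasFiniteMultiplicities_repXS (hadm : M.IsAdmissible) :
    HasFiniteMultiplicities (M.repXS P) :=
  fun γ => M.finite_intertwiningMap_repXS P hadm γ.continuous

theorem hasFiniteMultiplicities_repXSpart (hadm : M.IsAdmissible) (ε : ZMod 2) :
    HasFiniteMultiplicities (M.repXSpart P ε) := fun γ => by
  have := M.hasFiniteMultiplicities_repXS P hadm γ
  exact finite_intertwiningMap_restrictRep _

end GKModule

end

section

open scoped Manifold ContDiff TensorProduct ComplexConjugate




open Filter Topology MeasureTheory

/-! ### Unitarity of representations of compact groups -/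

section InvariantForm

variable {H W : Type*} [Group H] [TopologicalSpace H] [IsTopologicalGroup H] [CompactSpace H]
  [AddCommGroup W] [Module ℂ W] [FiniteDimensional ℂ W] {σ : Representation ℂ H W}

/-- An invariant Hermitian inner product. -/
structure IsInvariantForm (σ : Representation ℂ H W) (β : W → W →ₗ[ℂ] ℂ) : Prop where
  conj_symm : ∀ x y, conj (β x y) = β y x
  pos : ∀ x, x ≠ 0 → 0 < (β x x).re
  invariant : ∀ h x y, β (σ h x) (σ h y) = β x y

/-- Every finite-dimensional continuous representation of a compact group is unitary. -/
theorem exists_isInvariantForm (hσ : IsContinuousRep σ) : ∃ β, IsInvariantForm σ β := by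
  let _ : MeasurableSpace H := borel H
  have : BorelSpace H := ⟨rfl⟩
  obtain ⟨μ, _, _, _⟩ := exists_haar_probability H
  let e := Module.finBasis ℂ W
  -- The Hermitian form of a basis, translated by `h`; its average over `H` is invariant, and it
  -- stays definite because the integrand is continuous, nonnegative and positive at `h = 1`.
  let F : W → W → H → ℂ := fun x y h => ∑ i, conj (e.coord i (σ h⁻¹ x)) * e.coord i (σ h⁻¹ y)
  have hc : ∀ i x, Continuous fun h => e.coord i (σ h⁻¹ x) := fun i x =>
    (hσ x (e.coord i)).comp continuous_inv
  have hF : ∀ x y, Continuous (F x y) := fun x y =>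
    continuous_finsetSum _ fun i _ => (Complex.continuous_conj.comp (hc i x)).mul (hc i y)
  have hI : ∀ x y, Integrable (F x y) μ := fun x y => integrable_of_continuous μ (hF x y)
  refine ⟨fun x =>
    { toFun := fun y => ∫ h, F x y h ∂μ
      map_add' := fun y y' => by
        rw [← integral_add (hI _ _) (hI _ _)]
        simp only [F, map_add, mul_add, Finset.sum_add_distrib]
      map_smul' := fun c y => by
        rw [RingHom.id_apply, smul_eq_mul, ← integral_const_mul]
        simp only [F, map_smul, smul_eq_mul, mul_left_comm, Finset.mul_sum] },
    fun x y => ?_, fun x hx => ?_, fun k x y => ?_⟩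
  · change conj (∫ h, F x y h ∂μ) = ∫ h, F y x h ∂μ
    rw [← integral_conj]
    simp only [F, map_sum, map_mul, Complex.conj_conj, mul_comm]
  · change 0 < (∫ h, F x x h ∂μ).re
    have h1 : ∀ h, F x x h = ((∑ i, ‖e.coord i (σ h⁻¹ x)‖ ^ 2 : ℝ) : ℂ) := fun h => by
      rw [Complex.ofReal_sum]
      refine Finset.sum_congr rfl fun i _ => ?_
      rw [Complex.conj_mul', Complex.ofReal_pow]
    simp only [h1]
    rw [integral_complex_ofReal, Complex.ofReal_re]
    have h2 : Continuous fun h => ∑ i, ‖e.coord i (σ h⁻¹ x)‖ ^ 2 :=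
      continuous_finsetSum _ fun i _ => (hc i x).norm.pow 2
    refine h2.integral_pos_of_hasCompactSupport_nonneg_nonzero
      (HasCompactSupport.of_compactSpace _) (fun h => by positivity) (x := 1) fun h0 => hx ?_
    rw [Finset.sum_eq_zero_iff_of_nonneg fun _ _ => by positivity] at h0
    refine e.ext_elem fun i => ?_
    have h3 := h0 i (Finset.mem_univ _)
    rw [inv_one, map_one] at h3
    simpa using h3
  · change ∫ h, F (σ k x) (σ k y) h ∂μ = ∫ h, F x y h ∂μ
    rw [← integral_mul_left_eq_self _ k]
    congr 1
    ext h
    have : ∀ z, σ (k * h)⁻¹ (σ k z) = σ h⁻¹ z := fun z => by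
      rw [← Module.End.mul_apply, ← map_mul, mul_inv_rev, inv_mul_cancel_right]
    simp only [F, this]

variable {β : W → W →ₗ[ℂ] ℂ} (hβ : IsInvariantForm σ β)
include hβ

theorem IsInvariantForm.add_left (x x' y : W) : β (x + x') y = β x y + β x' y := by
  rw [← hβ.conj_symm, map_add, map_add, hβ.conj_symm, hβ.conj_symm]

theorem IsInvariantForm.smul_left (c : ℂ) (x y : W) : β (c • x) y = conj c * β x y := by
  rw [← hβ.conj_symm, map_smul, smul_eq_mul, map_mul, hβ.conj_symm]

theorem IsInvariantForm.im_self (x : W) : (β x x).im = 0 :=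
  Complex.conj_eq_iff_im.1 (hβ.conj_symm x x)

theorem IsInvariantForm.nonneg (x : W) : 0 ≤ (β x x).re := by
  by_cases h : x = 0
  · rw [h, map_zero, Complex.zero_re]
  · exact (hβ.pos x h).le

theorem IsInvariantForm.exists_unit [Nontrivial W] : ∃ x, β x x = 1 := by
  obtain ⟨x, hx⟩ := exists_ne (0 : W)
  have h := hβ.pos x hx
  have hr : β x x = ((β x x).re : ℂ) := Complex.ext rfl (by simp [hβ.im_self])
  refine ⟨((√(β x x).re)⁻¹ : ℂ) • x, ?_⟩
  rw [hβ.smul_left, map_smul, hr, smul_eq_mul, map_inv₀, Complex.conj_ofReal, Complex.ofReal_re,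
    ← mul_assoc, ← Complex.ofReal_inv, ← Complex.ofReal_mul, ← Complex.ofReal_mul,
    ← mul_inv, Real.mul_self_sqrt h.le, inv_mul_cancel₀ h.ne', Complex.ofReal_one]

theorem IsInvariantForm.re_le (x y : W) : (β x y).re ≤ ((β x x).re + (β y y).re) / 2 := by
  have h := hβ.nonneg (x + (-1 : ℂ) • y)
  rw [hβ.add_left, hβ.smul_left, map_add, map_add, map_smul, map_smul, ← hβ.conj_symm x y] at h
  simp at h
  linarith

theorem IsInvariantForm.norm_le {x y : W} (hx : β x x = 1) (hy : β y y = 1) : ‖β x y‖ ≤ 1 := by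
  -- A phase makes the value real, so that the bound on real parts yields Cauchy–Schwarz for unit
  -- vectors.
  obtain ⟨w, hw, hw'⟩ : ∃ w : ℂ, ‖w‖ = 1 ∧ w * β x y = ‖β x y‖ := by
    by_cases h0 : β x y = 0
    · exact ⟨1, by simp, by simp [h0]⟩
    · have h1 : (‖β x y‖ : ℂ) ≠ 0 := by simpa using h0
      refine ⟨conj (β x y) / ‖β x y‖, by simp [h0], ?_⟩
      rw [div_mul_eq_mul_div, Complex.conj_mul', div_eq_iff h1, sq]
  have h := hβ.re_le x (w • y)
  rw [map_smul, smul_eq_mul, hw', map_smul, hβ.smul_left, hx, hy, smul_eq_mul, mul_one,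
    Complex.mul_conj', hw] at h
  simpa using h

theorem IsInvariantForm.conj_matrixCoeff (x : W) (h : H) :
    conj (β x (σ h x)) = β x (σ h⁻¹ x) := by
  rw [hβ.conj_symm, ← hβ.invariant h⁻¹, ← Module.End.mul_apply, ← map_mul, inv_mul_cancel, map_one,
    Module.End.one_apply]

end InvariantForm

/-! ### Counting irreducible representations -/

section Counting

variable {H : Type*} [Group H] [TopologicalSpace H] [IsTopologicalGroup H] [CompactSpace H]

/-- Matrix coefficients of disjoint representations of a compact group are orthogonal. -/
theorem integral_matrixCoeff_eq_zero [MeasurableSpace H] [BorelSpace H] (μ : Measure H)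
    [IsProbabilityMeasure μ] [μ.IsMulLeftInvariant] {V W : Type*} [AddCommGroup V] [Module ℂ V]
    [FiniteDimensional ℂ V] [AddCommGroup W] [Module ℂ W] [FiniteDimensional ℂ W]
    {ρ : Representation ℂ H V} {σ : Representation ℂ H W} (hρ : IsContinuousRep ρ)
    (hσ : IsContinuousRep σ) (h : ∀ (f : Representation.IntertwiningMap σ ρ) x, f x = 0)
    (x : V) (φ : Module.Dual ℂ V) (y : W) (ψ : Module.Dual ℂ W) :
    ∫ h, φ (ρ h x) * ψ (σ h⁻¹ y) ∂μ = 0 := by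
  -- The integral is a matrix entry of the average of a rank-one map, an intertwiner and hence zero.
  obtain ⟨g, hg⟩ := exists_average μ hρ (isLocallyFiniteRep_of_finite ρ) hσ (ψ.smulRight x)
  have h1 := hg y φ
  rw [h, map_zero] at h1
  rw [h1]
  congr 1
  ext k
  rw [LinearMap.smulRight_apply, map_smul, map_smul, smul_eq_mul, mul_comm]

/-- A set of disjoint irreducible representations of a compact group is finite, with an explicit
bound, if they have positive definite functions that are uniformly close to `1` near `1`. -/
theorem exists_card_le {U : Set H} (hU : U ∈ 𝓝 (1 : H)) : ∃ N : ℕ, ∀ s : Finset (FDIrrep H),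
    (∀ γ ∈ s, ∃ (x : Fin γ.dim → ℂ) (ψ : Module.Dual ℂ (Fin γ.dim → ℂ)),
      (∀ h, conj (ψ (γ.ρ h x)) = ψ (γ.ρ h⁻¹ x)) ∧ (∀ h, ‖ψ (γ.ρ h x)‖ ≤ 1) ∧
      ∀ h ∈ U, 2⁻¹ ≤ (ψ (γ.ρ h x)).re) →
    (∀ γ ∈ s, ∀ γ' ∈ s, γ ≠ γ' →
      ∀ (f : Representation.IntertwiningMap γ'.ρ γ.ρ) x, f x = 0) → s.card ≤ N := by
  let _ : MeasurableSpace H := borel H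
  have : BorelSpace H := ⟨rfl⟩
  obtain ⟨μ, _, _, _⟩ := exists_haar_probability H
  obtain ⟨O, hOU, hO, hO1⟩ := mem_nhds_iff.1 hU
  have hm : 0 < μ.real O := ENNReal.toReal_pos (hO.measure_pos μ ⟨1, hO1⟩).ne' (measure_ne_top _ _)
  obtain ⟨N, hN⟩ := exists_nat_ge (4 / μ.real O)
  refine ⟨N, fun s h1 h2 => ?_⟩
  choose! x ψ hconj hnorm hre using h1
  have hcont : ∀ γ : FDIrrep H, Continuous fun h => ψ γ (γ.ρ h (x γ)) := fun γ =>
    γ.continuous _ _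
  -- Orthogonality bounds the integral of `|F|²` by the number `n` of representations, whereas `|F|
  -- ≥ n/2` on `O` bounds it below by `(n/2)² μ(O)`. Hence `n ≤ 4 / μ(O)`.
  let F : H → ℂ := fun h => ∑ γ ∈ s, ψ γ (γ.ρ h (x γ))
  have hF : Continuous F := continuous_finsetSum _ fun γ _ => hcont γ
  have e1 : ∀ h, F h * conj (F h) =
      ∑ γ ∈ s, ∑ γ' ∈ s, ψ γ (γ.ρ h (x γ)) * ψ γ' (γ'.ρ h⁻¹ (x γ')) := fun h => by
    simp only [F, map_sum, Finset.sum_mul_sum]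
    exact Finset.sum_congr rfl fun γ _ => Finset.sum_congr rfl fun γ' hγ' => by
      rw [hconj γ' hγ']
  have hint : ∀ γ γ' : FDIrrep H,
      Integrable (fun h => ψ γ (γ.ρ h (x γ)) * ψ γ' (γ'.ρ h⁻¹ (x γ'))) μ := fun γ γ' =>
    integrable_of_continuous μ ((hcont γ).mul ((hcont γ').comp continuous_inv))
  have e2 : ∫ h, F h * conj (F h) ∂μ =
      ∑ γ ∈ s, ∫ h, ψ γ (γ.ρ h (x γ)) * ψ γ (γ.ρ h⁻¹ (x γ)) ∂μ := by
    simp only [e1]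
    rw [integral_finsetSum _ fun γ _ => integrable_finsetSum _ fun γ' _ => hint γ γ']
    refine Finset.sum_congr rfl fun γ hγ => ?_
    rw [integral_finsetSum _ fun γ' _ => hint γ γ']
    refine Finset.sum_eq_single_of_mem γ hγ fun γ' hγ' hne => ?_
    exact integral_matrixCoeff_eq_zero μ γ.continuous γ'.continuous (h2 γ hγ γ' hγ' hne.symm) _ _ _ _
  have e3 : ‖∫ h, F h * conj (F h) ∂μ‖ ≤ s.card := by
    rw [e2]
    refine (norm_sum_le _ _).trans ?_
    rw [← nsmul_one, ← Finset.sum_const]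
    refine Finset.sum_le_sum fun γ hγ => ?_
    refine (norm_integral_le_of_norm_le_const (C := 1) (Eventually.of_forall fun h => ?_)).trans ?_
    · rw [norm_mul]
      exact mul_le_one₀ (hnorm γ hγ h) (norm_nonneg _) (hnorm γ hγ h⁻¹)
    · simp
  have e4 : ∀ h, F h * conj (F h) = ((‖F h‖ ^ 2 : ℝ) : ℂ) := fun h => by
    rw [Complex.mul_conj', Complex.ofReal_pow]
  have e5 : (s.card / 2 : ℝ) ^ 2 * μ.real O ≤ s.card := by
    refine le_trans ?_ e3
    simp only [e4]
    rw [integral_complex_ofReal, Complex.norm_real]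
    refine le_trans ?_ (le_abs_self _)
    have h3 : Continuous fun h => ‖F h‖ ^ 2 := hF.norm.pow 2
    have h4 : Integrable (fun h => ‖F h‖ ^ 2) μ :=
      h3.integrable_of_hasCompactSupport (HasCompactSupport.of_compactSpace _)
    calc (s.card / 2 : ℝ) ^ 2 * μ.real O = ∫ _ in O, (s.card / 2 : ℝ) ^ 2 ∂μ := by
          rw [setIntegral_const, smul_eq_mul, mul_comm]
      _ ≤ ∫ h in O, ‖F h‖ ^ 2 ∂μ := by
          refine setIntegral_mono_on (integrable_const _).integrableOn h4.integrableOn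
            hO.measurableSet fun h hh => ?_
          refine pow_le_pow_left₀ (by positivity) ?_ 2
          refine le_trans ?_ (Complex.re_le_norm _)
          rw [Complex.re_sum]
          refine le_trans ?_ (Finset.sum_le_sum fun γ hγ => hre γ hγ h (hOU hh))
          rw [Finset.sum_const, nsmul_eq_mul]
          exact le_of_eq (by ring)
      _ ≤ ∫ h, ‖F h‖ ^ 2 ∂μ := setIntegral_le_integral h4 (Eventually.of_forall fun h => by positivity)
  by_contra hlt
  have h6 : (N : ℝ) < s.card := by exact_mod_cast not_le.1 hlt
  have h7 : 4 < s.card * μ.real O := by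
    rw [← div_lt_iff₀ hm]
    exact hN.trans_lt h6
  have h8 : (0 : ℝ) < s.card := lt_of_le_of_lt (Nat.cast_nonneg N) h6
  nlinarith

/-- A representation in which finitely many irreducible representations occur, each with finite
multiplicity, is finite-dimensional. -/
theorem finiteDimensional_of_card_le {V : Type*} [AddCommGroup V] [Module ℂ V]
    {ρ : Representation ℂ H V} (hρ : IsContinuousRep ρ) (hl : IsLocallyFiniteRep ρ)
    (hfin : HasFiniteMultiplicities ρ) (N : ℕ) (hN : ∀ s : Finset (FDIrrep H),
      (∀ γ ∈ s, ∃ f : Representation.IntertwiningMap γ.ρ ρ, Function.Injective f) →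
      (∀ γ ∈ s, ∀ γ' ∈ s, γ ≠ γ' →
        ∀ (f : Representation.IntertwiningMap γ'.ρ γ.ρ) x, f x = 0) → s.card ≤ N) :
    FiniteDimensional ℂ V := by
  classical
  let Good : Finset (FDIrrep H) → Prop := fun s =>
    (∀ γ ∈ s, ∃ f : Representation.IntertwiningMap γ.ρ ρ, Function.Injective f) ∧
      ∀ γ ∈ s, ∀ γ' ∈ s, γ ≠ γ' → ∀ (f : Representation.IntertwiningMap γ'.ρ γ.ρ) x, f x = 0
  obtain ⟨s, hs, hmax⟩ : ∃ s, Good s ∧ ∀ s', Good s' → s'.card ≤ s.card := by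
    let A : Set ℕ := {n | ∃ s, Good s ∧ s.card = n}
    have hA : A.Nonempty := ⟨0, ∅, ⟨by simp, by simp⟩, rfl⟩
    have hb : BddAbove A := ⟨N, by rintro _ ⟨s, hs, rfl⟩; exact hN s hs.1 hs.2⟩
    obtain ⟨s, hs, hc⟩ := Nat.sSup_mem hA hb
    exact ⟨s, hs, fun s' hs' => hc ▸ le_csSup hb ⟨s', hs', rfl⟩⟩
  -- The isotypic component of `γ`, as the image of `Hom(γ, V) ⊗ γ`; this description makes its
  -- finite-dimensionality immediate.
  let J : FDIrrep H → Submodule ℂ V := fun γ =>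
    LinearMap.range (TensorProduct.lift (R := ℂ) (M := Representation.IntertwiningMap γ.ρ ρ)
      (N := Fin γ.dim → ℂ) (P₂ := V)
      { toFun := fun f => f.toLinearMap, map_add' := fun _ _ => rfl, map_smul' := fun _ _ => rfl })
  have hJmem : ∀ (γ : FDIrrep H) (f : Representation.IntertwiningMap γ.ρ ρ) x, f x ∈ J γ :=
    fun γ f x => ⟨f ⊗ₜ x, rfl⟩
  have hJfin : ∀ γ, FiniteDimensional ℂ (J γ) := fun γ => by
    have := hfin γ
    exact inferInstanceAs (FiniteDimensional ℂ (LinearMap.range _))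
  have hJst : ∀ γ h, ∀ y ∈ J γ, ρ h y ∈ J γ := by
    rintro γ h _ ⟨z, rfl⟩
    induction z with
    | zero => rw [map_zero, map_zero]; exact Submodule.zero_mem _
    | add a b ha hb => rw [map_add, map_add]; exact Submodule.add_mem _ ha hb
    | tmul f x =>
      change ρ h (f x) ∈ _
      rw [← intertwiningMap_apply]
      exact hJmem γ f _
  let Y : Submodule ℂ V := ⨆ γ ∈ s, J γ
  have hYst : ∀ h, ∀ y ∈ Y, ρ h y ∈ Y := fun h => by
    change Y ≤ Y.comap (ρ h)
    exact iSup₂_le fun γ hγ y hy => (le_iSup₂ (f := fun γ _ => J γ) γ hγ) (hJst γ h y hy)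
  have hYfin : FiniteDimensional ℂ Y := by
    have : Y = s.sup J := (Finset.sup_eq_iSup s J).symm
    rw [this]
    infer_instance
  -- Otherwise the quotient contains an irreducible representation, which lifts to `V` by averaging.
  -- It is disjoint from all members of `s`, as its lift meets `Y` only in zero, contradicting
  -- maximality of `s`.
  have htop : Y = ⊤ := by
    by_contra hne
    have : Nontrivial (V ⧸ Y) := Submodule.Quotient.nontrivial_iff.2 hne
    obtain ⟨γ, f, hf⟩ := exists_irrep (ρ := ρ.quotient Y hYst)
      (hρ.of_surjective Y.mkQ (fun _ _ => rfl) Y.mkQ_surjective)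
      (hl.of_surjective Y.mkQ (fun _ _ => rfl) Y.mkQ_surjective)
    obtain ⟨g, hg⟩ := exists_lift_intertwiningMap hρ hl γ.continuous Y.mkQ
      (σ := ρ.quotient Y hYst) (fun _ _ => rfl) Y.mkQ_surjective f
    have hgi : Function.Injective g := fun a b hab => hf (by rw [← hg, ← hg, hab])
    have hnot : ∀ γ' ∈ s, ∀ t : Representation.IntertwiningMap γ'.ρ γ.ρ,
        ¬ Function.Surjective t := fun γ' hγ' t ht => by
      have := nontrivial_of_isIrreducible γ.irreducible
      obtain ⟨x, hx⟩ := exists_ne (0 : Fin γ.dim → ℂ)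
      obtain ⟨z, rfl⟩ := ht x
      have h1 : g (t z) ∈ Y := (le_iSup₂ (f := fun γ _ => J γ) γ' hγ') (hJmem γ' (g.comp t) z)
      have h2 := hg (t z)
      have h3 : Y.mkQ (g (t z)) = 0 := (Submodule.Quotient.mk_eq_zero _).2 h1
      rw [h3] at h2
      exact hx (hf (h2.symm.trans (map_zero f).symm))
    have hz1 : ∀ γ' ∈ s, ∀ (t : Representation.IntertwiningMap γ'.ρ γ.ρ) x, t x = 0 :=
      fun γ' hγ' t => by
        by_contra hne
        push Not at hne
        obtain ⟨x, hx⟩ := hne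
        rcases eq_bot_or_eq_top_of_isIrreducible γ.irreducible (LinearMap.range t.toLinearMap) (by
          rintro h _ ⟨y, rfl⟩
          exact ⟨γ'.ρ h y, intertwiningMap_apply t h y⟩) with h | h
        · exact hx ((Submodule.mem_bot ℂ).1 (h ▸ ⟨x, rfl⟩ : t x ∈ (⊥ : Submodule ℂ (Fin γ.dim → ℂ))))
        · exact hnot γ' hγ' t (LinearMap.range_eq_top.1 h)
    have hz2 : ∀ γ' ∈ s, ∀ (t : Representation.IntertwiningMap γ.ρ γ'.ρ) x, t x = 0 :=
      fun γ' hγ' t => by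
        rcases eq_zero_or_injective γ.irreducible t with h | h
        · exact h
        · exfalso
          have := nontrivial_of_isIrreducible γ.irreducible
          obtain ⟨x, hx⟩ := exists_ne (0 : Fin γ.dim → ℂ)
          rcases eq_bot_or_eq_top_of_isIrreducible γ'.irreducible (LinearMap.range t.toLinearMap) (by
            rintro h _ ⟨y, rfl⟩
            exact ⟨γ.ρ h y, intertwiningMap_apply t h y⟩) with h' | h'
          · refine hx (h ?_)
            rw [map_zero]
            exact (Submodule.mem_bot ℂ).1 (h' ▸ ⟨x, rfl⟩ : t x ∈ (⊥ : Submodule ℂ (Fin γ'.dim → ℂ)))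
          · let te := LinearEquiv.ofBijective t.toLinearMap ⟨h, LinearMap.range_eq_top.1 h'⟩
            refine hnot γ' hγ' ⟨te.symm.toLinearMap, fun k => LinearMap.ext fun y => ?_⟩
              te.symm.surjective
            obtain ⟨y, rfl⟩ := te.surjective y
            change te.symm (γ'.ρ k (t y)) = γ.ρ k (te.symm (te y))
            rw [← intertwiningMap_apply, te.symm_apply_apply]
            exact te.symm_apply_apply _
    have hγs : γ ∉ s := fun hγ => hnot γ hγ (Representation.IntertwiningMap.id _)
      Function.surjective_id
    have hgood : Good (insert γ s) := by
      refine ⟨fun γ' h => ?_, fun γ₁ h₁ γ₂ h₂ hne => ?_⟩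
      · rcases Finset.mem_insert.1 h with rfl | h
        · exact ⟨g, hgi⟩
        · exact hs.1 γ' h
      · rcases Finset.mem_insert.1 h₁ with rfl | h₃
        · rcases Finset.mem_insert.1 h₂ with rfl | h₄
          · exact absurd rfl hne
          · exact hz1 γ₂ h₄
        · rcases Finset.mem_insert.1 h₂ with rfl | h₄
          · exact hz2 γ₁ h₃
          · exact hs.2 γ₁ h₃ γ₂ h₄ hne
    have := hmax _ hgood
    rw [Finset.card_insert_of_notMem hγs] at this
    omega
  rw [htop] at hYfin
  exact Module.finite_def.2 ((Submodule.fg_iff_finiteDimensional _).2 hYfin)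

end Counting

end

section

open scoped Manifold ContDiff TensorProduct ComplexConjugate




open Filter Topology

universe u v w

/-! ### Finite-dimensionality of the kernel of the Dirac operator -/

namespace ReductiveStructure

variable {E : Type u} [NormedAddCommGroup E] [NormedSpace ℝ E] {G : Type v}
  [TopologicalSpace G] [ChartedSpace E G] [Group G] [LieGroup 𝓘(ℝ, E) ∞ G]
  {R : ReductiveStructure E G} [FiniteDimensional ℝ E]

section Differential

variable {W : Type*} [AddCommGroup W] [Module ℂ W] {σ : Representation ℂ R.Ktilde W}
  {a : LieAlg E G →ₗ[ℝ] Module.End ℂ W}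

theorem IsDifferential.hasDerivAt (ha : R.IsDifferential σ a) {c : ℝ → R.Ktilde} {t : ℝ}
    {Z : LieAlg E G} (hc : R.HasVelocity (fun h => (c t)⁻¹ * c (t + h)) Z) (x : W)
    (φ : Module.Dual ℂ W) :
    HasDerivAt (fun s => φ (σ (c s) x)) (φ (σ (c t) (a Z x))) t := by
  have h1 : HasDerivAt (fun h => φ (σ (c t) (σ ((c t)⁻¹ * c (t + h)) x))) (φ (σ (c t) (a Z x))) 0 :=
    ha _ Z hc x (φ ∘ₗ σ (c t))
  have h2 : ∀ h, σ (c t) (σ ((c t)⁻¹ * c (t + h)) x) = σ (c (t + h)) x := fun h => by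
    rw [← Module.End.mul_apply, ← map_mul, mul_inv_cancel_left]
  simp only [h2] at h1
  rw [← sub_self t] at h1
  simpa only [add_sub_cancel] using h1.comp_sub_const t t

variable [FiniteDimensional ℂ W] {β : W → W →ₗ[ℂ] ℂ}

theorem IsDifferential.skew (ha : R.IsDifferential σ a) (hβ : IsInvariantForm σ β)
    {Z : LieAlg E G} (hZ : Z ∈ R.k₀) (x y : W) : β (a Z x) y = -β x (a Z y) := by
  obtain ⟨c, hc⟩ := R.exists_hasVelocity (R.mem_k₀.1 hZ)
  let e := Module.finBasis ℂ W
  -- The form is conjugate-linear on the left; this expression reduces its product rule to linear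
  -- functionals.
  have key : ∀ u v, β u v = ∑ i, e.coord i v * conj (β (e i) u) := fun u v => by
    simp only [hβ.conj_symm]
    exact apply_eq_sum_coord e (β u) v
  have h0 : ∀ z, σ (c 0) z = z := fun z => by rw [hc.1, map_one]; rfl
  have h1 : HasDerivAt (fun t => β (σ (c t) x) (σ (c t) y)) (β (a Z x) y + β x (a Z y)) 0 := by
    have h2 : HasDerivAt (fun t => ∑ i, e.coord i (σ (c t) y) * conj (β (e i) (σ (c t) x)))
        (∑ i, (e.coord i (a Z y) * conj (β (e i) (σ (c 0) x)) +
          e.coord i (σ (c 0) y) * conj (β (e i) (a Z x)))) 0 :=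
      HasDerivAt.fun_sum fun i _ =>
        HasDerivAt.mul (ha c Z hc y (e.coord i)) (HasDerivAt.star (ha c Z hc x (β (e i))))
    rw [Finset.sum_add_distrib, h0, h0, ← key, ← key, add_comm] at h2
    simpa only [← key] using h2
  have h3 : (fun t => β (σ (c t) x) (σ (c t) y)) = fun _ => β x y :=
    funext fun t => hβ.invariant _ _ _
  rw [h3] at h1
  exact eq_neg_of_add_eq_zero_left (h1.unique (hasDerivAt_const _ _))

/-- As each `a (Z_b)` is skew, the squared norms of the vectors `a (Z_b) x` add up to `-Re c`; each
one is therefore at most `|Re c|`. -/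
theorem IsDifferential.form_self_le (ha : R.IsDifferential σ a) (hβ : IsInvariantForm σ β) {c : ℂ}
    {x : W} (hx : β x x = 1) (hc : ∑ b, a (R.kBasis b) (a (R.kBasis b) x) = c • x) (b) :
    (β (a (R.kBasis b) x) (a (R.kBasis b) x)).re ≤ |c.re| := by
  have h1 : ∑ b, (β (a (R.kBasis b) x) (a (R.kBasis b) x)).re = -c.re := by
    have h2 := congrArg (fun z => (β x z).re) hc
    simp only [map_sum, map_smul, hx, smul_eq_mul, mul_one, Complex.re_sum] at h2
    rw [← h2, ← Finset.sum_neg_distrib]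
    refine Finset.sum_congr rfl fun b _ => ?_
    rw [ha.skew hβ (R.kBasis b).2, Complex.neg_re]
  refine le_trans ?_ (h1.le.trans (neg_le_abs _))
  exact Finset.single_le_sum (f := fun b => (β (a (R.kBasis b) x) (a (R.kBasis b) x)).re)
    (fun b _ => hβ.nonneg _) (Finset.mem_univ b)

theorem IsDifferential.abs_re_le (ha : R.IsDifferential σ a) (hβ : IsInvariantForm σ β) {c : ℂ}
    {x : W} (hx : β x x = 1) (hc : ∑ b, a (R.kBasis b) (a (R.kBasis b) x) = c • x)
    {Z : LieAlg E G} (hZ : Z ∈ R.k₀) (y : W) (hy : β y y = 1) :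
    |(β y (a Z x)).re| ≤ (∑ b, |R.B (R.kBasis b) Z|) * ((1 + |c.re|) / 2) := by
  have h1 : ∀ b, |(β y (a (R.kBasis b) x)).re| ≤ (1 + |c.re|) / 2 := fun b => by
    have h2 := ha.form_self_le hβ hx hc b
    have h3 := hβ.re_le y (a (R.kBasis b) x)
    have h4 := hβ.re_le ((-1 : ℂ) • y) (a (R.kBasis b) x)
    rw [hβ.smul_left, hβ.smul_left, map_smul, hy] at h4
    rw [hy] at h3
    simp at h3 h4
    rw [abs_le]
    constructor <;> linarith
  have h5 : β y (a Z x) = -∑ b, R.B (R.kBasis b) Z • β y (a (R.kBasis b) x) := by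
    conv_lhs => rw [R.eq_sum_kBasis hZ]
    rw [map_neg, map_sum, LinearMap.neg_apply, LinearMap.sum_apply, map_neg, map_sum]
    congr 1
    refine Finset.sum_congr rfl fun b _ => ?_
    rw [map_smul]
    exact (β y).map_smul_of_tower _ _
  rw [h5, Complex.neg_re, abs_neg, Complex.re_sum, Finset.sum_mul]
  refine (Finset.abs_sum_le_sum_abs _ _).trans (Finset.sum_le_sum fun b _ => ?_)
  rw [Complex.real_smul, Complex.re_ofReal_mul, abs_mul]
  exact mul_le_mul_of_nonneg_left (h1 b) (abs_nonneg _)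

end Differential

theorem exists_sum_abs_B_le (R : ReductiveStructure E G) :
    ∃ C : ℝ, 0 ≤ C ∧ ∀ Z : E, ∑ b, |R.B (R.kBasis b) (Z : LieAlg E G)| ≤ C * ‖Z‖ := by
  let L : Fin _ → (E →L[ℝ] ℝ) := fun b =>
    (show E →ₗ[ℝ] ℝ from R.B (R.kBasis b)).toContinuousLinearMap
  refine ⟨∑ b, ‖L b‖, Finset.sum_nonneg fun b _ => norm_nonneg _, fun Z => ?_⟩
  rw [Finset.sum_mul]
  exact Finset.sum_le_sum fun b _ => (L b).le_opNorm Z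

theorem exists_short_curve_B (R : ReductiveStructure E G) {δ : ℝ} (hδ : 0 < δ) :
    ∃ U ∈ 𝓝 (1 : R.Ktilde), ∀ k ∈ U, ∃ (p : ℝ → R.Ktilde) (Z : ℝ → LieAlg E G), p 0 = 1 ∧ p 1 = k ∧
      ∀ t ∈ Set.Icc (0 : ℝ) 1, ∑ b, |R.B (R.kBasis b) (Z t)| ≤ δ ∧
        R.HasVelocity (fun h => (p t)⁻¹ * p (t + h)) (Z t) := by
  obtain ⟨C, hC, hCB⟩ := R.exists_sum_abs_B_le
  -- The summand `1` avoids dividing by zero when `C = 0`.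
  obtain ⟨U, hU, hcurve⟩ := R.exists_short_curve_Ktilde (δ := δ * (C + 1)⁻¹) (by positivity)
  refine ⟨U, hU, fun k hk => ?_⟩
  obtain ⟨p, hp0, hp1, hp⟩ := hcurve k hk
  choose! Z hZ hvel using hp
  refine ⟨p, Z, hp0, hp1, fun t ht => ⟨(hCB (Z t)).trans ?_, hvel t ht⟩⟩
  refine (mul_le_mul_of_nonneg_left (hZ t ht) hC).trans ?_
  rw [mul_left_comm, ← div_eq_mul_inv]
  refine mul_le_of_le_one_right hδ.le ?_
  rw [div_le_one (by positivity)]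
  linarith

/-- Along the curve the matrix coefficient starts at `1`, and the real part of its derivative has
modulus at most `(1 + |Re c|)⁻¹ · (1 + |Re c|)/2 = 1/2`, so the mean value inequality applies. -/
theorem IsDifferential.matrixCoeff_ge {W : Type*} [AddCommGroup W] [Module ℂ W]
    [FiniteDimensional ℂ W] {σ : Representation ℂ R.Ktilde W}
    {a : LieAlg E G →ₗ[ℝ] Module.End ℂ W} {β : W → W →ₗ[ℂ] ℂ} (ha : R.IsDifferential σ a)
    (hβ : IsInvariantForm σ β) {c : ℂ} {x : W} (hx : β x x = 1)
    (hc : ∑ b, a (R.kBasis b) (a (R.kBasis b) x) = c • x) {p : ℝ → R.Ktilde} {Z : ℝ → LieAlg E G}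
    (hp0 : p 0 = 1) (hp : ∀ t ∈ Set.Icc (0 : ℝ) 1,
      ∑ b, |R.B (R.kBasis b) (Z t)| ≤ (1 + |c.re|)⁻¹ ∧
        R.HasVelocity (fun h => (p t)⁻¹ * p (t + h)) (Z t)) :
    2⁻¹ ≤ (β x (σ (p 1) x)).re := by
  have hd : ∀ t ∈ Set.Icc (0 : ℝ) 1, HasDerivWithinAt (fun s => (β x (σ (p s) x)).re)
      (β x (σ (p t) (a (Z t) x))).re (Set.Icc 0 1) t := fun t ht =>
    (Complex.reCLM.hasFDerivAt.comp_hasDerivAt t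
      (ha.hasDerivAt (hp t ht).2 x (β x))).hasDerivWithinAt
  have hb : ∀ t ∈ Set.Ico (0 : ℝ) 1, ‖(β x (σ (p t) (a (Z t) x))).re‖ ≤ 2⁻¹ := fun t ht => by
    obtain ⟨h0, h0'⟩ := hp t (Set.Ico_subset_Icc_self ht)
    have h1 : β x (σ (p t) (a (Z t) x)) = β (σ (p t)⁻¹ x) (a (Z t) x) := by
      rw [← hβ.invariant (p t)⁻¹, ← Module.End.mul_apply, ← map_mul, inv_mul_cancel, map_one,
        Module.End.one_apply]
    rw [h1, Real.norm_eq_abs]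
    refine (ha.abs_re_le hβ hx hc (R.mem_k₀.2 h0'.dθ_eq) _ (by rw [hβ.invariant, hx])).trans ?_
    refine (mul_le_mul_of_nonneg_right h0 (by positivity)).trans (le_of_eq ?_)
    have : (1 + |c.re|) ≠ 0 := by positivity
    field_simp
  have h := norm_image_sub_le_of_norm_deriv_le_segment_01' hd hb
  have e0 : (β x (σ (p 0) x)).re = 1 := by
    rw [hp0, map_one, Module.End.one_apply, hx, Complex.one_re]
  rw [e0, Real.norm_eq_abs, abs_le] at h
  linarith [h.1]

/-- The matrix coefficients of the unitary representations of `K̃` with given Casimir eigenvalue are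
uniformly close to `1` near `1`. -/
theorem exists_nhds_matrixCoeff (R : ReductiveStructure E G) (c : ℂ) :
    ∃ U ∈ 𝓝 (1 : R.Ktilde), ∀ {W : Type w} [AddCommGroup W] [Module ℂ W] [FiniteDimensional ℂ W]
      {σ : Representation ℂ R.Ktilde W} {a : LieAlg E G →ₗ[ℝ] Module.End ℂ W}
      {β : W → W →ₗ[ℂ] ℂ} {x : W}, R.IsDifferential σ a → IsInvariantForm σ β → β x x = 1 →
      ∑ b, a (R.kBasis b) (a (R.kBasis b) x) = c • x → ∀ k ∈ U, 2⁻¹ ≤ (β x (σ k x)).re := by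
  obtain ⟨U, hU, hcurve⟩ := R.exists_short_curve_B (δ := (1 + |c.re|)⁻¹) (by positivity)
  refine ⟨U, hU, fun {W} _ _ _ {σ a β x} ha hβ hx hc k hk => ?_⟩
  obtain ⟨p, Z, hp0, rfl, hp⟩ := hcurve k hk
  exact ha.matrixCoeff_ge hβ hx hc hp0 hp

section Kernel

/-- The inclusion of the kernel of an equivariant operator. -/
def kerInclusion {H V : Type*} [Group H] [AddCommGroup V] [Module ℂ V] (ρ : Representation ℂ H V)
    (T : Module.End ℂ V) (hT : ∀ h y, ρ h (T y) = T (ρ h y)) :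
    Representation.IntertwiningMap (kerRep ρ T hT) ρ :=
  ⟨(LinearMap.ker T).subtype, fun _ => rfl⟩

variable {V : Type*} [AddCommGroup V] [Module ℂ V] {ρ : Representation ℂ R.Ktilde V}
  {d : LieAlg E G →ₗ[ℝ] Module.End ℂ V} {T : Module.End ℂ V} {c : ℂ}

/-- On the kernel of `T` the identity `T² = 0` forces the sum of the squares of the differential
over the basis of `𝔨₀` to be `c`, the same for every `σ`. Hence the neighbourhood `U` can be chosen
independently of `σ`. -/
theorem IsCasimirSqrt.exists_matrixCoeff (hT : R.IsCasimirSqrt d c T) (hd : R.IsDifferential ρ d)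
    (hρT : ∀ h y, ρ h (T y) = T (ρ h y)) :
    ∃ U ∈ 𝓝 (1 : R.Ktilde), ∀ {W : Type w} [AddCommGroup W] [Module ℂ W] [FiniteDimensional ℂ W]
      [Nontrivial W] {σ : Representation ℂ R.Ktilde W} (_ : IsContinuousRep σ)
      (f : Representation.IntertwiningMap σ (kerRep ρ T hρT)) (_ : Function.Injective f),
      ∃ (x : W) (ψ : Module.Dual ℂ W), (∀ h, conj (ψ (σ h x)) = ψ (σ h⁻¹ x)) ∧
        (∀ h, ‖ψ (σ h x)‖ ≤ 1) ∧ ∀ h ∈ U, 2⁻¹ ≤ (ψ (σ h x)).re := by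
  obtain ⟨U, hU, h⟩ := R.exists_nhds_matrixCoeff c
  refine ⟨U, hU, fun {W} _ _ _ _ {σ} hσ f₀ hf₀ => ?_⟩
  let f := (kerInclusion ρ T hρT).comp f₀
  have hf : Function.Injective f := Subtype.val_injective.comp hf₀
  have hf0 : ∀ x, T (f x) = 0 := fun x => (f₀ x).2
  obtain ⟨a, ha⟩ := hd.exists_of_injective f hf
  obtain ⟨β, hβ⟩ := exists_isInvariantForm hσ
  obtain ⟨x, hx⟩ := hβ.exists_unit
  refine ⟨x, β x, hβ.conj_matrixCoeff x, fun k => hβ.norm_le hx (by rw [hβ.invariant, hx]),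
    h ha hβ hx ?_⟩
  have h1 := hT.sq_apply hd ha f x
  rw [hf0, map_zero] at h1
  exact (sub_eq_zero.1 (hf (h1.symm.trans (map_zero f).symm))).symm

/-- The kernel of `T` is finite-dimensional. -/
theorem IsCasimirSqrt.finiteDimensional_ker (hT : R.IsCasimirSqrt d c T) (hd : R.IsDifferential ρ d)
    (hρ : IsContinuousRep ρ) (hl : IsLocallyFiniteRep ρ) (hfin : HasFiniteMultiplicities ρ)
    (hρT : ∀ h y, ρ h (T y) = T (ρ h y)) : FiniteDimensional ℂ (LinearMap.ker T) := by
  obtain ⟨U, hU, h⟩ := hT.exists_matrixCoeff hd hρT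
  obtain ⟨N, hN⟩ := exists_card_le hU
  refine finiteDimensional_of_card_le (ρ := kerRep ρ T hρT)
    (hρ.of_injective (LinearMap.ker T).subtype (fun _ _ => rfl) Subtype.val_injective)
    (hl.of_injective (LinearMap.ker T).subtype (fun _ _ => rfl) Subtype.val_injective)
    (fun γ => ?_) N fun s h1 h2 => hN s (fun γ hγ => ?_) h2
  · have := hfin γ
    exact finite_intertwiningMap_restrictRep _
  · have := nontrivial_of_isIrreducible γ.irreducible
    exact (h1 γ hγ).elim fun f hf => h (W := Fin γ.dim → ℂ) (σ := γ.ρ) γ.continuous f hf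

end Kernel

end ReductiveStructure

namespace GKModule

attribute [local instance 100] LieRing.ofAssociativeRing

variable {E : Type u} [NormedAddCommGroup E] [NormedSpace ℝ E] [CompleteSpace E]
    {G : Type v} [TopologicalSpace G] [ChartedSpace E G] [Group G] [LieGroup 𝓘(ℝ, E) ∞ G]
    {R : ReductiveStructure E G} {X : Type w} [AddCommGroup X] [Module ℂ X] (M : GKModule R X)
    (P : R.Polarization) [FiniteDimensional ℝ E] [T2Space G]

theorem finiteDimensional_ker_diracOp (hadm : M.IsAdmissible) (hinf : M.HasInfinitesimalCharacter) :
    FiniteDimensional ℂ (LinearMap.ker (M.diracOp P)) := by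
  obtain ⟨c, hc⟩ := M.exists_isCasimirSqrt_diracOp P hinf
  exact hc.finiteDimensional_ker (M.isDifferential_diagActₗ P) (M.isContinuousRep_repXS P)
    (M.isLocallyFiniteRep_repXS P) (M.hasFiniteMultiplicities_repXS P hadm) (M.repXS_diracOp P)

end GKModule

end

/-! ### Parity of the Dirac operator and the conclusion -/

section

universe u v w

theorem isCompl_range_lTensor {S : Type*} (X : Type*) [AddCommGroup S] [Module ℂ S]
    [AddCommGroup X] [Module ℂ X] {A A' : Submodule ℂ S} (h : IsCompl A A') :
    IsCompl (LinearMap.range (A.subtype.lTensor X)) (LinearMap.range (A'.subtype.lTensor X)) := by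
  refine ⟨Submodule.disjoint_def.2 fun y hy hy' => ?_, codisjoint_iff.2 (eq_top_iff.2 fun y _ => ?_)⟩
  -- The projection onto `A` along `A'`, tensored with `X`, is the identity on one range and zero on
  -- the other.
  · let p : S →ₗ[ℂ] S := A.subtype ∘ₗ A.projectionOnto A' h
    have e1 : p ∘ₗ A.subtype = A.subtype := LinearMap.ext fun x =>
      congrArg Subtype.val (Submodule.projectionOnto_apply_left h x)
    have e2 : p ∘ₗ A'.subtype = 0 := LinearMap.ext fun x =>
      congrArg Subtype.val (Submodule.projectionOnto_apply_right h x)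
    obtain ⟨z, hz⟩ := hy
    obtain ⟨z', hz'⟩ := hy'
    have h1 : p.lTensor X y = y := by
      rw [← hz, ← LinearMap.comp_apply, ← LinearMap.lTensor_comp, e1]
    have h2 : p.lTensor X y = 0 := by
      rw [← hz', ← LinearMap.comp_apply, ← LinearMap.lTensor_comp, e2, LinearMap.lTensor_zero,
        LinearMap.zero_apply]
    rw [← h1, h2]
  · induction y with
    | zero => exact Submodule.zero_mem _
    | add a b ha hb => exact Submodule.add_mem _ (ha trivial) (hb trivial)
    | tmul x s =>
      obtain ⟨a, ha, b, hb, rfl⟩ := Submodule.mem_sup.1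
        (h.sup_eq_top ▸ Submodule.mem_top : s ∈ A ⊔ A')
      rw [TensorProduct.tmul_add]
      exact Submodule.add_mem_sup ⟨x ⊗ₜ ⟨a, ha⟩, rfl⟩ ⟨x ⊗ₜ ⟨b, hb⟩, rfl⟩

namespace GKModule

attribute [local instance 100] LieRing.ofAssociativeRing

variable {E : Type u} [NormedAddCommGroup E] [NormedSpace ℝ E] [CompleteSpace E]
    {G : Type v} [TopologicalSpace G] [ChartedSpace E G] [Group G] [LieGroup 𝓘(ℝ, E) ∞ G]
    {R : ReductiveStructure E G} {X : Type w} [AddCommGroup X] [Module ℂ X] (M : GKModule R X)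
    (P : R.Polarization) [FiniteDimensional ℝ E] [T2Space G]

theorem isCompl_XS : IsCompl (M.XS P 0) (M.XS P 1) :=
  isCompl_range_lTensor X (CliffordAlgebra.evenOdd_isCompl (0 : QuadraticForm ℂ P.W))

/-- The Dirac operator is odd. -/
theorem diracOp_mem_XS (ε : ZMod 2) {y : X ⊗[ℂ] P.S} (hy : y ∈ M.XS P ε) :
    M.diracOp P y ∈ M.XS P (ε + 1) := by
  obtain ⟨z, rfl⟩ := hy
  induction z with
  | zero => rw [map_zero, map_zero]; exact Submodule.zero_mem _
  | add a b ha hb => rw [map_add, map_add]; exact Submodule.add_mem _ ha hb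
  | tmul x s =>
    rw [LinearMap.lTensor_tmul, diracOp_tmul]
    exact Submodule.sum_mem _ fun i _ =>
      ⟨M.actReal x _ ⊗ₜ ⟨_, P.cliffordMap_mem_halfSpin _ ε s.2⟩, rfl⟩

theorem isContinuousRep_repHDirPart (ε : ZMod 2) : IsContinuousRep (M.repHDirPart P ε) := by
  have h1 : IsContinuousRep (kerRep (M.repXS P) (M.diracOp P) (M.repXS_diracOp P)) :=
    (M.isContinuousRep_repXS P).of_injective (LinearMap.ker (M.diracOp P)).subtype (fun _ _ => rfl)
      Subtype.val_injective
  have h2 : IsContinuousRep (M.repHDir P) :=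
    h1.of_surjective (kerInterRange (M.diracOp P)).mkQ (fun _ _ => rfl)
      (kerInterRange (M.diracOp P)).mkQ_surjective
  exact h2.of_injective (M.HDirPart P ε).subtype (fun _ _ => rfl) Subtype.val_injective

theorem finiteDimensional_HDirPart (hadm : M.IsAdmissible) (hinf : M.HasInfinitesimalCharacter)
    (ε : ZMod 2) : FiniteDimensional ℂ (M.HDirPart P ε) := by
  have := M.finiteDimensional_ker_diracOp P hadm hinf
  infer_instance

/-- The Dirac index is the difference of the tensor products with the half-spin modules. -/
theorem diracIndex_eq_spinDifference (hadm : M.IsAdmissible)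
    (hinf : M.HasInfinitesimalCharacter) : M.diracIndex P = M.spinDifference P := funext fun γ => by
  obtain ⟨c, hc⟩ := M.exists_isCasimirSqrt_diracOp P hinf
  obtain ⟨s, hs⟩ := hc.exists_scalar (M.isDifferential_diagActₗ P) (M.repXS_diracOp P) γ.irreducible
  exact multiplicity_sub_cohomologyPart (M.repXS_diracOp P) (M.isContinuousRep_repXS P)
    (M.isLocallyFiniteRep_repXS P) (fun h _ hy => M.repXS_mem_XS P h 0 hy)
    (fun h _ hy => M.repXS_mem_XS P h 1 hy) (M.isCompl_XS P).disjoint (M.isCompl_XS P).sup_eq_top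
    (fun _ hy => M.diracOp_mem_XS P 0 hy) (fun _ hy => M.diracOp_mem_XS P 1 hy) γ
    (M.hasFiniteMultiplicities_repXSpart P hadm 0 γ)
    (M.hasFiniteMultiplicities_repXSpart P hadm 1 γ) hs

end GKModule

end

end DiracIndex

end

theorem mainTheorem5 {E : Type*} [NormedAddCommGroup E] [NormedSpace ℝ E] [FiniteDimensional ℝ E]
    [CompleteSpace E] {G : Type*} [TopologicalSpace G] [T2Space G] [ConnectedSpace G]
    [ChartedSpace E G] [Group G] [LieGroup 𝓘(ℝ, E) ∞ G]
    (R : DiracIndex.ReductiveStructure E G) (P : R.Polarization)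
    {X : Type*} [AddCommGroup X] [Module ℂ X] (M : DiracIndex.GKModule R X)
    (hadm : M.IsAdmissible) (hinf : M.HasInfinitesimalCharacter) :
    (∀ ε : ZMod 2, FiniteDimensional ℂ (M.HDirPart P ε) ∧
        DiracIndex.IsContinuousRep (M.repHDirPart P ε)) ∧
      (∀ ε : ZMod 2, DiracIndex.HasFiniteMultiplicities (M.repXSpart P ε)) ∧
      M.diracIndex P = M.spinDifference P :=
  ⟨fun ε => ⟨M.finiteDimensional_HDirPart P hadm hinf ε, M.isContinuousRep_repHDirPart P ε⟩,
    M.hasFiniteMultiplicities_repXSpart P hadm, M.diracIndex_eq_spinDifference P hadm hinf⟩
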